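/- Let $n\ge 2$ and $2\le k\le n+1$. Let $Y\subset\mathbb C^{n+1}$ be the open ball of radius $R>0$ around the origin with the standard symplectic form $\omega_Y$ and the $T^k$-action $\rho_s(y)=(e^{is_1}y_1,\dots,e^{is_k}y_k,y_{k+1},\dots,y_{n+1})$. Let $J_Y$ be a complex structure on $Y$ tamed by $\omega_Y$, which at the origin is $\omega_Y$-compatible and $T^k$-invariant. Let $p$ be a $J_Y$-meromorphic function on $Y$ with $p(\rho_s(y))=e^{i(-s_1+s_2+\dots+s_k)}p(y)$, so that $p(y)=\frac{y_2\cdots y_k}{y_1}\,q(y)$ with $q$ a $T^k$-invariant function, i.e. a function of $|y_1|^2/2,\dots,|y_k|^2/2,y_{k+1},\dots,y_{n+1}$; assume that $q$ is smooth on $Y$, $q(0)=1$, and $q$ has no zeros. Let $\eta_Y$ be a $J_Y$-complex volume form (a smooth nowhere vanishing form of type $(n+1,0)$) on $\{y\in Y: y_2\cdots y_k\neq 0\}$ such that $y_2\cdots y_k\,\eta_Y$ extends smoothly to $Y$, with value $dy_1\wedge\dots\wedge dy_{n+1}$ at $y=0$. For $\zeta\ne 0$ let $Y_\zeta=p^{-1}(\zeta)\subset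 Y\setminus\{y_1=0\}$, with the complex volume form $\eta_{Y_\zeta}=\eta_Y/(d\zeta/\zeta^2)$ and the phase $\alpha_{Y_\zeta}(\Lambda^v)=\eta_{Y_\zeta}(e_1\wedge\dots\wedge e_n)^2/|\eta_{Y_\zeta}(e_1\wedge\dots\wedge e_n)|^2$ of a Lagrangian subspace $\Lambda^v=\mathrm{span}_{\mathbb R}\{e_1,\dots,e_n\}\subset T_yY_\zeta$. Let $\psi_t$ be the flow on $Y\setminus\{y_1=0\}$ of the horizontal lift $Z$ of $-i\zeta\partial_\zeta$, that is, $Dp(Z)=-ip$ and $Z$ is $\omega_Y$-orthogonal to $\ker Dp$. The $d$-fold monodromy is $h_\zeta^d=\psi_{2\pi d}|_{Y_\zeta}$; it is well-defined near $y\in Y_\zeta$ if the flow $\psi_t$, $0\le t\le 2\pi d$, exists and is smooth on a neighbourhood of $y$. Its graded phase is $\tilde\alpha_{h_\zeta^d}(\Lambda^v)=\theta(2\pi d)$, where $\theta:[0,2\pi d]\to\mathbb R$ is continuous, $\theta(0)=0$ and $e^{2\pi i\theta(t)}=\alpha_{Y_{e^{-it}\zeta}}(D\psi_t(\Lambda^v))/\alpha_{Y_\zeta}(\Lambda^v)$.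 Then for every integer $d>0$ and every $\epsilon>0$ there are $R\ge\delta_1>\delta_2>0$ such that, for all $\zeta\in\mathbb C$ with $0<|\zeta|<\delta_1$ and all $y\in Y_\zeta$ with $\|y\|<\delta_1$ and $|y_1|>\delta_2$, the $d$-fold monodromy $h_\zeta^d$ is well-defined near $y$, its graded phase exists at every Lagrangian subspace $\Lambda^v\subset T_yY_\zeta$, and, provided $|y_2|\le|y_3|\le\dots\le|y_k|$, $$\tilde\alpha_{h_\zeta^d}(\Lambda^v)\le -2d\,\frac{1}{1+|\zeta|^2/|y_3|^{2(k-1)}}+n+1+\epsilon$$ for all Lagrangian subspaces $\Lambda^v\subset T_yY_\zeta$. Here the fraction is read as $|y_3|^{2(k-1)}/(|y_3|^{2(k-1)}+|\zeta|^2)$, i.e. as $0$ if $y_3=0$ (possible only for $k=2$). -/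

import Mathlib

open scoped ContDiff

namespace SeidelLocal

/-- The ambient space `ℂ^(n+1)` with its Euclidean norm; the coordinates `y_1, …, y_(n+1)` are
`y 0, …, y n`. -/
abbrev E (n : ℕ) : Type := EuclideanSpace ℂ (Fin (n + 1))

/-- The standard symplectic form `∑ dx_j ∧ dy_j`, so that `ω(v, i v) = ‖v‖²`. -/
def omega {n : ℕ} (v w : E n) : ℝ := ∑ j, ((starRingEnd ℂ) (v j) * w j).im

/-- The action `ρ_s` of `T^k` on the first `k` coordinates. -/
noncomputable def rho {n k : ℕ} (s : Fin k → ℝ) (y : E n) : E n :=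
  WithLp.toLp 2 fun j : Fin (n + 1) =>
    if h : (j : ℕ) < k then Complex.exp (Complex.I * (s ⟨j, h⟩ : ℂ)) * y j else y j

/-- The weight `-s_1 + s_2 + ⋯ + s_k`. -/
def weight {k : ℕ} (s : Fin k → ℝ) : ℝ := ∑ j : Fin k, if (j : ℕ) = 0 then -s j else s j

/-- The monomial `y_2 ⋯ y_k`. -/
noncomputable def tailProd {n : ℕ} (k : ℕ) (y : E n) : ℂ :=
  ∏ j ∈ Finset.univ.filter (fun j : Fin (n + 1) => 0 < (j : ℕ) ∧ (j : ℕ) < k), y j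

/-- A smooth complex valued function on `U` is `J`-holomorphic if its real derivative
intertwines `J` and multiplication by `i`. -/
def IsHolo {n : ℕ} (J : E n → E n →L[ℝ] E n) (U : Set (E n)) (f : E n → ℂ) : Prop :=
  ContDiffOn ℝ ∞ f U ∧ ∀ y ∈ U, ∀ v, fderiv ℝ f y (J y v) = Complex.I * fderiv ℝ f y v

/-- `J` is a (smooth, integrable) complex structure on the open set `Y`: `J² = -1`, and around
each point there are `J`-holomorphic functions forming a coordinate system. -/
structure IsComplexStructure {n : ℕ} (Y : Set (E n)) (J : E n → E n →L[ℝ] E n) : Prop where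
  smooth : ContDiffOn ℝ ∞ J Y
  sq : ∀ y ∈ Y, ∀ v, J y (J y v) = -v
  charts : ∀ x ∈ Y, ∃ U : Set (E n), IsOpen U ∧ x ∈ U ∧ U ⊆ Y ∧
    ∃ φ : E n → E n, (∀ j, IsHolo J U fun y => φ y j) ∧
      ∀ y ∈ U, Function.Bijective (fderiv ℝ φ y)

/-- `p` is a `J`-meromorphic function on `Y`: locally it is a quotient `f / g` of `J`-holomorphic
functions, where `g` does not vanish identically on any nonempty open subset. -/
def IsMero {n : ℕ} (J : E n → E n →L[ℝ] E n) (Y : Set (E n)) (p : E n → ℂ) : Prop :=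
  ∀ x ∈ Y, ∃ U : Set (E n), IsOpen U ∧ x ∈ U ∧ U ⊆ Y ∧
    ∃ f g : E n → ℂ, IsHolo J U f ∧ IsHolo J U g ∧
      U ⊆ closure {y ∈ U | g y ≠ 0} ∧ ∀ y ∈ U, g y ≠ 0 → p y = f y / g y

/-- Complex valued real-multilinear alternating `(n+1)`-forms on `ℂ^(n+1)`. -/
abbrev Form (n : ℕ) : Type := E n [⋀^Fin (n + 1)]→L[ℝ] ℂ

/-- `η` is a `J`-complex volume form on `S`: a smooth, nowhere vanishing form of type `(n+1, 0)`
with respect to `J`. -/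
structure IsComplexVolumeForm {n : ℕ} (J : E n → E n →L[ℝ] E n) (S : Set (E n))
    (η : E n → Form n) : Prop where
  smooth : ContDiffOn ℝ ∞ η S
  type : ∀ y ∈ S, ∀ (v : Fin (n + 1) → E n) (i : Fin (n + 1)),
    η y (Function.update v i (J y (v i))) = Complex.I * η y v
  ne_zero : ∀ y ∈ S, η y ≠ 0

/-- A form of type `(n+1, 0)` vanishes on `n+1` vectors of a complex subspace of complex
dimension at most `n`. -/
theorem form_eq_zero {n : ℕ} (A : Form n) (j : E n →L[ℝ] E n)
    (hA : ∀ (v : Fin (n + 1) → E n) (i : Fin (n + 1)),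
      A (Function.update v i (j (v i))) = Complex.I * A v)
    (D : E n →L[ℝ] ℂ) (hD : ∀ v, D (j v) = Complex.I * D v) (w : E n) (hw : D w ≠ 0)
    (u : Fin (n + 1) → E n) (hu : ∀ i, D (u i) = 0) : A u = 0 := by
  have hsurj : LinearMap.range D.toLinearMap = ⊤ := by
    rw [LinearMap.range_eq_top]
    intro c
    refine ⟨(c / D w).re • w + (c / D w).im • j w, ?_⟩
    simp only [ContinuousLinearMap.coe_coe, map_add, map_smul, hD, Complex.real_smul]
    have h := Complex.re_add_im (c / D w)
    calc _ = (((c / D w).re : ℂ) + ((c / D w).im : ℂ) * Complex.I) * D w := by ring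
      _ = c := by rw [h]; field_simp
  have hrank := LinearMap.finrank_range_add_finrank_ker D.toLinearMap
  have hE : Module.finrank ℝ (E n) = 2 * (n + 1) := by
    rw [finrank_real_of_complex, finrank_euclideanSpace_fin]
  rw [hsurj, finrank_top, Complex.finrank_real_complex, hE] at hrank
  let L : (Fin (n + 1) → ℂ) →ₗ[ℝ] E n :=
    ∑ i, ((Complex.reLm.comp (LinearMap.proj i : (Fin (n + 1) → ℂ) →ₗ[ℝ] ℂ)).smulRight (u i) +
      (Complex.imLm.comp (LinearMap.proj i : (Fin (n + 1) → ℂ) →ₗ[ℝ] ℂ)).smulRight (j (u i)))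
  have hL : ∀ c, L c = ∑ i, ((c i).re • u i + (c i).im • j (u i)) := by
    intro c; simp [L, LinearMap.sum_apply]
  have hLmem : ∀ c, L c ∈ LinearMap.ker D.toLinearMap := by
    intro c
    rw [hL]
    refine Submodule.sum_mem _ fun i _ => ?_
    simp [LinearMap.mem_ker, hD, hu]
  obtain ⟨c, hc, hc0⟩ : ∃ c, L c = 0 ∧ c ≠ 0 := by
    have hker : LinearMap.ker (L.codRestrict _ hLmem) ≠ ⊥ := by
      apply LinearMap.ker_ne_bot_of_finrank_lt
      rw [Module.finrank_pi_fintype]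
      simp only [Complex.finrank_real_complex, Finset.sum_const, Finset.card_univ, Fintype.card_fin,
        smul_eq_mul]
      omega
    obtain ⟨c, hc, hc0⟩ := Submodule.exists_mem_ne_zero_of_ne_bot hker
    refine ⟨c, ?_, hc0⟩
    have := congrArg Subtype.val (LinearMap.mem_ker.1 hc)
    simpa using this
  obtain ⟨i₀, hi₀⟩ := Function.ne_iff.1 hc0
  have key : ∀ x, A (Function.update u i₀ (j x)) = Complex.I * A (Function.update u i₀ x) := by
    intro x
    have := hA (Function.update u i₀ x) i₀
    simpa using this
  have hzero : A (Function.update u i₀ (L c)) = 0 := by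
    rw [hc]; exact A.map_update_zero u i₀
  have hoff : ∀ i, i ≠ i₀ → A (Function.update u i₀ (u i)) = 0 := by
    intro i hi
    apply A.map_eq_zero_of_eq _ (i := i) (j := i₀) _ hi
    simp [hi]
  let B : E n →ₗ[ℝ] ℂ := A.toMultilinearMap.toLinearMap u i₀
  have hB : ∀ x, B x = A (Function.update u i₀ x) := fun x => rfl
  rw [← hB, hL, map_sum, Finset.sum_eq_single i₀] at hzero
  · rw [map_add, map_smul, map_smul, hB, hB, key, Function.update_eq_self, Complex.real_smul,
      Complex.real_smul] at hzero
    have h2 : c i₀ * A u = 0 := by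
      calc c i₀ * A u = (((c i₀).re : ℂ) + ((c i₀).im : ℂ) * Complex.I) * A u := by
            rw [Complex.re_add_im]
        _ = 0 := by rw [← hzero]; ring
    exact (mul_eq_zero.1 h2).resolve_left hi₀
  · intro i _ hi
    rw [map_add, map_smul, map_smul, hB, hB, key, hoff i hi]; simp
  · simp

/-- The contraction `A (w, v_1, …, v_n) / D w` with `v_i ∈ ker D` does not depend on `w`. -/
theorem contraction_eq {n : ℕ} (A : Form n) (j : E n →L[ℝ] E n)
    (hA : ∀ (v : Fin (n + 1) → E n) (i : Fin (n + 1)),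
      A (Function.update v i (j (v i))) = Complex.I * A v)
    (D : E n →L[ℝ] ℂ) (hD : ∀ v, D (j v) = Complex.I * D v) (w w' : E n) (hw : D w ≠ 0)
    (hw' : D w' ≠ 0) (v : Fin n → E n) (hv : ∀ i, D (v i) = 0) :
    A (Matrix.vecCons w v) / D w = A (Matrix.vecCons w' v) / D w' := by
  have key : ∀ x, A (Matrix.vecCons (j x) v) = Complex.I * A (Matrix.vecCons x v) := by
    intro x
    have := hA (Matrix.vecCons x v) 0
    rwa [Matrix.vecCons, Fin.update_cons_zero] at this
  let B : E n →ₗ[ℝ] ℂ := A.toMultilinearMap.toLinearMap (Matrix.vecCons 0 v) 0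
  have hB : ∀ x, B x = A (Matrix.vecCons x v) := by
    intro x
    have : B x = A (Function.update (Matrix.vecCons 0 v) 0 x) := rfl
    rw [this, Matrix.vecCons, Fin.update_cons_zero]; rfl
  set b := D w' with hb
  set a := D w with ha
  set x := (b.re • w + b.im • j w) - (a.re • w' + a.im • j w') with hx
  have hDx : D x = 0 := by
    rw [hx]
    simp only [map_sub, map_add, map_smul, hD, Complex.real_smul, ← ha, ← hb]
    calc _ = ((b.re : ℂ) + b.im * Complex.I) * a - ((a.re : ℂ) + a.im * Complex.I) * b := by ring
      _ = 0 := by rw [Complex.re_add_im, Complex.re_add_im]; ring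
  have h0 : A (Matrix.vecCons x v) = 0 := by
    refine form_eq_zero A j hA D hD w hw _ fun i => ?_
    refine Fin.cases ?_ (fun i => ?_) i
    · simpa using hDx
    · simpa using hv i
  rw [← hB, hx] at h0
  simp only [map_sub, map_add, map_smul, Complex.real_smul] at h0
  rw [hB, hB, hB, hB, key, key] at h0
  rw [div_eq_div_iff hw hw']
  have : ((b.re : ℂ) + b.im * Complex.I) * A (Matrix.vecCons w v)
      - ((a.re : ℂ) + a.im * Complex.I) * A (Matrix.vecCons w' v) = 0 := by
    rw [← h0]; ring
  rw [Complex.re_add_im, Complex.re_add_im] at this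
  linear_combination this

/-- The local model `(Y, ω_Y, J_Y, η_Y, p)`. The function `p` takes its values in
`ℂ` off its poles `{y_1 = 0}`; its values as a total function on `{y_1 = 0}` carry no meaning. The
`T^k`-invariance of `q`, i.e. the form `q(|y_1|²/2, …, |y_k|²/2, y_(k+1), …, y_(n+1))`, follows
from `equivariant` and `factor`. -/
structure LocalModel (n k : ℕ) where
  /-- The radius of the open ball `Y`. -/
  R : ℝ
  R_pos : 0 < R
  /-- The complex structure `J_Y`. -/
  J : E n → E n →L[ℝ] E n
  complex : IsComplexStructure (Metric.ball 0 R) J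
  tamed : ∀ y ∈ Metric.ball (0 : E n) R, ∀ v, v ≠ 0 → 0 < omega v (J y v)
  compatible_zero : ∀ v w, omega (J 0 v) (J 0 w) = omega v w
  invariant_zero : ∀ (s : Fin k → ℝ) (v : E n), J 0 (rho s v) = rho s (J 0 v)
  /-- The meromorphic function `p`. -/
  p : E n → ℂ
  /-- The smooth factor `q`. -/
  q : E n → ℂ
  mero : IsMero J (Metric.ball 0 R) p
  equivariant : ∀ (s : Fin k → ℝ), ∀ y ∈ Metric.ball (0 : E n) R, y 0 ≠ 0 →
    p (rho s y) = Complex.exp (Complex.I * (weight s : ℂ)) * p y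
  factor : ∀ y ∈ Metric.ball (0 : E n) R, y 0 ≠ 0 → p y = tailProd k y / y 0 * q y
  q_smooth : ContDiffOn ℝ ∞ q (Metric.ball 0 R)
  q_zero : q 0 = 1
  q_ne_zero : ∀ y ∈ Metric.ball (0 : E n) R, q y ≠ 0
  /-- The complex volume form `η_Y`, defined off the divisor `{y_2 ⋯ y_k = 0}` of zeros of `p`. -/
  η : E n → Form n
  volume_form : IsComplexVolumeForm J {y ∈ Metric.ball (0 : E n) R | tailProd k y ≠ 0} η
  /-- `y_2 ⋯ y_k η_Y` extends smoothly to `Y`, with value `dy_1 ∧ ⋯ ∧ dy_(n+1)` at `0`. -/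
  extends_smoothly : ∃ Θ : E n → Form n, ContDiffOn ℝ ∞ Θ (Metric.ball 0 R) ∧
    (∀ y ∈ Metric.ball (0 : E n) R, tailProd k y ≠ 0 → Θ y = tailProd k y • η y) ∧
    ∀ v : Fin (n + 1) → E n, Θ 0 v = Matrix.det (Matrix.of fun i j => v i j)

namespace LocalModel

variable {n k : ℕ} (M : LocalModel n k)

/-- `Y` without the poles of `p`. -/
def dom : Set (E n) := {y ∈ Metric.ball (0 : E n) M.R | y 0 ≠ 0}

/-- The fibre `Y_ζ = p⁻¹(ζ)`. -/
def fiber (ζ : ℂ) : Set (E n) := {y ∈ M.dom | M.p y = ζ}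

/-- `w` is the horizontal lift at `y` of the tangent vector `c ∈ T_(p(y)) ℂ = ℂ`: it maps to `c`
under `Dp`, and it is symplectically orthogonal to the tangent space `ker Dp` of the fibre. -/
def IsHorizontalLift (y : E n) (c : ℂ) (w : E n) : Prop :=
  fderiv ℝ M.p y w = c ∧ ∀ v, fderiv ℝ M.p y v = 0 → omega w v = 0

/-- `ψ` is, for times in `[0, T]` and initial points in `U`, the flow in `Y` minus the poles of `p`
of the horizontal lift `Z` of the vector field `-i ζ ∂_ζ`. As `p (ψ t x) = exp (-i t) p x`, the map
`ψ t` is parallel transport along the circle `|ζ| = const`, and `ψ (2 π d)` is the `d`-fold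
monodromy of each fibre. -/
structure IsParallelTransport (T : ℝ) (U : Set (E n)) (ψ : ℝ → E n → E n) : Prop where
  zero : ∀ x ∈ U, ψ 0 x = x
  mem : ∀ t ∈ Set.Icc 0 T, ∀ x ∈ U, ψ t x ∈ M.dom
  smooth : ∀ t ∈ Set.Icc 0 T, ContDiffOn ℝ ∞ (ψ t) U
  flow : ∀ t ∈ Set.Icc 0 T, ∀ x ∈ U, ∃ w : E n,
    M.IsHorizontalLift (ψ t x) (-Complex.I * M.p (ψ t x)) w ∧
      HasDerivWithinAt (fun s => ψ s x) w (Set.Icc 0 T) t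

/-- `Λ` is a Lagrangian subspace of `T_y Y_ζ = ker Dp_y`, where `ζ = p(y)`. -/
structure IsLagrangian (y : E n) (Λ : Submodule ℝ (E n)) : Prop where
  tangent : ∀ v ∈ Λ, fderiv ℝ M.p y v = 0
  isotropic : ∀ v ∈ Λ, ∀ w ∈ Λ, omega v w = 0
  finrank_eq : Module.finrank ℝ Λ = n

/-- The complex volume form `η_(Y_ζ) = η_Y / (dζ / ζ²)` on the fibre through `y`, evaluated on
vectors `v_1, …, v_n` of `T_y Y_ζ`: it is `ζ² η_Y (w, v_1, …, v_n) / Dp(w)` for any `w` with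
`Dp(w) ≠ 0`; see `fiberForm_eq`. -/
noncomputable def fiberForm (y : E n) (v : Fin n → E n) : ℂ :=
  M.p y ^ 2 *
    M.η y (Matrix.vecCons (Classical.epsilon fun w => fderiv ℝ M.p y w ≠ 0) v) /
    fderiv ℝ M.p y (Classical.epsilon fun w => fderiv ℝ M.p y w ≠ 0)

theorem isOpen_dom : IsOpen M.dom :=
  Metric.isOpen_ball.inter ((isOpen_ne_fun (by fun_prop) continuous_const))

theorem tailProd_contDiff : ContDiff ℝ ∞ (tailProd (n := n) k) := by
  unfold tailProd
  refine contDiff_prod fun j _ => ?_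
  exact ((EuclideanSpace.proj j : E n →L[ℂ] ℂ).restrictScalars ℝ).contDiff

theorem p_smooth : ContDiffOn ℝ ∞ M.p M.dom := by
  have h : ContDiffOn ℝ ∞ (fun y : E n => tailProd k y / y 0 * M.q y) M.dom := by
    refine ContDiffOn.mul (ContDiffOn.mul tailProd_contDiff.contDiffOn ?_)
      (M.q_smooth.mono fun y hy => hy.1)
    refine ContDiffOn.inv ?_ fun y hy => hy.2
    exact ((EuclideanSpace.proj 0 : E n →L[ℂ] ℂ).restrictScalars ℝ).contDiff.contDiffOn
  exact h.congr fun y hy => M.factor y hy.1 hy.2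

/-- The meromorphic function `p` is `J`-holomorphic away from `{y_1 = 0}`. -/
theorem p_holo : IsHolo M.J M.dom M.p := by
  refine ⟨M.p_smooth, fun x hx v => ?_⟩
  obtain ⟨U, hU, hxU, hUY, f, g, hf, hg, hdense, hpfg⟩ := M.mero x hx.1
  have hpc : ContinuousOn (fderiv ℝ M.p) M.dom :=
    M.p_smooth.continuousOn_fderiv_of_isOpen M.isOpen_dom (by simp)
  have hJc : ContinuousOn M.J M.dom := M.complex.smooth.continuousOn.mono fun y hy => hy.1
  have hx' : x ∈ closure {y ∈ U ∩ M.dom | g y ≠ 0} := by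
    rw [mem_closure_iff]
    intro O hO hxO
    obtain ⟨z, ⟨⟨hz1, hz2⟩, hz3⟩⟩ := mem_closure_iff.1 (hdense hxU) (O ∩ M.dom)
      (hO.inter M.isOpen_dom) ⟨hxO, hx⟩
    exact ⟨z, hz1, ⟨hz3.1, hz2⟩, hz3.2⟩
  have heq : ∀ y ∈ {y ∈ U ∩ M.dom | g y ≠ 0},
      fderiv ℝ M.p y (M.J y v) = Complex.I * fderiv ℝ M.p y v := by
    rintro y ⟨⟨hyU, hyd⟩, hgy⟩
    have hfd : HasFDerivAt f (fderiv ℝ f y) y :=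
      ((hf.1.differentiableOn (by simp)).differentiableAt (hU.mem_nhds hyU)).hasFDerivAt
    have hgd : HasFDerivAt g (fderiv ℝ g y) y :=
      ((hg.1.differentiableOn (by simp)).differentiableAt (hU.mem_nhds hyU)).hasFDerivAt
    have hpd : HasFDerivAt M.p (fderiv ℝ M.p y) y :=
      ((M.p_smooth.differentiableOn (by simp)).differentiableAt
        (M.isOpen_dom.mem_nhds hyd)).hasFDerivAt
    have hev : (fun z => M.p z * g z) =ᶠ[nhds y] f := by
      have h1 : ∀ᶠ z in nhds y, z ∈ U := hU.mem_nhds hyU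
      have h2 : ∀ᶠ z in nhds y, g z ≠ 0 := hgd.continuousAt.eventually_ne hgy
      filter_upwards [h1, h2] with z hz1 hz2
      rw [hpfg z hz1 hz2]; field_simp
    have hder := (hpd.mul hgd).unique (hfd.congr_of_eventuallyEq hev)
    have e1 := congrArg (fun l : E n →L[ℝ] ℂ => l (M.J y v)) hder
    have e2 := congrArg (fun l : E n →L[ℝ] ℂ => l v) hder
    simp only [add_apply, smul_apply, smul_eq_mul,
      hf.2 y hyU v, hg.2 y hyU v] at e1 e2
    have : g y * (fderiv ℝ M.p y (M.J y v) - Complex.I * fderiv ℝ M.p y v) = 0 := by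
      linear_combination e1 - Complex.I * e2
    exact sub_eq_zero.1 ((mul_eq_zero.1 this).resolve_left hgy)
  have hc1 : ContinuousWithinAt (fun y => fderiv ℝ M.p y (M.J y v) - Complex.I * fderiv ℝ M.p y v)
      {y ∈ U ∩ M.dom | g y ≠ 0} x := by
    have hp := (hpc x hx).mono (s := {y ∈ U ∩ M.dom | g y ≠ 0}) fun y hy => hy.1.2
    have hJ := (hJc x hx).mono (s := {y ∈ U ∩ M.dom | g y ≠ 0}) fun y hy => hy.1.2
    exact (hp.clm_apply (hJ.clm_apply continuousWithinAt_const)).sub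
      (continuousWithinAt_const.mul (hp.clm_apply continuousWithinAt_const))
  have hmem := hc1.mem_closure_image hx'
  have hsub : (fun y => fderiv ℝ M.p y (M.J y v) - Complex.I * fderiv ℝ M.p y v) ''
      {y ∈ U ∩ M.dom | g y ≠ 0} ⊆ {0} := by
    rintro _ ⟨y, hy, rfl⟩
    exact sub_eq_zero.2 (heq y hy)
  have := closure_mono hsub hmem
  rw [closure_singleton] at this
  exact sub_eq_zero.1 this

/-- The form on the fibre does not depend on the vector with which `η_Y` is contracted. -/
theorem fiberForm_eq {y : E n} (hy : y ∈ M.dom) (hp : M.p y ≠ 0) {w : E n}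
    (hw : fderiv ℝ M.p y w ≠ 0) {v : Fin n → E n} (hv : ∀ i, fderiv ℝ M.p y (v i) = 0) :
    M.fiberForm y v = M.p y ^ 2 * M.η y (Matrix.vecCons w v) / fderiv ℝ M.p y w := by
  have ht : tailProd k y ≠ 0 := by
    intro h
    apply hp
    rw [M.factor y hy.1 hy.2, h]; simp
  have he : fderiv ℝ M.p y (Classical.epsilon fun w => fderiv ℝ M.p y w ≠ 0) ≠ 0 :=
    Classical.epsilon_spec (p := fun w => fderiv ℝ M.p y w ≠ 0) ⟨w, hw⟩
  unfold fiberForm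
  rw [mul_div_assoc, mul_div_assoc,
    contraction_eq (M.η y) (M.J y) (M.volume_form.type y ⟨hy.1, ht⟩)
      (fderiv ℝ M.p y) (M.p_holo.2 y hy) _ w he hw v hv]

open Classical in
/-- The phase `η_(Y_ζ)(e_1 ∧ ⋯ ∧ e_n)² / |η_(Y_ζ)(e_1 ∧ ⋯ ∧ e_n)|²` of an `n`-dimensional subspace
`Λ = span {e_1, …, e_n}` of `T_y Y_ζ`; it does not depend on the basis, see `phase_eq`. -/
noncomputable def phase (y : E n) (Λ : Submodule ℝ (E n)) : ℂ :=
  if h : Module.finrank ℝ Λ = n then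
    M.fiberForm y (fun i => (Module.finBasisOfFinrankEq ℝ Λ h i : E n)) ^ 2 /
      (‖M.fiberForm y (fun i => (Module.finBasisOfFinrankEq ℝ Λ h i : E n))‖ : ℂ) ^ 2
  else 0

/-- The phase does not depend on the basis. -/
theorem phase_eq (y : E n) (Λ : Submodule ℝ (E n)) (e : Module.Basis (Fin n) ℝ Λ) :
    M.phase y Λ = M.fiberForm y (fun i => (e i : E n)) ^ 2 /
      (‖M.fiberForm y (fun i => (e i : E n))‖ : ℂ) ^ 2 := by
  have h : Module.finrank ℝ Λ = n := by simpa using Module.finrank_eq_card_basis e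
  let w := Classical.epsilon fun w => fderiv ℝ M.p y w ≠ 0
  let F : Λ [⋀^Fin n]→ₗ[ℝ] ℂ :=
    ((M.η y).toAlternatingMap.curryLeft w).compLinearMap Λ.subtype
  have hF : ∀ v : Fin n → Λ, F v = M.η y (Matrix.vecCons w fun i => (v i : E n)) := fun v => rfl
  let G : Λ [⋀^Fin n]→ₗ[ℝ] ℂ :=
    (LinearMap.toSpanSingleton ℝ ℂ (F e)).compAlternatingMap e.det
  have hFG : F = G := by
    refine Module.Basis.ext_alternating e fun s hs => ?_
    obtain ⟨σ, rfl⟩ : ∃ σ : Equiv.Perm (Fin n), s = σ :=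
      ⟨Equiv.ofBijective s (Finite.injective_iff_bijective.1 hs), rfl⟩
    have h1 : (fun i => e (σ i)) = (e ∘ σ) := rfl
    rw [h1, AlternatingMap.map_perm]
    simp [G, AlternatingMap.map_perm, Module.Basis.det_self]
  let b := Module.finBasisOfFinrankEq ℝ Λ h
  have hdet : e.det b ≠ 0 := (e.isUnit_det b).ne_zero
  have hb : M.fiberForm y (fun i => (b i : E n)) =
      (e.det b : ℂ) * M.fiberForm y (fun i => (e i : E n)) := by
    have h1 : F b = (e.det b : ℂ) * F e := by
      conv_lhs => rw [hFG]
      simp [G]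
    rw [hF, hF] at h1
    unfold fiberForm
    change M.p y ^ 2 * M.η y (Matrix.vecCons w fun i => (b i : E n)) / _ =
      _ * (M.p y ^ 2 * M.η y (Matrix.vecCons w fun i => (e i : E n)) / _)
    rw [h1]; ring
  have hphase : M.phase y Λ = M.fiberForm y (fun i => (b i : E n)) ^ 2 /
      (‖M.fiberForm y (fun i => (b i : E n))‖ : ℂ) ^ 2 := by
    unfold phase; rw [dif_pos h]
  have hd' : (e.det b : ℂ) ≠ 0 := by exact_mod_cast hdet
  have hsq : ((|e.det b| : ℝ) : ℂ) ^ 2 = (e.det b : ℂ) ^ 2 := by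
    rw [← Complex.ofReal_pow, sq_abs, Complex.ofReal_pow]
  rw [hphase, hb, norm_mul, Complex.norm_real, Real.norm_eq_abs, Complex.ofReal_mul, mul_pow,
    mul_pow, hsq, mul_div_mul_left _ _ (pow_ne_zero 2 hd')]

/-- `a` is the value on `Λ ⊂ T_y Y_ζ` of the graded phase function of the parallel transport `ψ T`:
the continuous lift `θ` along `0 ≤ t ≤ T`, starting at `0`, of
`t ↦ (phase of Dψ_t(Λ)) / (phase of Λ)` to the universal cover `x ↦ exp (2 π i x)` of the circle has
`θ T = a`. -/
def IsGradedPhase (T : ℝ) (ψ : ℝ → E n → E n) (y : E n) (Λ : Submodule ℝ (E n)) (a : ℝ) : Prop :=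
  ∃ θ : ℝ → ℝ, ContinuousOn θ (Set.Icc 0 T) ∧ θ 0 = 0 ∧ θ T = a ∧
    ∀ t ∈ Set.Icc 0 T,
      M.phase y Λ ≠ 0 ∧
      Complex.exp (2 * Real.pi * Complex.I * (θ t : ℂ)) =
        M.phase (ψ t y) (Λ.map (fderiv ℝ (ψ t) y).toLinearMap) / M.phase y Λ

end LocalModel

end SeidelLocal

/-!
On `Y` minus the coordinate hyperplanes `y_1 = 0, …, y_k = 0` the function `p` has no zeros, and
the horizontal lift of `-i ζ ∂_ζ` is a multiple of the Hamiltonian vector field of `log |p|`. As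
`q` is invariant under the torus, this lift has the explicit form `field`: it rotates each of the
coordinates `y_1, …, y_k` with angular velocity `speed` and moves the others slowly
(`LocalModel.fderiv_p_field`, `LocalModel.omega_field_eq_zero`). Hence the absolute values of
`y_1, …, y_k` are conserved, and the flow exists for any given time if the initial point is close
enough to the origin (`IsControlled.exists_flow`). Neither here nor below does it matter how small
`|y_1| > 0` is, so that `δ₂` may be any positive number smaller than `δ₁`.

Up to an error which is small near the origin, the linearization of the field at `x` is an
infinitesimal rotation plus a shear (`IsControlled.norm_fderiv_field_sub_le`). On vectors tangent to
the level sets of `|p|`, the coefficients of this shear can be replaced by symmetric ones, which are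
bounded and constant along the flow (`IsControlled.norm_shear_mainCoeff_sub_le`). In the rotating
frame the resulting shear `N` is constant, and `N² = 0`, so that by Grönwall's inequality the
linearized flow is close to `1 + t N` (`exists_linearization_bound`).

A Lagrangian subspace `Λ` of the tangent space of a fibre spans, together with the horizontal field,
a Lagrangian subspace of `ℂ^(n+1)`, which has a unitary frame (`exists_unitaryFrame`). Let `Θ` be
the smooth extension of `y_2 ⋯ y_k η_Y`. Up to a constant factor, the form on the fibres takes the
value `q Θ(frame) / y_1` on the basis of `Λ` contained in the frame
(`LocalModel.fiberForm_eq_extension`).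
Near the origin `q Θ` is close to the determinant, so that along the flow the argument of this value
is, up to a small error, the sum of two contributions (`LocalModel.exists_isGradedPhase`):
* the determinant of the frame transported by `1 + t N` is a polynomial in `t` of degree at most
  `n + 1` without real zeros, as `1 + t N` is symplectic. Hence its argument changes by at most
  `(n + 1) π` (`exists_arg_frameDet_shear`);
* the rotations of the coordinates contribute the sum of the angles by which `y_2, …, y_k` turn. In
  time `2 π d` this is close to `-2 π d S' / S`, where `S` is the sum of the `|y_j|⁻²` for `j ≤ k`,
  and `S'` is the same sum without `j = 1` (`IsOrbit.sum_angle_le`).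

The graded phase is the change of the argument divided by `π`. The ordering of the `|y_j|` and
`|p(y)| = |ζ|` bound `S' / S` from below by the fraction in the theorem
(`fraction_le_innerSum_div`).
-/

namespace SeidelLocal

/-! ### Differential equations on a compact interval -/

open Set in
/-- **Grönwall's inequality** on `[0, T]` with a closed form of the bound. -/
theorem norm_le_of_deriv_bound {F : Type*} [NormedAddCommGroup F] [NormedSpace ℝ F]
    {f f' : ℝ → F} {T K δ ε : ℝ} (hK : 0 ≤ K) (hε : 0 ≤ ε)
    (hf : ∀ t ∈ Icc 0 T, HasDerivWithinAt f (f' t) (Icc 0 T) t) (h0 : ‖f 0‖ ≤ δ)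
    (hb : ∀ t ∈ Icc 0 T, ‖f' t‖ ≤ K * ‖f t‖ + ε) :
    ∀ t ∈ Icc 0 T, ‖f t‖ ≤ (δ + ε * T) * Real.exp (K * T) := by
  intro t ht
  have hδ : 0 ≤ δ := (norm_nonneg _).trans h0
  have hT : 0 ≤ T := ht.1.trans ht.2
  have h1 := norm_le_gronwallBound_of_norm_deriv_right_le (f := f) (f' := f') (a := 0) (b := T)
    (fun t ht => (hf t ht).continuousWithinAt)
    (fun t ht => (hf t ⟨ht.1, ht.2.le⟩).mono_of_mem_nhdsWithin
      (Icc_mem_nhdsGE_of_mem ht)) h0 (fun t ht => hb t ⟨ht.1, ht.2.le⟩) T ⟨hT, le_rfl⟩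
  have h2 := norm_le_gronwallBound_of_norm_deriv_right_le (f := f) (f' := f') (a := 0) (b := T)
    (fun t ht => (hf t ht).continuousWithinAt)
    (fun t ht => (hf t ⟨ht.1, ht.2.le⟩).mono_of_mem_nhdsWithin
      (Icc_mem_nhdsGE_of_mem ht)) h0 (fun t ht => hb t ⟨ht.1, ht.2.le⟩) t ht
  refine (h2.trans (gronwallBound_mono hδ hε hK (by simpa using ht.2 : t - 0 ≤ T))).trans ?_
  rcases hK.eq_or_lt with rfl | hK
  · simp [gronwallBound_K0]
  rw [gronwallBound_of_K_ne_0 hK.ne', add_mul]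
  refine add_le_add_right ?_ _
  have h3 : 1 - K * T ≤ Real.exp (-(K * T)) := by
    have := Real.add_one_le_exp (-(K * T)); linarith
  have h4 : Real.exp (K * T) - 1 ≤ K * T * Real.exp (K * T) := by
    have h5 := mul_le_mul_of_nonneg_right h3 (Real.exp_pos (K * T)).le
    rw [← Real.exp_add] at h5
    simp only [neg_add_cancel, Real.exp_zero] at h5
    nlinarith
  calc ε / K * (Real.exp (K * T) - 1) ≤ ε / K * (K * T * Real.exp (K * T)) := by gcongr
    _ = ε * T * Real.exp (K * T) := by field_simp

open Set in
/-- A bounded time-dependent field which is Lipschitz on balls has solutions on `[0, T]`. -/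
theorem exists_solution_of_bounded {F : Type*} [NormedAddCommGroup F] [NormedSpace ℝ F]
    [CompleteSpace F] {f : ℝ → F → F} {T L : ℝ} (hT : 0 ≤ T)
    (hlip : ∀ r : ℝ, ∃ K, ∀ t ∈ Icc 0 T, LipschitzOnWith K (f t) (Metric.closedBall 0 r))
    (hcont : ∀ x, ContinuousOn (f · x) (Icc 0 T)) (hL : ∀ t ∈ Icc 0 T, ∀ x, ‖f t x‖ ≤ L) (x : F) :
    ∃ α : ℝ → F, α 0 = x ∧
      ∀ t ∈ Icc 0 T, HasDerivWithinAt α (f t (α t)) (Icc 0 T) t := by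
  have hL0 : 0 ≤ L := (norm_nonneg _).trans (hL 0 ⟨le_rfl, hT⟩ 0)
  obtain ⟨K, hK⟩ := hlip (‖x‖ + L * T)
  have hsub : Metric.closedBall x (L * T) ⊆ Metric.closedBall (0 : F) (‖x‖ + L * T) := by
    apply Metric.closedBall_subset_closedBall'
    rw [dist_zero_right, add_comm]
  have hpl : IsPicardLindelof f (⟨0, le_rfl, hT⟩ : Icc (0 : ℝ) T) x ⟨L * T, by positivity⟩ 0
      ⟨L, hL0⟩ K := by
    refine ⟨fun t ht => (hK t ht).mono hsub, fun y _ => hcont y, fun t ht y _ => hL t ht y, ?_⟩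
    simp only [sub_zero, sub_self, NNReal.coe_zero]
    rw [max_eq_left hT]
    exact le_rfl
  exact hpl.exists_eq_forall_mem_Icc_hasDerivWithinAt₀

open Set in
/-- Linear equations with continuous coefficients have solutions on all of `[0, T]`. -/
theorem exists_linear_solution {F : Type*} [NormedAddCommGroup F] [NormedSpace ℝ F]
    [FiniteDimensional ℝ F] {A : ℝ → F →L[ℝ] F} {T : ℝ} (hT : 0 ≤ T)
    (hA : ContinuousOn A (Icc 0 T)) (x : F) :
    ∃ α : ℝ → F, α 0 = x ∧ ∀ t ∈ Icc 0 T, HasDerivWithinAt α (A t (α t)) (Icc 0 T) t := by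
  have : CompleteSpace F := FiniteDimensional.complete ℝ F
  obtain ⟨K, hK⟩ := isCompact_Icc.exists_bound_of_continuousOn hA
  have hK0 : 0 ≤ K := (norm_nonneg _).trans (hK 0 ⟨le_rfl, hT⟩)
  -- Truncate the field outside a ball which the solution cannot leave.
  set M : ℝ := ‖x‖ * Real.exp (K * T) with hM
  have hM0 : 0 ≤ M := by positivity
  let χ : ContDiffBump (0 : F) := ⟨M + 1, M + 2, by linarith, by linarith⟩
  let G : F → F := fun w => χ w • w
  have hG : ContDiff ℝ 1 G := χ.contDiff.smul contDiff_id
  have hGle : ∀ w, ‖G w‖ ≤ ‖w‖ := fun w => by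
    simp only [G, norm_smul, Real.norm_eq_abs, abs_of_nonneg (χ.nonneg)]
    exact mul_le_of_le_one_left (norm_nonneg _) χ.le_one
  have hGb : ∀ w, ‖G w‖ ≤ M + 2 := fun w => by
    by_cases hw : M + 2 ≤ ‖w‖
    · have : χ w = 0 := χ.zero_of_le_dist (by simpa using hw)
      simp only [G, this, zero_smul, norm_zero]; positivity
    · exact (hGle w).trans (not_le.1 hw).le
  obtain ⟨α, h0, hα⟩ := exists_solution_of_bounded (f := fun t w => A t (G w)) (L := K * (M + 2)) hT
    (fun r => by
      obtain ⟨K', hK'⟩ := (hG.locallyLipschitz.locallyLipschitzOn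
        (s := Metric.closedBall (0 : F) r)).exists_lipschitzOnWith_of_compact
          (isCompact_closedBall _ _)
      refine ⟨⟨K, hK0⟩ * K', fun t ht => ?_⟩
      exact ((A t).lipschitz.weaken (show ‖A t‖₊ ≤ ⟨K, hK0⟩ from hK t ht)).comp_lipschitzOnWith hK')
    (fun w => hA.clm_apply continuousOn_const)
    (fun t ht w => ((A t).le_opNorm _).trans
      (mul_le_mul (hK t ht) (hGb w) (norm_nonneg _) hK0)) x
  have hb := norm_le_of_deriv_bound (δ := ‖x‖) (ε := 0) hK0 le_rfl hα (by rw [h0])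
    (fun t ht => by
      rw [add_zero]
      exact ((A t).le_opNorm _).trans (mul_le_mul (hK t ht) (hGle _) (norm_nonneg _) hK0))
  refine ⟨α, h0, fun t ht => ?_⟩
  have h1 : χ (α t) = 1 := χ.one_of_mem_closedBall (by
    have := hb t ht
    simp only [zero_mul, add_zero, ← hM] at this
    simp only [mem_closedBall_zero_iff, χ]; linarith)
  have := hα t ht
  simpa only [G, h1, one_smul] using this

/-! ### Smooth dependence of flows on the initial point -/

/-- `ψ` is the flow, for times in `[0, T]`, of the vector field `Z`, and it is bounded near each
initial point, uniformly in time. -/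
structure IsBoundedFlow {F : Type*} [NormedAddCommGroup F] [NormedSpace ℝ F] (Z : F → F) (T : ℝ)
    (ψ : ℝ → F → F) : Prop where
  zero : ∀ x, ψ 0 x = x
  deriv : ∀ x, ∀ t ∈ Set.Icc 0 T,
    HasDerivWithinAt (fun s => ψ s x) (Z (ψ t x)) (Set.Icc 0 T) t
  bounded : ∀ x₀, ∃ ρ > 0, ∃ C, ∀ x ∈ Metric.ball x₀ ρ, ∀ t ∈ Set.Icc 0 T, ‖ψ t x‖ ≤ C

theorem IsBoundedFlow.continuousOn_time {F : Type*} [NormedAddCommGroup F] [NormedSpace ℝ F]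
    {Z : F → F} {T : ℝ} {ψ : ℝ → F → F} (hψ : IsBoundedFlow Z T ψ) (x : F) :
    ContinuousOn (fun s => ψ s x) (Set.Icc 0 T) :=
  fun t ht => (hψ.deriv x t ht).continuousWithinAt

section Flow

open Set Metric

variable {F : Type*} [NormedAddCommGroup F] [NormedSpace ℝ F] [FiniteDimensional ℝ F]
  {Z : F → F} {T : ℝ} {ψ : ℝ → F → F}

theorem IsBoundedFlow.locally_lipschitz (hψ : IsBoundedFlow Z T ψ) (hZ : ContDiff ℝ ∞ Z) (x₀ : F) :
    ∃ ρ > 0, ∃ L ≥ 0, ∀ x ∈ ball x₀ ρ, ∀ x' ∈ ball x₀ ρ, ∀ t ∈ Icc 0 T,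
      ‖ψ t x - ψ t x'‖ ≤ L * ‖x - x'‖ := by
  obtain ⟨ρ, hρ, C, hC⟩ := hψ.bounded x₀
  obtain ⟨K, hK⟩ := ((hZ.of_le (by simp) : ContDiff ℝ 1 Z).locallyLipschitz.locallyLipschitzOn
    (s := closedBall (0 : F) C)).exists_lipschitzOnWith_of_compact (isCompact_closedBall _ _)
  refine ⟨ρ, hρ, Real.exp (K * T), (Real.exp_pos _).le, fun x hx x' hx' t ht => ?_⟩
  have := norm_le_of_deriv_bound (f := fun s => ψ s x - ψ s x') (K := K) (ε := 0)
    (δ := ‖x - x'‖) K.2 le_rfl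
    (fun t ht => (hψ.deriv x t ht).sub (hψ.deriv x' t ht)) (by simp [hψ.zero])
    (fun t ht => by
      rw [add_zero, ← dist_eq_norm, ← dist_eq_norm]
      exact hK.dist_le_mul _ (by simpa using hC x hx t ht) _ (by simpa using hC x' hx' t ht)) t ht
  rw [zero_mul, add_zero] at this
  linarith

/-- The solution of the variational equation. -/
theorem IsBoundedFlow.exists_variation (hψ : IsBoundedFlow Z T ψ) (hZ : ContDiff ℝ ∞ Z)
    (hT : 0 ≤ T) :
    ∃ D : ℝ → F → F →L[ℝ] F, (∀ x, D 0 x = ContinuousLinearMap.id ℝ F) ∧ ∀ x, ∀ t ∈ Icc 0 T,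
      HasDerivWithinAt (fun s => D s x) ((fderiv ℝ Z (ψ t x)).comp (D t x)) (Icc 0 T) t := by
  have h : ∀ x, ∃ α : ℝ → F →L[ℝ] F, α 0 = ContinuousLinearMap.id ℝ F ∧ ∀ t ∈ Icc 0 T,
      HasDerivWithinAt α ((fderiv ℝ Z (ψ t x)).comp (α t)) (Icc 0 T) t := fun x => by
    have hc : ContinuousOn (fun t => (ContinuousLinearMap.compL ℝ F F F) (fderiv ℝ Z (ψ t x)))
        (Icc 0 T) :=
      (ContinuousLinearMap.continuous _).comp_continuousOn
        ((hZ.continuous_fderiv (by simp)).comp_continuousOn (hψ.continuousOn_time x))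
    exact exists_linear_solution hT hc _
  choose D hD using h
  exact ⟨fun t x => D x t, fun x => (hD x).1, fun x => (hD x).2⟩

/-- The derivative of the flow with respect to the initial point is the solution `D` of the
variational equation, by Grönwall's inequality for `ψ t (x + h) - ψ t x - D t x h`. -/
theorem IsBoundedFlow.hasFDerivAt (hψ : IsBoundedFlow Z T ψ) (hZ : ContDiff ℝ ∞ Z)
    {D : ℝ → F → F →L[ℝ] F} (hD0 : ∀ x, D 0 x = ContinuousLinearMap.id ℝ F)
    (hD : ∀ x, ∀ t ∈ Icc 0 T,
      HasDerivWithinAt (fun s => D s x) ((fderiv ℝ Z (ψ t x)).comp (D t x)) (Icc 0 T) t)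
    (x : F) {t : ℝ} (ht : t ∈ Icc 0 T) : HasFDerivAt (ψ t) (D t x) x := by
  have hT : 0 ≤ T := ht.1.trans ht.2
  obtain ⟨ρ, hρ, L, hL, hlip⟩ := hψ.locally_lipschitz hZ x
  have hcZ : Continuous (fderiv ℝ Z) := hZ.continuous_fderiv (by simp)
  obtain ⟨C, hC⟩ := isCompact_Icc.exists_bound_of_continuousOn (hψ.continuousOn_time x)
  obtain ⟨K, hK⟩ := (isCompact_closedBall (0 : F) C).exists_bound_of_continuousOn hcZ.continuousOn
  have hmem : ∀ s ∈ Icc 0 T, ψ s x ∈ closedBall (0 : F) C := fun s hs => by simpa using hC s hs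
  have hK0 : 0 ≤ K := (norm_nonneg _).trans (hK _ (hmem t ht))
  have huc := (isCompact_closedBall (0 : F) (C + 1)).uniformContinuousOn_of_continuous
    hcZ.continuousOn
  rw [hasFDerivAt_iff_isLittleO_nhds_zero, Asymptotics.isLittleO_iff]
  intro c hc
  obtain ⟨η, hη, hηc⟩ : ∃ η > 0, η * L * T * Real.exp (K * T) ≤ c := by
    refine ⟨c / (L * T * Real.exp (K * T) + 1), by positivity, ?_⟩
    rw [div_mul_eq_mul_div, div_mul_eq_mul_div, div_mul_eq_mul_div, div_le_iff₀ (by positivity)]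
    nlinarith
  obtain ⟨r, hr, hrη⟩ := Metric.uniformContinuousOn_iff.1 huc η hη
  have hsmall : ∀ᶠ h : F in nhds 0, ‖h‖ < ρ ∧ L * ‖h‖ < min r 1 := by
    refine Filter.Eventually.and ?_ ?_
    · exact continuous_norm.continuousAt.eventually_lt continuousAt_const (by simpa)
    · exact (continuous_const.mul continuous_norm).continuousAt.eventually_lt continuousAt_const
        (by simpa using hr)
  filter_upwards [hsmall] with h hh
  have hclose : ∀ s ∈ Icc 0 T, ‖ψ s (x + h) - ψ s x‖ ≤ L * ‖h‖ := fun s hs => by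
    simpa using hlip (x + h) (by simpa using hh.1) x (mem_ball_self hρ) s hs
  have hlin : ∀ s ∈ Icc 0 T, ‖Z (ψ s (x + h)) - Z (ψ s x)
      - fderiv ℝ Z (ψ s x) (ψ s (x + h) - ψ s x)‖ ≤ η * (L * ‖h‖) := fun s hs => by
    refine (Convex.norm_image_sub_le_of_norm_hasFDerivWithin_le' (𝕜 := ℝ)
      (f := Z) (f' := fderiv ℝ Z) (C := η) (s := ball (ψ s x) (min r 1))
      (fun y _ => (hZ.differentiable (by simp) y).hasFDerivAt.hasFDerivWithinAt)
      (fun y hy => ?_) (convex_ball _ _) (mem_ball_self (by positivity)) ?_).trans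
        (mul_le_mul_of_nonneg_left (hclose s hs) hη.le)
    · rw [mem_ball] at hy
      have hm := hmem s hs
      rw [← dist_eq_norm]
      refine (hrη y ?_ _ ?_ (hy.trans_le (min_le_left _ _))).le
      · rw [mem_closedBall] at hm ⊢
        exact (dist_triangle _ _ _).trans (by linarith [hy.trans_le (min_le_right r 1)])
      · exact closedBall_subset_closedBall (by linarith) hm
    · rw [mem_ball, dist_eq_norm]; exact (hclose s hs).trans_lt hh.2
  have hmain := norm_le_of_deriv_bound (T := T) (K := K) (δ := 0) (ε := η * (L * ‖h‖))
    (f := fun s => ψ s (x + h) - ψ s x - D s x h) hK0 (by positivity)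
    (fun s hs => ((hψ.deriv (x + h) s hs).sub (hψ.deriv x s hs)).sub
      ((hD x s hs).clm_apply (hasDerivWithinAt_const _ _ h)))
    (by simp [hψ.zero, hD0])
    (fun s hs => by
      have e : Z (ψ s (x + h)) - Z (ψ s x) - (((fderiv ℝ Z (ψ s x)).comp (D s x)) h + D s x 0)
          = (Z (ψ s (x + h)) - Z (ψ s x) - fderiv ℝ Z (ψ s x) (ψ s (x + h) - ψ s x))
            + fderiv ℝ Z (ψ s x) (ψ s (x + h) - ψ s x - D s x h) := by
        simp only [map_sub, map_zero, ContinuousLinearMap.comp_apply]; abel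
      rw [e, add_comm (K * _)]
      refine (norm_add_le _ _).trans (add_le_add (hlin s hs) ?_)
      exact (ContinuousLinearMap.le_opNorm _ _).trans
        (mul_le_mul_of_nonneg_right (hK _ (hmem s hs)) (norm_nonneg _))) t ht
  refine hmain.trans ?_
  calc (0 + η * (L * ‖h‖) * T) * Real.exp (K * T)
      = (η * L * T * Real.exp (K * T)) * ‖h‖ := by ring
    _ ≤ c * ‖h‖ := by gcongr

/-- The derivative of a flow is, together with the flow itself, the flow of a smooth field on
`F × (F →L[ℝ] F)`. -/
theorem IsBoundedFlow.prolong (hψ : IsBoundedFlow Z T ψ) (hZ : ContDiff ℝ ∞ Z)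
    {D : ℝ → F → F →L[ℝ] F} (hD0 : ∀ x, D 0 x = ContinuousLinearMap.id ℝ F)
    (hD : ∀ x, ∀ t ∈ Icc 0 T,
      HasDerivWithinAt (fun s => D s x) ((fderiv ℝ Z (ψ t x)).comp (D t x)) (Icc 0 T) t) :
    IsBoundedFlow (fun z : F × (F →L[ℝ] F) => (Z z.1, (fderiv ℝ Z z.1).comp z.2)) T
      (fun t z => (ψ t z.1, (D t z.1).comp z.2)) := by
  refine ⟨fun z => by simp [hψ.zero, hD0], fun z t ht => ?_, fun z₀ => ?_⟩
  · refine (hψ.deriv z.1 t ht).prodMk ?_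
    have := (hD z.1 t ht).clm_comp (hasDerivWithinAt_const t (Icc 0 T) z.2)
    simpa [ContinuousLinearMap.comp_assoc] using this
  · obtain ⟨ρ, hρ, C, hC⟩ := hψ.bounded z₀.1
    obtain ⟨K, hK⟩ := (isCompact_closedBall (0 : F) C).exists_bound_of_continuousOn
      (hZ.continuous_fderiv (by simp)).continuousOn
    refine ⟨min ρ 1, by positivity,
      max C (‖ContinuousLinearMap.id ℝ F‖ * Real.exp (K * T) * (‖z₀.2‖ + 1)), fun z hz t ht => ?_⟩
    have hz' : z ∈ ball z₀.1 ρ ×ˢ ball z₀.2 1 := by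
      rw [mem_ball, Prod.dist_eq, max_lt_iff] at hz
      exact ⟨hz.1.trans_le (min_le_left _ _), hz.2.trans_le (min_le_right _ _)⟩
    have hmem : ∀ s ∈ Icc 0 T, ψ s z.1 ∈ closedBall (0 : F) C := fun s hs => by
      simpa using hC _ hz'.1 s hs
    have hK0 : 0 ≤ K := (norm_nonneg _).trans (hK _ (hmem t ht))
    have hDb := norm_le_of_deriv_bound (δ := ‖ContinuousLinearMap.id ℝ F‖) (ε := 0) hK0 le_rfl
      (hD z.1) (by rw [hD0]) (fun s hs => by
        rw [add_zero]
        exact (ContinuousLinearMap.opNorm_comp_le _ _).trans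
          (mul_le_mul_of_nonneg_right (hK _ (hmem s hs)) (norm_nonneg _))) t ht
    rw [zero_mul, add_zero] at hDb
    refine max_le_max (hC _ hz'.1 t ht) ((ContinuousLinearMap.opNorm_comp_le _ _).trans ?_)
    refine mul_le_mul hDb ?_ (norm_nonneg _) (by positivity)
    have h2 := hz'.2
    rw [mem_ball, dist_eq_norm] at h2
    linarith [norm_le_norm_add_norm_sub' z.2 z₀.2]

end Flow

/-- The time `t` maps of the flow of a smooth field are `C^r` for every `r`, by induction on `r`:
the derivative of the flow is again part of a flow. The induction runs over all spaces `F`. -/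
theorem IsBoundedFlow.contDiff_nat (r : ℕ) : ∀ {F : Type} [NormedAddCommGroup F] [NormedSpace ℝ F]
    [FiniteDimensional ℝ F] {Z : F → F} {T : ℝ} {ψ : ℝ → F → F}, IsBoundedFlow Z T ψ →
    ContDiff ℝ ∞ Z → ∀ t ∈ Set.Icc 0 T, ContDiff ℝ r (ψ t) := by
  induction r with
  | zero =>
    intro F _ _ _ Z T ψ hψ hZ t ht
    obtain ⟨D, hD0, hD⟩ := hψ.exists_variation hZ (ht.1.trans ht.2)
    exact contDiff_zero.2 (continuous_iff_continuousAt.2 fun x =>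
      (hψ.hasFDerivAt hZ hD0 hD x ht).continuousAt)
  | succ r ih =>
    intro F _ _ _ Z T ψ hψ hZ t ht
    obtain ⟨D, hD0, hD⟩ := hψ.exists_variation hZ (ht.1.trans ht.2)
    have hder := fun x => hψ.hasFDerivAt hZ hD0 hD x ht
    have hfd : fderiv ℝ (ψ t) = D t := funext fun x => (hder x).fderiv
    rw [Nat.cast_add, Nat.cast_one, contDiff_succ_iff_fderiv]
    refine ⟨fun x => (hder x).differentiableAt, by simp, ?_⟩
    have hsm : ContDiff ℝ ∞ (fun z : F × (F →L[ℝ] F) => (Z z.1, (fderiv ℝ Z z.1).comp z.2)) :=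
      (hZ.comp contDiff_fst).prodMk
        (((hZ.fderiv_right (by simp)).comp contDiff_fst).clm_comp contDiff_snd)
    have h1 := ih (hψ.prolong hZ hD0 hD) hsm t ht
    have h2 := (h1.comp (contDiff_id.prodMk
      (contDiff_const (c := ContinuousLinearMap.id ℝ F)))).snd
    rw [hfd]
    exact h2

/-- A compactly supported smooth vector field has a flow on `[0, T]`, which depends smoothly on the
initial point and whose derivative solves the variational equation. -/
theorem exists_smooth_flow {F : Type} [NormedAddCommGroup F] [NormedSpace ℝ F]
    [FiniteDimensional ℝ F] {Z : F → F} (hZ : ContDiff ℝ ∞ Z) (hc : HasCompactSupport Z) {T : ℝ}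
    (hT : 0 ≤ T) :
    ∃ ψ : ℝ → F → F, (∀ x, ψ 0 x = x) ∧
      (∀ x, ∀ t ∈ Set.Icc 0 T,
        HasDerivWithinAt (fun s => ψ s x) (Z (ψ t x)) (Set.Icc 0 T) t) ∧
      (∀ t ∈ Set.Icc 0 T, ContDiff ℝ ∞ (ψ t)) ∧
      ∀ x v, ∀ t ∈ Set.Icc 0 T, HasDerivWithinAt (fun s => fderiv ℝ (ψ s) x v)
        (fderiv ℝ Z (ψ t x) (fderiv ℝ (ψ t) x v)) (Set.Icc 0 T) t := by
  have : CompleteSpace F := FiniteDimensional.complete ℝ F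
  obtain ⟨L, hL⟩ := hZ.continuous.bounded_above_of_compact_support hc
  have hex : ∀ x, ∃ α : ℝ → F, α 0 = x ∧
      ∀ t ∈ Set.Icc 0 T, HasDerivWithinAt α (Z (α t)) (Set.Icc 0 T) t := fun x =>
    exists_solution_of_bounded (f := fun _ => Z) hT (fun r => by
      obtain ⟨K, hK⟩ := ((hZ.of_le (by simp) : ContDiff ℝ 1 Z).locallyLipschitz.locallyLipschitzOn
        (s := Metric.closedBall (0 : F) r)).exists_lipschitzOnWith_of_compact
          (isCompact_closedBall _ _)
      exact ⟨K, fun _ _ => hK⟩) (fun _ => continuousOn_const) (fun _ _ => hL) x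
  choose α hα0 hα using hex
  have hψ : IsBoundedFlow Z T (fun t x => α x t) := by
    refine ⟨hα0, hα, fun x₀ => ⟨1, one_pos, (‖x₀‖ + 1 + L * T) * Real.exp (0 * T), ?_⟩⟩
    intro x hx t ht
    refine norm_le_of_deriv_bound le_rfl ((norm_nonneg _).trans (hL 0)) (hα x) ?_
      (fun s _ => by simpa using hL _) t ht
    rw [hα0]
    rw [Metric.mem_ball, dist_eq_norm] at hx
    linarith [norm_le_norm_add_norm_sub' x x₀]
  obtain ⟨D, hD0, hD⟩ := hψ.exists_variation hZ hT
  refine ⟨fun t x => α x t, hα0, hα, fun t ht =>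
    contDiff_infty.2 fun r => IsBoundedFlow.contDiff_nat r hψ hZ t ht, fun x v t ht => ?_⟩
  have hfd : ∀ s ∈ Set.Icc 0 T, fderiv ℝ (fun x => α x s) x = D s x := fun s hs =>
    (hψ.hasFDerivAt hZ hD0 hD x hs).fderiv
  have h1 := (hD x t ht).clm_apply (hasDerivWithinAt_const t (Set.Icc 0 T) v)
  simp only [ContinuousLinearMap.comp_apply, map_zero, add_zero] at h1
  refine (h1.congr_of_mem (fun s hs => by rw [hfd s hs]) ht).congr_deriv ?_
  rw [hfd t ht]

/-! ### The argument of a polynomial along a real interval -/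

open Set in
/-- A linear factor `t - a` without zero on `[0, T]` turns by at most `π`, because `1 - t / a` stays
in the slit plane. -/
theorem exists_arg_prod (T : ℝ) (s : Multiset ℂ) (hs : ∀ a ∈ s, ∀ t ∈ Icc 0 T, (t : ℂ) ≠ a) :
    ∃ φ : ℝ → ℝ, ContinuousOn φ (Icc 0 T) ∧ φ 0 = 0 ∧ (∀ t, |φ t| ≤ Multiset.card s * Real.pi) ∧
      ∀ t ∈ Icc 0 T, ∃ ρ : ℝ, 0 < ρ ∧ (s.map fun a => (t : ℂ) - a).prod =
        ρ * Complex.exp (φ t * Complex.I) * (s.map fun a => (0 : ℂ) - a).prod := by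
  induction s using Multiset.induction_on with
  | empty => exact ⟨fun _ => 0, continuousOn_const, rfl, by simp, fun t _ => ⟨1, one_pos, by simp⟩⟩
  | cons a s ih =>
    obtain ⟨φ, hφc, hφ0, hφb, hφ⟩ := ih fun b hb => hs b (Multiset.mem_cons_of_mem hb)
    have ha := hs a (Multiset.mem_cons_self a s)
    have hslit : ∀ t ∈ Icc 0 T, (1 - (t : ℂ) / a) ∈ Complex.slitPlane := by
      intro t ht
      have ha0 : a ≠ 0 := fun h => ha 0 ⟨le_rfl, ht.1.trans ht.2⟩ (by simp [h])
      by_contra hn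
      rw [Complex.mem_slitPlane_iff_not_le_zero, not_not] at hn
      set x : ℝ := (1 - (t : ℂ) / a).re with hx
      have hre : 1 - (t : ℂ) / a = (x : ℂ) := by
        apply Complex.ext
        · simp [hx]
        · simpa using hn.2
      have hx0 : x ≤ 0 := hn.1
      have h1 : (t : ℂ) = ((1 - x : ℝ) : ℂ) * a := by
        have : (t : ℂ) / a = 1 - x := by rw [← hre]; ring
        rw [div_eq_iff ha0] at this
        rw [this]; push_cast; ring
      have h2 : a = ((t / (1 - x) : ℝ) : ℂ) := by
        have h3 : ((1 - x : ℝ) : ℂ) ≠ 0 := by exact_mod_cast (by linarith : (1 - x) ≠ 0)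
        rw [Complex.ofReal_div, h1]; field_simp
      refine ha (t / (1 - x)) ⟨div_nonneg ht.1 (by linarith), ?_⟩ h2.symm
      rw [div_le_iff₀ (by linarith)]
      nlinarith [ht.1, ht.2]
    refine ⟨fun t => Complex.arg (1 - (t : ℂ) / a) + φ t, ?_, by simp [hφ0], fun t => ?_,
      fun t ht => ?_⟩
    · refine ContinuousOn.add (fun t ht => ?_) hφc
      refine ContinuousAt.comp_continuousWithinAt (f := fun t : ℝ => 1 - (t : ℂ) / a)
        (Complex.continuousAt_arg (hslit t ht)) ?_
      exact (by fun_prop : Continuous fun t : ℝ => 1 - (t : ℂ) / a).continuousWithinAt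
    · rw [Multiset.card_cons]
      push_cast
      rw [add_mul, one_mul, add_comm (_ * _)]
      exact (abs_add_le _ _).trans (add_le_add (Complex.abs_arg_le_pi _) (hφb t))
    · obtain ⟨ρ, hρ, h⟩ := hφ t ht
      have ha0 : a ≠ 0 := fun h => ha 0 ⟨le_rfl, ht.1.trans ht.2⟩ (by simp [h])
      refine ⟨‖1 - (t : ℂ) / a‖ * ρ,
        mul_pos (norm_pos_iff.2 (Complex.slitPlane_ne_zero (hslit t ht))) hρ, ?_⟩
      have h2 := Complex.norm_mul_exp_arg_mul_I (1 - (t : ℂ) / a)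
      rw [Multiset.map_cons, Multiset.prod_cons, h, Multiset.map_cons, Multiset.prod_cons]
      push_cast
      rw [add_mul, Complex.exp_add]
      calc _ = (1 - (t : ℂ) / a) * (0 - a) *
            (ρ * Complex.exp (φ t * Complex.I) * (s.map fun a => (0 : ℂ) - a).prod) := by
              field_simp; ring
        _ = _ := by
          conv_lhs => rw [← h2]
          ring

open Set in
/-- The argument of a complex polynomial of degree at most `N` without zeros on `[0, T]` changes by
at most `N π`. -/
theorem exists_arg_polynomial {N : ℕ} {P : Polynomial ℂ} (hP : P.natDegree ≤ N) (T : ℝ)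
    (h0 : ∀ t ∈ Icc 0 T, P.eval (t : ℂ) ≠ 0) :
    ∃ φ : ℝ → ℝ, ContinuousOn φ (Icc 0 T) ∧ φ 0 = 0 ∧ (∀ t, |φ t| ≤ N * Real.pi) ∧
      ∀ t ∈ Icc 0 T, ∃ ρ : ℝ, 0 < ρ ∧ P.eval (t : ℂ) =
        ρ * Complex.exp (φ t * Complex.I) * P.eval 0 := by
  obtain ⟨φ, hc, hφ0, hb, hφ⟩ := exists_arg_prod T P.roots fun a ha t ht hta => by
    refine h0 t ht ?_
    rw [hta]
    exact (Polynomial.mem_roots'.1 ha).2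
  have hev : ∀ z : ℂ, P.eval z = P.leadingCoeff * (P.roots.map fun a => z - a).prod := fun z => by
    conv_lhs => rw [(IsAlgClosed.splits P).eq_prod_roots]
    rw [Polynomial.eval_mul, Polynomial.eval_C, Polynomial.eval_multiset_prod, Multiset.map_map]
    simp
  refine ⟨φ, hc, hφ0, fun t => (hb t).trans ?_, fun t ht => ?_⟩
  · have : (Multiset.card P.roots : ℝ) ≤ N := by exact_mod_cast P.card_roots'.trans hP
    exact mul_le_mul_of_nonneg_right this Real.pi_pos.le
  · obtain ⟨ρ, hρ, h⟩ := hφ t ht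
    refine ⟨ρ, hρ, ?_⟩
    rw [hev, hev, h]; ring

/-- The determinant of a linear pencil of matrices is a polynomial in the parameter. -/
theorem exists_polynomial_det {N : ℕ} (A B : Matrix (Fin N) (Fin N) ℂ) :
    ∃ P : Polynomial ℂ, P.natDegree ≤ N ∧ ∀ z : ℂ, P.eval z = (A + z • B).det := by
  refine ⟨((Polynomial.X : Polynomial ℂ) • B.map Polynomial.C + A.map Polynomial.C).det, ?_, ?_⟩
  · simpa using Polynomial.natDegree_det_X_add_C_le B A
  · intro z
    rw [← Polynomial.coe_evalRingHom, RingHom.map_det]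
    congr 1
    ext i j
    simp [add_comm]
    ring

/-! ### Isotropic frames and shears -/

variable {n : ℕ}

theorem omega_eq_im_inner (v w : E n) : omega v w = (inner ℂ v w).im := by
  simp [omega, PiLp.inner_apply, RCLike.inner_apply, Complex.im_sum, mul_comm]

theorem omega_add_left (u v w : E n) : omega (u + v) w = omega u w + omega v w := by
  simp [omega_eq_im_inner]

theorem omega_add_right (u v w : E n) : omega u (v + w) = omega u v + omega u w := by
  simp [omega_eq_im_inner]

theorem real_smul_eq (a : ℝ) (v : E n) : a • v = (a : ℂ) • v := by
  ext j; simp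

theorem omega_smul_left (a : ℝ) (v w : E n) : omega (a • v) w = a * omega v w := by
  rw [omega_eq_im_inner, omega_eq_im_inner, real_smul_eq, inner_smul_left]
  simp

theorem omega_smul_right (a : ℝ) (v w : E n) : omega v (a • w) = a * omega v w := by
  rw [omega_eq_im_inner, omega_eq_im_inner, real_smul_eq, inner_smul_right]
  simp

theorem omega_antisymm (v w : E n) : omega v w = -omega w v := by
  rw [omega_eq_im_inner, omega_eq_im_inner, ← inner_conj_symm, Complex.conj_im]

theorem omega_sum_left {ι : Type*} (s : Finset ι) (f : ι → E n) (w : E n) :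
    omega (∑ i ∈ s, f i) w = ∑ i ∈ s, omega (f i) w := by
  simp only [omega_eq_im_inner, sum_inner, Complex.im_sum]

theorem omega_sum_right {ι : Type*} (s : Finset ι) (f : ι → E n) (w : E n) :
    omega w (∑ i ∈ s, f i) = ∑ i ∈ s, omega w (f i) := by
  simp only [omega_eq_im_inner, inner_sum, Complex.im_sum]

theorem norm_le_sum_coord (v : E n) : ‖v‖ ≤ ∑ j, ‖v j‖ := by
  have h : v = ∑ j, EuclideanSpace.single j (v j) := by
    ext i
    simp [Finset.sum_apply, Pi.single_apply]
  conv_lhs => rw [h]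
  refine (norm_sum_le _ _).trans (le_of_eq ?_)
  simp

theorem norm_le_of_coord {v : E n} {c : ℝ} (h : ∀ j, ‖v j‖ ≤ c) : ‖v‖ ≤ (n + 1) * c := by
  refine (norm_le_sum_coord v).trans ((Finset.sum_le_sum fun j _ => h j).trans (le_of_eq ?_))
  simp

theorem norm_coord_le (v : E n) (j : Fin (n + 1)) : ‖v j‖ ≤ ‖v‖ := PiLp.norm_apply_le v j

/-- The shear `v ↦ (i u_j ∑_l G_jl Re (conj u_l v_l))_j`: it takes the components of `v` along the
lines `ℝ u_l` to components along `ℝ i u_j`. -/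
noncomputable def shear (u : Fin (n + 1) → ℂ) (G : Fin (n + 1) → Fin (n + 1) → ℝ) :
    E n →L[ℝ] E n :=
  LinearMap.toContinuousLinearMap
    { toFun := fun v => WithLp.toLp 2 fun j =>
        Complex.I * u j * ((∑ l, G j l * ((starRingEnd ℂ) (u l) * v l).re : ℝ) : ℂ)
      map_add' := fun v w => by
        ext j
        simp only [PiLp.add_apply, mul_add, Complex.add_re, Finset.sum_add_distrib,
          Complex.ofReal_add]
      map_smul' := fun a v => by
        ext j
        simp only [PiLp.smul_apply, RingHom.id_apply, Complex.real_smul]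
        have : ∀ l, ((starRingEnd ℂ) (u l) * ((a : ℂ) * v l)).re
            = a * ((starRingEnd ℂ) (u l) * v l).re := fun l => by
          rw [mul_left_comm, Complex.re_ofReal_mul]
        simp only [this, mul_left_comm _ a, ← Finset.mul_sum, Complex.ofReal_mul]
        ring }

theorem shear_apply (u : Fin (n + 1) → ℂ) (G : Fin (n + 1) → Fin (n + 1) → ℝ) (v : E n)
    (j : Fin (n + 1)) : shear u G v j =
      Complex.I * u j * ((∑ l, G j l * ((starRingEnd ℂ) (u l) * v l).re : ℝ) : ℂ) := rfl

theorem shear_shear (u : Fin (n + 1) → ℂ) (G G' : Fin (n + 1) → Fin (n + 1) → ℝ) (v : E n) :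
    shear u G (shear u G' v) = 0 := by
  ext j
  rw [shear_apply]
  have : ∀ l, ((starRingEnd ℂ) (u l) * shear u G' v l).re = 0 := fun l => by
    rw [shear_apply]
    have : (starRingEnd ℂ) (u l) * (Complex.I * u l *
        ((∑ l', G' l l' * ((starRingEnd ℂ) (u l') * v l').re : ℝ) : ℂ))
        = ((Complex.normSq (u l) * (∑ l', G' l l' * ((starRingEnd ℂ) (u l') * v l').re) : ℝ) : ℂ)
          * Complex.I := by
      rw [Complex.ofReal_mul, Complex.normSq_eq_conj_mul_self]; ring
    rw [this]; simp
  simp [this]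

theorem omega_shear (u : Fin (n + 1) → ℂ) (G : Fin (n + 1) → Fin (n + 1) → ℝ) (v w : E n) :
    omega (shear u G v) w = -∑ j, ∑ l, G j l * ((starRingEnd ℂ) (u l) * v l).re *
      ((starRingEnd ℂ) (u j) * w j).re := by
  unfold omega
  rw [← Finset.sum_neg_distrib]
  refine Finset.sum_congr rfl fun j _ => ?_
  rw [shear_apply, ← Finset.sum_mul]
  simp only [map_mul, Complex.conj_ofReal, Complex.conj_I]
  rw [show -Complex.I * (starRingEnd ℂ) (u j) *
      ((∑ l, G j l * ((starRingEnd ℂ) (u l) * v l).re : ℝ) : ℂ) * w j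
      = ((∑ l, G j l * ((starRingEnd ℂ) (u l) * v l).re : ℝ) : ℂ) *
        (-Complex.I * ((starRingEnd ℂ) (u j) * w j)) by ring, Complex.im_ofReal_mul]
  simp
  ring

theorem omega_shear_symm (u : Fin (n + 1) → ℂ) {G : Fin (n + 1) → Fin (n + 1) → ℝ}
    (hG : ∀ j l, G j l = G l j) (v w : E n) :
    omega (shear u G v) w + omega v (shear u G w) = 0 := by
  rw [omega_antisymm v, omega_shear, omega_shear, Finset.sum_comm]
  have : ∀ j l, G l j * ((starRingEnd ℂ) (u j) * v j).re * ((starRingEnd ℂ) (u l) * w l).re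
      = G j l * ((starRingEnd ℂ) (u l) * w l).re * ((starRingEnd ℂ) (u j) * v j).re :=
    fun j l => by rw [hG]; ring
  simp only [this]
  ring

/-- Shears `N` with symmetric coefficients are infinitesimally symplectic and have square zero, so
that `1 + t N` is symplectic. -/
theorem omega_one_add_shear (u : Fin (n + 1) → ℂ) {G : Fin (n + 1) → Fin (n + 1) → ℝ}
    (hG : ∀ j l, G j l = G l j) (t : ℝ) (v w : E n) :
    omega (v + t • shear u G v) (w + t • shear u G w) = omega v w := by
  have h1 := omega_shear_symm u hG v w
  have h2 := omega_shear_symm u hG v (shear u G w)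
  rw [shear_shear] at h2
  have h3 : omega v (0 : E n) = 0 := by simp [omega]
  simp only [omega_add_left, omega_add_right, omega_smul_left, omega_smul_right]
  rw [h3, add_zero] at h2
  rw [h2]
  linear_combination t * h1

theorem norm_shear_le {u : Fin (n + 1) → ℂ} (hu : ∀ j, ‖u j‖ ≤ 1)
    {G : Fin (n + 1) → Fin (n + 1) → ℝ} {g : ℝ} (hG : ∀ j l, |G j l| ≤ g) (v : E n) :
    ‖shear u G v‖ ≤ (n + 1) * ((n + 1) * g) * ‖v‖ := by
  have hg : 0 ≤ g := (abs_nonneg _).trans (hG 0 0)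
  rw [mul_assoc]
  refine norm_le_of_coord fun j => ?_
  rw [shear_apply, norm_mul, norm_mul, Complex.norm_I, one_mul, Complex.norm_real, Real.norm_eq_abs]
  calc ‖u j‖ * |∑ l, G j l * ((starRingEnd ℂ) (u l) * v l).re|
      ≤ 1 * ∑ l : Fin (n + 1), g * ‖v‖ := by
        refine mul_le_mul (hu j) ((Finset.abs_sum_le_sum_abs _ _).trans
          (Finset.sum_le_sum fun l _ => ?_)) (abs_nonneg _) zero_le_one
        rw [abs_mul]
        refine mul_le_mul (hG j l) ((Complex.abs_re_le_norm _).trans ?_) (abs_nonneg _) hg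
        rw [norm_mul, RCLike.norm_conj]
        calc ‖u l‖ * ‖v l‖ ≤ 1 * ‖v‖ :=
              mul_le_mul (hu l) (norm_coord_le v l) (norm_nonneg _) zero_le_one
          _ = ‖v‖ := one_mul _
    _ = (n + 1) * g * ‖v‖ := by simp; ring

/-- The determinant of the coordinates of `n + 1` vectors. -/
noncomputable def frameDet (v : Fin (n + 1) → E n) : ℂ := Matrix.det (Matrix.of fun i j => v i j)

/-- Linearly independent vectors which span an isotropic subspace are independent over `ℂ`. -/
theorem frameDet_ne_zero {w : Fin (n + 1) → E n} (hw : ∀ i j, omega (w i) (w j) = 0)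
    (hli : LinearIndependent ℝ w) : frameDet w ≠ 0 := by
  intro h
  obtain ⟨c, hc, hcw⟩ := Matrix.exists_vecMul_eq_zero_iff.2 h
  set a : E n := ∑ i, (c i).re • w i with ha
  set b : E n := ∑ i, (c i).im • w i with hb
  have hab : a = -(Complex.I • b) := by
    rw [eq_neg_iff_add_eq_zero]
    ext j
    have := congrFun hcw j
    simp only [Matrix.vecMul, dotProduct, Matrix.of_apply, Pi.zero_apply] at this
    have h0 : (0 : E n) j = 0 := rfl
    rw [h0, ← this]
    simp only [ha, hb, PiLp.add_apply, PiLp.smul_apply, WithLp.ofLp_sum, Finset.sum_apply,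
      Complex.real_smul, smul_eq_mul, Finset.mul_sum, ← Finset.sum_add_distrib, WithLp.ofLp_smul,
      Pi.smul_apply]
    refine Finset.sum_congr rfl fun i _ => ?_
    conv_rhs => rw [← Complex.re_add_im (c i)]
    ring
  have hom : omega b a = 0 := by
    simp [ha, hb, omega_sum_left, omega_sum_right, omega_smul_left, omega_smul_right, hw]
  have hb0 : b = 0 := by
    rw [hab, omega_eq_im_inner, inner_neg_right, inner_smul_right] at hom
    have h1 : (inner ℂ b b).re = 0 := by simpa using hom
    have h2 : (inner ℂ b b).re = ‖b‖ ^ 2 := by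
      rw [inner_self_eq_norm_sq_to_K]; norm_cast
    rw [h2] at h1
    simpa using h1
  have ha0 : a = 0 := by rw [hab, hb0]; simp
  rw [Fintype.linearIndependent_iff] at hli
  have h1 := hli (fun i => (c i).re) ha0
  have h2 := hli (fun i => (c i).im) hb0
  exact hc (funext fun i => Complex.ext (h1 i) (h2 i))

/-- Frames which are orthonormal for the Hermitian inner product, i.e. orthonormal frames of
Lagrangian subspaces. -/
def IsUnitaryFrame (V : Fin (n + 1) → E n) : Prop :=
  ∀ i j, inner ℂ (V i) (V j) = if i = j then 1 else 0

theorem IsUnitaryFrame.norm_eq {V : Fin (n + 1) → E n} (hV : IsUnitaryFrame V) (i : Fin (n + 1)) :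
    ‖V i‖ = 1 := by
  have h2 : ‖V i‖ ^ 2 = 1 := by
    rw [← inner_self_eq_norm_sq (𝕜 := ℂ), hV i i, if_pos rfl]
    rfl
  exact (pow_eq_one_iff_of_nonneg (norm_nonneg _) two_ne_zero).1 h2

theorem IsUnitaryFrame.linearIndependent {V : Fin (n + 1) → E n} (hV : IsUnitaryFrame V) :
    LinearIndependent ℝ V := by
  have h : Orthonormal ℂ V := orthonormal_iff_ite.2 hV
  exact h.linearIndependent.restrict_scalars' ℝ

theorem isCompact_unitaryFrames : IsCompact {V : Fin (n + 1) → E n | IsUnitaryFrame V} := by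
  refine Metric.isCompact_of_isClosed_isBounded ?_ ?_
  · simp only [IsUnitaryFrame, Set.ofPred_forall]
    exact isClosed_iInter fun i => isClosed_iInter fun j =>
      isClosed_eq (by fun_prop) continuous_const
  · refine (Metric.isBounded_closedBall (x := 0) (r := 1)).subset fun V hV => ?_
    rw [mem_closedBall_zero_iff, pi_norm_le_iff_of_nonneg zero_le_one]
    exact fun i => (IsUnitaryFrame.norm_eq hV i).le

/-- The maps `1 + t N` are symplectic, and hence take Lagrangian frames to Lagrangian frames. -/
theorem frameDet_shear_ne_zero {V : Fin (n + 1) → E n} (hV : IsUnitaryFrame V)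
    (u : Fin (n + 1) → ℂ) {G : Fin (n + 1) → Fin (n + 1) → ℝ} (hG : ∀ j l, G j l = G l j)
    (t : ℝ) : frameDet (fun i => V i + t • shear u G (V i)) ≠ 0 := by
  refine frameDet_ne_zero (fun i j => ?_) ?_
  · rw [omega_one_add_shear u hG, omega_eq_im_inner, hV]
    split_ifs <;> simp
  · have h := hV.linearIndependent
    refine LinearIndependent.map' (f := ((1 : E n →ₗ[ℝ] E n) + t • (shear u G).toLinearMap)) h ?_
    rw [LinearMap.ker_eq_bot']
    intro v hv
    have hv' : v + t • shear u G v = 0 := hv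
    have h2 := congrArg (shear u G) hv'
    rw [map_add, map_smul, shear_shear, smul_zero, add_zero, map_zero] at h2
    rw [h2, smul_zero, add_zero] at hv'
    exact hv'

theorem continuous_frameDet : Continuous (frameDet (n := n)) := by
  unfold frameDet
  refine Continuous.matrix_det ?_
  fun_prop

/-- The determinant of a sheared unitary frame is bounded below, uniformly for bounded shears and
bounded times. -/
theorem exists_frameDet_shear_lower_bound (n : ℕ) (g T : ℝ) : ∃ c > 0,
    ∀ (u : Fin (n + 1) → ℂ) (G : Fin (n + 1) → Fin (n + 1) → ℝ) (V : Fin (n + 1) → E n) (t : ℝ),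
      (∀ j, ‖u j‖ ≤ 1) → (∀ j l, |G j l| ≤ g) → (∀ j l, G j l = G l j) → IsUnitaryFrame V →
      t ∈ Set.Icc 0 T → c ≤ ‖frameDet (fun i => V i + t • shear u G (V i))‖ := by
  let S : Set ((Fin (n + 1) → ℂ) × (Fin (n + 1) → Fin (n + 1) → ℝ) × (Fin (n + 1) → E n) × ℝ) :=
    {u | ∀ j, ‖u j‖ ≤ 1} ×ˢ {G | (∀ j l, |G j l| ≤ g) ∧ ∀ j l, G j l = G l j} ×ˢ
      {V | IsUnitaryFrame V} ×ˢ Set.Icc 0 T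
  have hS : IsCompact S := by
    refine IsCompact.prod ?_ (IsCompact.prod ?_ (isCompact_unitaryFrames.prod isCompact_Icc))
    · have : {u : Fin (n + 1) → ℂ | ∀ j, ‖u j‖ ≤ 1} =
          Set.univ.pi fun _ => Metric.closedBall (0 : ℂ) 1 := by ext; simp
      rw [this]
      exact isCompact_univ_pi fun _ => isCompact_closedBall _ _
    · have h1 : IsCompact (Set.univ.pi fun _ : Fin (n + 1) => Set.univ.pi fun _ : Fin (n + 1) =>
          Metric.closedBall (0 : ℝ) g) :=
        isCompact_univ_pi fun _ => isCompact_univ_pi fun _ => isCompact_closedBall _ _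
      have h2 : IsClosed {G : Fin (n + 1) → Fin (n + 1) → ℝ | ∀ j l, G j l = G l j} := by
        simp only [Set.ofPred_forall]
        exact isClosed_iInter fun i => isClosed_iInter fun j =>
          isClosed_eq (by fun_prop) (by fun_prop)
      convert h1.inter_right h2 using 1
      ext G; simp
  have hcont : Continuous fun z : (Fin (n + 1) → ℂ) × (Fin (n + 1) → Fin (n + 1) → ℝ) ×
      (Fin (n + 1) → E n) × ℝ =>
      ‖frameDet (fun i => z.2.2.1 i + z.2.2.2 • shear z.1 z.2.1 (z.2.2.1 i))‖ := by
    refine (continuous_frameDet.comp (continuous_pi fun i => ?_)).norm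
    have h : Continuous fun z : (Fin (n + 1) → ℂ) × (Fin (n + 1) → Fin (n + 1) → ℝ) ×
      (Fin (n + 1) → E n) × ℝ => shear z.1 z.2.1 (z.2.2.1 i) := by
      refine (PiLp.continuous_toLp 2 _).comp (continuous_pi fun j => ?_)
      fun_prop
    fun_prop
  rcases S.eq_empty_or_nonempty with hE | hne
  · refine ⟨1, one_pos, fun u G V t hu hG hs hV ht => ?_⟩
    exact absurd (show (u, G, V, t) ∈ S from ⟨hu, ⟨hG, hs⟩, hV, ht⟩) (by rw [hE]; simp)
  · obtain ⟨z, hz, hmin⟩ := hS.exists_isMinOn hne hcont.continuousOn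
    refine ⟨_, norm_pos_iff.2 (frameDet_shear_ne_zero hz.2.2.1 z.1 hz.2.1.2 z.2.2.2),
      fun u G V t hu hG hs hV ht => ?_⟩
    exact hmin (show (u, G, V, t) ∈ S from ⟨hu, ⟨hG, hs⟩, hV, ht⟩)

/-- The argument of the determinant of a sheared unitary frame changes by at most `(n + 1) π`, as
this determinant is a polynomial of degree at most `n + 1` in the time. -/
theorem exists_arg_frameDet_shear {V : Fin (n + 1) → E n} (hV : IsUnitaryFrame V)
    (u : Fin (n + 1) → ℂ) {G : Fin (n + 1) → Fin (n + 1) → ℝ} (hG : ∀ j l, G j l = G l j) (T : ℝ) :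
    ∃ φ : ℝ → ℝ, ContinuousOn φ (Set.Icc 0 T) ∧ φ 0 = 0 ∧ (∀ t, |φ t| ≤ (n + 1) * Real.pi) ∧
      ∀ t ∈ Set.Icc 0 T, ∃ ρ : ℝ, 0 < ρ ∧ frameDet (fun i => V i + t • shear u G (V i)) =
        ρ * Complex.exp (φ t * Complex.I) * frameDet V := by
  obtain ⟨P, hdeg, hP⟩ := exists_polynomial_det (Matrix.of fun i j => V i j)
    (Matrix.of fun i j => shear u G (V i) j)
  have hPt : ∀ t : ℝ, P.eval (t : ℂ) = frameDet (fun i => V i + t • shear u G (V i)) := fun t => by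
    rw [hP, frameDet]
    rfl
  obtain ⟨φ, hc, h0, hb, hφ⟩ := exists_arg_polynomial hdeg T fun t _ => by
    rw [hPt]; exact frameDet_shear_ne_zero hV u hG t
  refine ⟨φ, hc, h0, by simpa using hb, fun t ht => ?_⟩
  have hP0 := hPt 0
  simp only [zero_smul, add_zero, Complex.ofReal_zero] at hP0
  rw [← hPt, ← hP0]
  exact hφ t ht

/-! ### Adapted unitary frames and comparison of volume forms -/

/-- The real inner product on a real subspace of `ℂ^(n+1)`. -/
noncomputable def reInner (Λ : Submodule ℝ (E n)) : LinearMap.BilinForm ℝ Λ :=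
  LinearMap.mk₂ ℝ (fun v w => (inner ℂ (v : E n) (w : E n)).re)
    (fun u v w => by simp) (fun a v w => by
      rw [Submodule.coe_smul, real_smul_eq, inner_smul_left]; simp)
    (fun u v w => by simp) (fun a v w => by
      rw [Submodule.coe_smul, real_smul_eq, inner_smul_right]; simp)

theorem reInner_apply (Λ : Submodule ℝ (E n)) (v w : Λ) :
    reInner Λ v w = (inner ℂ (v : E n) (w : E n)).re := rfl

/-- An isotropic subspace `Λ` of dimension `n` and a vector `z ∉ Λ` which is `ω`-orthogonal to it
span a Lagrangian subspace, which has an orthonormal basis adapted to `Λ`. -/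
theorem exists_unitaryFrame {Λ : Submodule ℝ (E n)} (hfr : Module.finrank ℝ Λ = n)
    (hiso : ∀ v ∈ Λ, ∀ w ∈ Λ, omega v w = 0) {z : E n} (hz : ∀ v ∈ Λ, omega z v = 0)
    (hzΛ : z ∉ Λ) :
    ∃ (V : Fin (n + 1) → E n) (c : ℝ) (e : Module.Basis (Fin n) ℝ Λ), 0 < c ∧ IsUnitaryFrame V ∧
      (∃ l ∈ Λ, V 0 = c • (z + l)) ∧ ∀ i : Fin n, V i.succ = e i := by
  obtain ⟨b₀, hb₀⟩ := LinearMap.BilinForm.exists_orthogonal_basis (B := reInner Λ)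
    ⟨fun v w => by
      simp only [reInner_apply, RingHom.id_apply]
      rw [← inner_conj_symm, Complex.conj_re]⟩
  let b := b₀.reindex (finCongr hfr)
  have hb : ∀ i j, i ≠ j → (inner ℂ (b i : E n) (b j : E n)).re = 0 := fun i j hij => by
    have := hb₀ (i := (finCongr hfr).symm i) (j := (finCongr hfr).symm j) (by simpa using hij)
    simpa [b, Module.Basis.reindex_apply, Function.onFun, reInner_apply] using this
  have hbne : ∀ i, ‖(b i : E n)‖ ≠ 0 := fun i => by simpa using b.ne_zero i
  let e := b.isUnitSMul (w := fun i => ‖(b i : E n)‖⁻¹) fun i => (inv_ne_zero (hbne i)).isUnit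
  have he : ∀ i, (e i : E n) = ‖(b i : E n)‖⁻¹ • (b i : E n) := fun i => by
    simp [e, Module.Basis.isUnitSMul_apply]
  have him : ∀ v ∈ Λ, ∀ w ∈ Λ, (inner ℂ v w).im = 0 := fun v hv w hw => by
    rw [← omega_eq_im_inner]; exact hiso v hv w hw
  have hee : ∀ i j, inner ℂ (e i : E n) (e j : E n) = if i = j then 1 else 0 := fun i j => by
    apply Complex.ext
    · rw [he, he, real_smul_eq, real_smul_eq, inner_smul_left, inner_smul_right]
      split_ifs with h
      · subst h
        have h3 : inner ℂ (b i : E n) (b i : E n) = ((‖(b i : E n)‖ ^ 2 : ℝ) : ℂ) := by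
          rw [inner_self_eq_norm_sq_to_K]; norm_cast
        rw [h3, Complex.conj_ofReal, ← Complex.ofReal_mul, ← Complex.ofReal_mul, Complex.ofReal_re,
          Complex.one_re]
        field_simp [hbne i]
      · rw [Complex.conj_ofReal, Complex.re_ofReal_mul, Complex.re_ofReal_mul, hb i j h]
        simp
    · rw [him _ (e i).2 _ (e j).2]
      split_ifs <;> simp
  set l : E n := -∑ i, (inner ℂ (e i : E n) z).re • (e i : E n) with hl
  have hlΛ : l ∈ Λ := Submodule.neg_mem _ (Submodule.sum_mem _ fun i _ =>
    Submodule.smul_mem _ _ (e i).2)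
  have hzim : ∀ v ∈ Λ, (inner ℂ v z).im = 0 := fun v hv => by
    rw [← omega_eq_im_inner, omega_antisymm, hz v hv, neg_zero]
  have hperp : ∀ i, inner ℂ (e i : E n) (z + l) = 0 := fun i => by
    apply Complex.ext
    · rw [inner_add_right, hl, inner_neg_right, inner_sum]
      simp only [real_smul_eq, inner_smul_right, hee]
      simp
    · rw [inner_add_right, Complex.add_im, hzim _ (e i).2, him _ (e i).2 _ hlΛ]
      simp
  have hne : ‖z + l‖ ≠ 0 := fun h => hzΛ (by
    rw [norm_eq_zero] at h
    rw [eq_neg_of_add_eq_zero_left h]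
    exact Submodule.neg_mem _ hlΛ)
  have hpos : 0 < ‖z + l‖⁻¹ := inv_pos.2 (lt_of_le_of_ne (norm_nonneg _) hne.symm)
  have hself : inner ℂ (z + l) (z + l) = ((‖z + l‖ ^ 2 : ℝ) : ℂ) := by
    rw [inner_self_eq_norm_sq_to_K]; norm_cast
  refine ⟨Fin.cons (‖z + l‖⁻¹ • (z + l)) fun i => (e i : E n), ‖z + l‖⁻¹, e, hpos, ?_,
    ⟨l, hlΛ, by simp⟩, fun i => by simp⟩
  intro i j
  refine Fin.cases ?_ (fun i => ?_) i <;> refine Fin.cases ?_ (fun j => ?_) j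
  · simp only [Fin.cons_zero, if_true]
    rw [real_smul_eq, inner_smul_left, inner_smul_right, hself, Complex.conj_ofReal]
    norm_cast
    field_simp
  · simp only [Fin.cons_zero, Fin.cons_succ, (Fin.succ_ne_zero j).symm, if_false]
    rw [real_smul_eq, inner_smul_left, ← inner_conj_symm, hperp]; simp
  · simp only [Fin.cons_zero, Fin.cons_succ, Fin.succ_ne_zero, if_false]
    rw [real_smul_eq, inner_smul_right, hperp, mul_zero]
  · simp only [Fin.cons_succ, hee, Fin.succ_inj]

/-- Near the origin, the value of the form `q Θ` on a frame is relatively close to the standard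
determinant, if that is bounded below. -/
theorem exists_form_close {Θ : E n → Form n} {q : E n → ℂ} (hΘ : ContinuousAt Θ 0)
    (hΘ0 : ∀ v, Θ 0 v = frameDet v) (hq : ContinuousAt q 0) (hq0 : q 0 = 1) (C : ℝ) {c ε : ℝ}
    (hc : 0 < c) (hε : 0 < ε) : ∃ δ > 0, ∀ x : E n, ‖x‖ < δ → ∀ w w' : Fin (n + 1) → E n,
      (∀ i, ‖w i‖ ≤ C) → (∀ i, ‖w' i - w i‖ ≤ δ) → c ≤ ‖frameDet w‖ →
      ‖q x * Θ x w' / frameDet w - 1‖ < ε := by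
  rcases le_or_gt 0 C with hC | hC
  swap
  · exact ⟨1, one_pos, fun x _ w w' h => absurd ((norm_nonneg _).trans (h 0)) (not_le.2 hC)⟩
  set η : ℝ := c * ε / 3 with hη
  have hη0 : 0 < η := by positivity
  have hcont : ContinuousAt (fun x => q x • Θ x - Θ 0) 0 := (hq.smul hΘ).sub continuousAt_const
  obtain ⟨δ₁, hδ₁, h1⟩ := Metric.continuousAt_iff.1 hcont (η / (C + 1) ^ (n + 1)) (by positivity)
  obtain ⟨δ₂, hδ₂, h2⟩ := Metric.uniformContinuousOn_iff.1
    ((isCompact_closedBall (0 : Fin (n + 1) → E n) (C + 1)).uniformContinuousOn_of_continuous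
      continuous_frameDet.continuousOn) η hη0
  refine ⟨min δ₁ (min (δ₂ / 2) 1), by positivity, fun x hx w w' hw hw' hcw => ?_⟩
  have hdet0 : frameDet w ≠ 0 := norm_pos_iff.1 (hc.trans_le hcw)
  have hw'n : ∀ i, ‖w' i‖ ≤ C + 1 := fun i => by
    have h3 := (hw' i).trans ((min_le_right _ _).trans (min_le_right _ _))
    linarith [norm_le_norm_add_norm_sub' (w' i) (w i), hw i]
  have hA : ‖(q x • Θ x - Θ 0) w'‖ ≤ η := by
    have h3 := h1 (x := x) (by simpa using hx.trans_le (min_le_left _ _))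
    rw [hq0, one_smul, sub_self, dist_zero_right] at h3
    refine ((q x • Θ x - Θ 0).le_opNorm w').trans ?_
    have h4 : ∏ i, ‖w' i‖ ≤ (C + 1) ^ (n + 1) := by
      refine (Finset.prod_le_prod (fun i _ => norm_nonneg _) fun i _ => hw'n i).trans ?_
      simp
    calc _ ≤ η / (C + 1) ^ (n + 1) * (C + 1) ^ (n + 1) :=
          mul_le_mul h3.le h4 (Finset.prod_nonneg fun i _ => norm_nonneg _) (by positivity)
      _ = η := by field_simp
  have hB : ‖frameDet w' - frameDet w‖ ≤ η := by
    have h3 := h2 w' ?_ w ?_ ?_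
    · rw [dist_eq_norm] at h3; exact h3.le
    · rw [mem_closedBall_zero_iff, pi_norm_le_iff_of_nonneg (by positivity)]; exact hw'n
    · rw [mem_closedBall_zero_iff, pi_norm_le_iff_of_nonneg (by positivity)]
      exact fun i => (hw i).trans (by linarith)
    · rw [dist_eq_norm]
      refine lt_of_le_of_lt ((pi_norm_le_iff_of_nonneg (by positivity : 0 ≤ δ₂ / 2)).2 fun i => ?_)
        (by linarith)
      exact (hw' i).trans ((min_le_right _ _).trans (min_le_left _ _))
  have hsplit : q x * Θ x w' / frameDet w - 1 =
      ((q x • Θ x - Θ 0) w' + (frameDet w' - frameDet w)) / frameDet w := by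
    have : (q x • Θ x - Θ 0) w' = q x * Θ x w' - frameDet w' := by rw [← hΘ0]; rfl
    rw [this]
    field_simp
    ring
  rw [hsplit, norm_div, div_lt_iff₀ (hc.trans_le hcw)]
  calc _ ≤ η + η := (norm_add_le _ _).trans (add_le_add hA hB)
    _ < ε * c := by rw [hη]; nlinarith [mul_pos hc hε]
    _ ≤ _ := by gcongr

/-- The argument is continuous and vanishes at `1`. -/
theorem exists_arg_close_one {ε : ℝ} (hε : 0 < ε) :
    ∃ δ > 0, ∀ z : ℂ, ‖z - 1‖ < δ → z ∈ Complex.slitPlane ∧ |Complex.arg z| < ε := by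
  have h1 : ∀ᶠ z in nhds (1 : ℂ), z ∈ Complex.slitPlane :=
    Complex.isOpen_slitPlane.mem_nhds Complex.one_mem_slitPlane
  have h2 : ∀ᶠ z in nhds (1 : ℂ), |Complex.arg z| < ε := by
    have := (Complex.continuousAt_arg Complex.one_mem_slitPlane).abs
    exact this.eventually_lt continuousAt_const (by simpa using hε)
  obtain ⟨δ, hδ, h⟩ := Metric.eventually_nhds_iff.1 (h1.and h2)
  exact ⟨δ, hδ, fun z hz => h (by rwa [dist_eq_norm])⟩

/-! ### The horizontal vector field in coordinates -/

/-- The indices of the coordinates on which the torus acts. -/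
def head (n k : ℕ) : Finset (Fin (n + 1)) := Finset.univ.filter fun j => (j : ℕ) < k

theorem mem_head {k : ℕ} {j : Fin (n + 1)} : j ∈ head n k ↔ (j : ℕ) < k := by simp [head]

/-- The exponent of `y_j` in `y_2 ⋯ y_k / y_1`. -/
def sgn (j : Fin (n + 1)) : ℝ := if (j : ℕ) = 0 then -1 else 1

theorem sgn_mul_self (j : Fin (n + 1)) : sgn j * sgn j = 1 := by unfold sgn; split_ifs <;> norm_num

theorem abs_sgn (j : Fin (n + 1)) : |sgn j| = 1 := by unfold sgn; split_ifs <;> norm_num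

/-- The logarithmic derivative of `q`. -/
noncomputable def kap (q : E n → ℂ) (x : E n) : E n →L[ℝ] ℂ := (q x)⁻¹ • fderiv ℝ q x

/-- For `j` in the head and `q` torus invariant, the gradient of `log |q|` has `j`-th component
`gam q x j * x j`. -/
noncomputable def gam (q : E n → ℂ) (x : E n) (j : Fin (n + 1)) : ℝ :=
  (kap q x (EuclideanSpace.single j (x j))).re / ‖x j‖ ^ 2

/-- The sum of the `|x_j|⁻²` over the head. -/
noncomputable def headSum (k : ℕ) (x : E n) : ℝ := ∑ j ∈ head n k, (‖x j‖ ^ 2)⁻¹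

/-- The components outside of the head of the gradient of `log |q|`. -/
noncomputable def tgrad (q : E n → ℂ) (k : ℕ) (x : E n) : E n :=
  WithLp.toLp 2 fun j => if (j : ℕ) < k then 0 else
    (((kap q x (EuclideanSpace.single j 1)).re : ℂ) +
      ((kap q x (EuclideanSpace.single j Complex.I)).re : ℂ) * Complex.I)

/-- The contribution of `q` to the denominator of the horizontal field. -/
noncomputable def corr (q : E n → ℂ) (k : ℕ) (x : E n) : ℝ :=
  ∑ j ∈ head n k, sgn j * gam q x j + (kap q x (Complex.I • tgrad q k x)).im

/-- The derivative of `arg p` along the Hamiltonian vector field of `log |p|`, for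
`p = q * y_2 ⋯ y_k / y_1`. -/
noncomputable def denom (q : E n → ℂ) (k : ℕ) (x : E n) : ℝ := headSum k x + corr q k x

/-- The angular velocity of the coordinate `x_j` along the horizontal field. -/
noncomputable def speed (q : E n → ℂ) (k : ℕ) (x : E n) (j : Fin (n + 1)) : ℝ :=
  -(sgn j * (‖x j‖ ^ 2)⁻¹ + gam q x j) / denom q k x

/-- The horizontal lift of `-i ζ ∂_ζ` with respect to `p = q * y_2 ⋯ y_k / y_1`, for `q` torus
invariant: a multiple of the Hamiltonian vector field of `log |p|`. -/
noncomputable def field (q : E n → ℂ) (k : ℕ) (x : E n) : E n :=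
  WithLp.toLp 2 fun j => if (j : ℕ) < k then Complex.I * (speed q k x j : ℂ) * x j else
    -(Complex.I * tgrad q k x j / (denom q k x : ℂ))

/-- The logarithmic derivative of `q * y_2 ⋯ y_k / y_1`. -/
noncomputable def dlog (q : E n → ℂ) (k : ℕ) (x v : E n) : ℂ :=
  ∑ j ∈ head n k, (sgn j : ℂ) * (v j / x j) + kap q x v

theorem eq_sum_single (v : E n) : v = ∑ j, EuclideanSpace.single j (v j) := by
  ext i
  simp [Finset.sum_apply, Pi.single_apply]

theorem single_real_mul (j : Fin (n + 1)) (a : ℝ) (z : ℂ) :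
    (EuclideanSpace.single j ((a : ℂ) * z) : E n) = a • EuclideanSpace.single j z := by
  ext i
  by_cases h : i = j <;> simp [h]

theorem single_add (j : Fin (n + 1)) (z w : ℂ) :
    (EuclideanSpace.single j (z + w) : E n) =
      EuclideanSpace.single j z + EuclideanSpace.single j w := by
  ext i
  by_cases h : i = j <;> simp [h]

/-- If `kap q x` vanishes on the rotation of the `j`-th coordinate, its real part in this coordinate
is radial. -/
theorem re_kap_single_head {q : E n → ℂ} {x : E n} {j : Fin (n + 1)} (hx : x j ≠ 0)
    (hrot : kap q x (EuclideanSpace.single j (Complex.I * x j)) = 0) (w : ℂ) :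
    (kap q x (EuclideanSpace.single j w)).re = gam q x j * ((starRingEnd ℂ) (x j) * w).re := by
  have hw : w = ((w / x j).re : ℂ) * x j + ((w / x j).im : ℂ) * (Complex.I * x j) := by
    conv_lhs => rw [← div_mul_cancel₀ w hx, ← Complex.re_add_im (w / x j)]
    ring
  have hre : ((starRingEnd ℂ) (x j) * w).re = (w / x j).re * ‖x j‖ ^ 2 := by
    have h1 : (starRingEnd ℂ) (x j) * w = (w / x j) * ((‖x j‖ ^ 2 : ℝ) : ℂ) := by
      rw [← Complex.normSq_eq_norm_sq, Complex.normSq_eq_conj_mul_self]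
      field_simp
    rw [h1, Complex.re_mul_ofReal]
  have hn : ‖x j‖ ^ 2 ≠ 0 := pow_ne_zero 2 (norm_ne_zero_iff.2 hx)
  rw [hre]
  conv_lhs => rw [hw, single_add, single_real_mul, single_real_mul, map_add, map_smul, map_smul,
    hrot, smul_zero, add_zero, Complex.smul_re, smul_eq_mul]
  rw [gam]
  field_simp

theorem re_kap_single_tail {q : E n → ℂ} {k : ℕ} {x : E n} {j : Fin (n + 1)} (hj : ¬ (j : ℕ) < k)
    (w : ℂ) : (kap q x (EuclideanSpace.single j w)).re =
      ((starRingEnd ℂ) (tgrad q k x j) * w).re := by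
  have hw : w = (w.re : ℂ) * 1 + (w.im : ℂ) * Complex.I := by
    rw [mul_one, Complex.re_add_im]
  conv_lhs => rw [hw, single_add, single_real_mul, single_real_mul, map_add, map_smul, map_smul,
    Complex.add_re, Complex.smul_re, Complex.smul_re, smul_eq_mul, smul_eq_mul]
  simp [tgrad, hj]
  ring

theorem re_kap {q : E n → ℂ} {k : ℕ} {x : E n} (hx : ∀ j ∈ head n k, x j ≠ 0)
    (hrot : ∀ j ∈ head n k, kap q x (EuclideanSpace.single j (Complex.I * x j)) = 0) (v : E n) :
    (kap q x v).re = ∑ j : Fin (n + 1),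
      if (j : ℕ) < k then gam q x j * ((starRingEnd ℂ) (x j) * v j).re
      else ((starRingEnd ℂ) (tgrad q k x j) * v j).re := by
  conv_lhs => rw [eq_sum_single v, map_sum, Complex.re_sum]
  refine Finset.sum_congr rfl fun j _ => ?_
  split_ifs with h
  · exact re_kap_single_head (hx j (mem_head.2 h)) (hrot j (mem_head.2 h)) _
  · exact re_kap_single_tail h _

theorem field_head {q : E n → ℂ} {k : ℕ} {x : E n} {j : Fin (n + 1)} (hj : (j : ℕ) < k) :
    field q k x j = Complex.I * (speed q k x j : ℂ) * x j := by simp [field, hj]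

theorem field_tail {q : E n → ℂ} {k : ℕ} {x : E n} {j : Fin (n + 1)} (hj : ¬ (j : ℕ) < k) :
    field q k x j = -(Complex.I * tgrad q k x j / (denom q k x : ℂ)) := by simp [field, hj]

theorem sum_head_eq {M : Type*} [AddCommMonoid M] (k : ℕ) (f : Fin (n + 1) → M) :
    ∑ j ∈ head n k, f j = ∑ j : Fin (n + 1), if (j : ℕ) < k then f j else 0 := by
  rw [head, Finset.sum_filter]

/-- The field lifts `-i ζ ∂_ζ`, as `d log p` maps it to `-i`. -/
theorem dlog_field {q : E n → ℂ} {k : ℕ} {x : E n} (hx : ∀ j ∈ head n k, x j ≠ 0)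
    (hrot : ∀ j ∈ head n k, kap q x (EuclideanSpace.single j (Complex.I * x j)) = 0)
    (hD : denom q k x ≠ 0) : dlog q k x (field q k x) = -Complex.I := by
  have hsplit : field q k x = (∑ j ∈ head n k, speed q k x j •
      (EuclideanSpace.single j (Complex.I * x j) : E n)) +
        (-(denom q k x)⁻¹) • (Complex.I • tgrad q k x) := by
    ext i
    rw [PiLp.add_apply, WithLp.ofLp_sum, Finset.sum_apply]
    by_cases hi : (i : ℕ) < k
    · rw [field_head hi, Finset.sum_eq_single i]
      · simp [tgrad, hi]; ring
      · intro j _ hji; simp [hji.symm]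
      · intro h; exact absurd (mem_head.2 hi) h
    · rw [field_tail hi, Finset.sum_eq_zero]
      · simp; field_simp
      · intro j hj
        have : i ≠ j := fun h => hi (h ▸ mem_head.1 hj)
        simp [this]
  have hre : (kap q x (Complex.I • tgrad q k x)).re = 0 := by
    rw [re_kap hx hrot]
    refine Finset.sum_eq_zero fun j _ => ?_
    split_ifs with h
    · simp [tgrad, h]
    · simp; ring
  have him : kap q x (Complex.I • tgrad q k x) =
      ((corr q k x - ∑ j ∈ head n k, sgn j * gam q x j : ℝ) : ℂ) * Complex.I := by
    apply Complex.ext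
    · rw [hre]; simp
    · simp [corr]
  have hk : kap q x (field q k x) = -(((denom q k x)⁻¹ *
      (corr q k x - ∑ j ∈ head n k, sgn j * gam q x j) : ℝ) : ℂ) * Complex.I := by
    rw [hsplit, map_add, map_sum, Finset.sum_eq_zero, zero_add, map_smul, him, Complex.real_smul]
    · push_cast; ring
    · intro j hj; rw [map_smul, hrot j hj, smul_zero]
  have hh : ∑ j ∈ head n k, (sgn j : ℂ) * (field q k x j / x j) =
      ((∑ j ∈ head n k, sgn j * speed q k x j : ℝ) : ℂ) * Complex.I := by
    push_cast
    rw [Finset.sum_mul]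
    refine Finset.sum_congr rfl fun j hj => ?_
    have hxj := hx j hj
    rw [field_head (mem_head.1 hj)]
    field_simp
  have hsum : ∑ j ∈ head n k, sgn j * speed q k x j =
      -(denom q k x)⁻¹ * (headSum k x + ∑ j ∈ head n k, sgn j * gam q x j) := by
    rw [headSum, ← Finset.sum_add_distrib, Finset.mul_sum]
    refine Finset.sum_congr rfl fun j hj => ?_
    rw [speed]
    linear_combination (-(denom q k x)⁻¹ * (‖x j‖ ^ 2)⁻¹) * sgn_mul_self j
  rw [dlog, hh, hk, hsum]
  have : (denom q k x)⁻¹ * (headSum k x + ∑ j ∈ head n k, sgn j * gam q x j) +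
      (denom q k x)⁻¹ * (corr q k x - ∑ j ∈ head n k, sgn j * gam q x j) = 1 := by
    rw [← mul_add, show headSum k x + ∑ j ∈ head n k, sgn j * gam q x j +
      (corr q k x - ∑ j ∈ head n k, sgn j * gam q x j) = denom q k x by rw [denom]; ring]
    exact inv_mul_cancel₀ hD
  have h2 := congrArg (fun r : ℝ => (r : ℂ)) this
  simp only [Complex.ofReal_add, Complex.ofReal_one] at h2
  rw [neg_mul, Complex.ofReal_neg]
  linear_combination (-Complex.I) * h2

/-- The field is `ω`-dual to a multiple of `d log |p|`. -/
theorem omega_field {q : E n → ℂ} {k : ℕ} {x : E n} (hx : ∀ j ∈ head n k, x j ≠ 0)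
    (hrot : ∀ j ∈ head n k, kap q x (EuclideanSpace.single j (Complex.I * x j)) = 0) (v : E n) :
    omega (field q k x) v = (dlog q k x v).re / denom q k x := by
  rw [dlog, Complex.add_re, re_kap hx hrot, Complex.re_sum, sum_head_eq, ← Finset.sum_add_distrib,
    omega, Finset.sum_div]
  refine Finset.sum_congr rfl fun j _ => ?_
  by_cases hj : (j : ℕ) < k
  · rw [if_pos hj, if_pos hj, field_head hj]
    have hxj := hx j (mem_head.2 hj)
    have h1 : ((sgn j : ℂ) * (v j / x j)).re =
        sgn j * (‖x j‖ ^ 2)⁻¹ * ((starRingEnd ℂ) (x j) * v j).re := by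
      have : (sgn j : ℂ) * (v j / x j) = ((sgn j * (‖x j‖ ^ 2)⁻¹ : ℝ) : ℂ) *
          ((starRingEnd ℂ) (x j) * v j) := by
        have h2 : (starRingEnd ℂ) (x j) ≠ 0 := by simpa using hxj
        rw [← Complex.normSq_eq_norm_sq, Complex.ofReal_mul, Complex.ofReal_inv,
          Complex.normSq_eq_conj_mul_self]
        field_simp
      rw [this, Complex.re_ofReal_mul]
    rw [h1, speed]
    simp only [map_mul, Complex.conj_I, Complex.conj_ofReal]
    rw [show -Complex.I * ((-(sgn j * (‖x j‖ ^ 2)⁻¹ + gam q x j) / denom q k x : ℝ) : ℂ) *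
      (starRingEnd ℂ) (x j) * v j = (((sgn j * (‖x j‖ ^ 2)⁻¹ + gam q x j) / denom q k x : ℝ) : ℂ) *
        (Complex.I * ((starRingEnd ℂ) (x j) * v j)) by push_cast; ring, Complex.im_ofReal_mul]
    simp only [Complex.I_mul_im]
    ring
  · rw [if_neg hj, if_neg hj, field_tail hj]
    simp only [map_neg, map_mul, map_div₀, Complex.conj_I, Complex.conj_ofReal]
    rw [show -(-Complex.I * (starRingEnd ℂ) (tgrad q k x j) / (denom q k x : ℂ)) * v j =
      (((denom q k x)⁻¹ : ℝ) : ℂ) * (Complex.I * ((starRingEnd ℂ) (tgrad q k x j) * v j)) by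
        push_cast; ring, Complex.im_ofReal_mul]
    simp only [Complex.I_mul_im, zero_add]
    ring

/-! ### Estimates for the horizontal field -/

/-- The part of the ball of radius `ρ` where the coordinates in the head do not vanish. -/
def regular (n k : ℕ) (ρ : ℝ) : Set (E n) :=
  {x | x ∈ Metric.ball (0 : E n) ρ ∧ ∀ j ∈ head n k, x j ≠ 0}

/-- Quantitative properties of a torus invariant function `q` on a small ball. The estimate
`kap_head` expresses that `q` is even in each coordinate of the head; `small` makes the terms coming
from `q` negligible with respect to `headSum`. -/
structure IsControlled (q : E n → ℂ) (k : ℕ) (ρ C : ℝ) : Prop where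
  k_pos : 0 < k
  one_le : 1 ≤ C
  smooth : ContDiffOn ℝ ∞ q (Metric.ball 0 ρ)
  ne_zero : ∀ x ∈ Metric.ball (0 : E n) ρ, q x ≠ 0
  rot : ∀ x ∈ regular n k ρ, ∀ j ∈ head n k,
    kap q x (EuclideanSpace.single j (Complex.I * x j)) = 0
  kap_le : ∀ x ∈ Metric.ball (0 : E n) ρ, ‖kap q x‖ ≤ C
  fderiv_kap_le : ∀ x ∈ Metric.ball (0 : E n) ρ, ‖fderiv ℝ (kap q) x‖ ≤ C
  kap_head : ∀ x ∈ regular n k ρ, ∀ j ∈ head n k, ∀ w : ℂ,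
    ‖kap q x (EuclideanSpace.single j w)‖ ≤ C * ‖x j‖ * ‖w‖
  radius_le : ρ ≤ 1
  small : 2 * (3 * (n + 1) * C ^ 2) * ρ ^ 2 ≤ 1

theorem isOpen_regular (k : ℕ) (ρ : ℝ) : IsOpen (regular n k ρ) := by
  have : regular n k ρ = Metric.ball 0 ρ ∩ ⋂ j ∈ head n k, {x : E n | x j ≠ 0} := by
    ext x; simp [regular]
  rw [this]
  refine Metric.isOpen_ball.inter (isOpen_biInter_finset fun j _ => ?_)
  exact isOpen_ne_fun (by fun_prop) continuous_const

theorem kap_contDiffOn {q : E n → ℂ} {ρ : ℝ} (hs : ContDiffOn ℝ ∞ q (Metric.ball 0 ρ))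
    (h0 : ∀ x ∈ Metric.ball (0 : E n) ρ, q x ≠ 0) : ContDiffOn ℝ ∞ (kap q) (Metric.ball 0 ρ) :=
  (hs.inv h0).smul (hs.fderiv_of_isOpen Metric.isOpen_ball (by simp))

theorem norm_single (j : Fin (n + 1)) (w : ℂ) : ‖(EuclideanSpace.single j w : E n)‖ = ‖w‖ := by
  simp

namespace IsControlled

variable {q : E n → ℂ} {k : ℕ} {ρ C : ℝ} {x : E n}

theorem zero_mem_head (h : IsControlled q k ρ C) : (0 : Fin (n + 1)) ∈ head n k :=
  mem_head.2 h.k_pos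

theorem coord_pos (hx : x ∈ regular n k ρ) {j : Fin (n + 1)} (hj : j ∈ head n k) : 0 < ‖x j‖ :=
  norm_pos_iff.2 (hx.2 j hj)

theorem inv_sq_le {x : E n} {j : Fin (n + 1)} (hj : j ∈ head n k) : (‖x j‖ ^ 2)⁻¹ ≤ headSum k x :=
  Finset.single_le_sum (f := fun j => (‖x j‖ ^ 2)⁻¹) (fun _ _ => by positivity) hj

theorem headSum_pos (h : IsControlled q k ρ C) (hx : x ∈ regular n k ρ) : 0 < headSum k x :=
  lt_of_lt_of_le (inv_pos.2 (pow_pos (coord_pos hx h.zero_mem_head) 2)) (inv_sq_le h.zero_mem_head)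

theorem norm_lt (hx : x ∈ regular n k ρ) : ‖x‖ < ρ := by simpa using hx.1

theorem inv_le_sqrt {j : Fin (n + 1)} (hj : j ∈ head n k) :
    ‖x j‖⁻¹ ≤ √(headSum k x) := by
  apply Real.le_sqrt_of_sq_le
  rw [inv_pow]
  exact inv_sq_le hj

theorem one_le_mul_sqrt (hx : x ∈ regular n k ρ) {j : Fin (n + 1)} (hj : j ∈ head n k) :
    1 ≤ ‖x j‖ * √(headSum k x) := by
  have h1 := coord_pos hx hj
  calc (1 : ℝ) = ‖x j‖ * ‖x j‖⁻¹ := by field_simp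
    _ ≤ _ := by gcongr; exact inv_le_sqrt hj

theorem inv_sqrt_le_norm (h : IsControlled q k ρ C) (hx : x ∈ regular n k ρ) :
    (√(headSum k x))⁻¹ ≤ ‖x‖ := by
  have h1 := one_le_mul_sqrt hx h.zero_mem_head
  have h2 := Real.sqrt_pos.2 (h.headSum_pos hx)
  rw [inv_le_iff_one_le_mul₀ h2]
  exact h1.trans (by gcongr; exact norm_coord_le x 0)

theorem one_le_sqrt (h : IsControlled q k ρ C) (hx : x ∈ regular n k ρ) :
    1 ≤ √(headSum k x) := by
  have h1 := h.inv_sqrt_le_norm hx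
  have h2 := Real.sqrt_pos.2 (h.headSum_pos hx)
  have h3 : (√(headSum k x))⁻¹ ≤ 1 := h1.trans ((norm_lt hx).le.trans h.radius_le)
  exact (inv_le_one₀ h2).1 h3

theorem abs_gam_le (h : IsControlled q k ρ C) (hx : x ∈ regular n k ρ) {j : Fin (n + 1)}
    (hj : j ∈ head n k) : |gam q x j| ≤ C := by
  have h1 := coord_pos hx hj
  rw [gam, abs_div, abs_of_pos (pow_pos h1 2), div_le_iff₀ (pow_pos h1 2)]
  refine (Complex.abs_re_le_norm _).trans ((h.kap_head x hx j hj _).trans (le_of_eq ?_))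
  ring

theorem norm_tgrad_coord_le (h : IsControlled q k ρ C) (hx : x ∈ regular n k ρ)
    (j : Fin (n + 1)) : ‖tgrad q k x j‖ ≤ 2 * C := by
  have hC := h.one_le
  simp only [tgrad]
  split_ifs
  · simp; linarith
  · have hb : ∀ z : ℂ, ‖z‖ = 1 → ‖((kap q x (EuclideanSpace.single j z)).re : ℂ)‖ ≤ C :=
      fun z hz => by
        rw [Complex.norm_real, Real.norm_eq_abs]
        refine (Complex.abs_re_le_norm _).trans (((kap q x).le_opNorm _).trans ?_)
        rw [norm_single, hz, mul_one]
        exact h.kap_le x hx.1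
    refine (norm_add_le _ _).trans ?_
    rw [norm_mul, Complex.norm_I, mul_one, two_mul]
    exact add_le_add (hb 1 (by simp)) (hb _ (by simp))

theorem norm_tgrad_le (h : IsControlled q k ρ C) (hx : x ∈ regular n k ρ) :
    ‖tgrad q k x‖ ≤ (n + 1) * (2 * C) :=
  norm_le_of_coord (h.norm_tgrad_coord_le hx)

theorem abs_corr_le (h : IsControlled q k ρ C) (hx : x ∈ regular n k ρ) :
    |corr q k x| ≤ 3 * (n + 1) * C ^ 2 := by
  have hC := h.one_le
  have h1 : |∑ j ∈ head n k, sgn j * gam q x j| ≤ (n + 1) * C := by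
    refine (Finset.abs_sum_le_sum_abs _ _).trans ?_
    refine (Finset.sum_le_sum fun j hj => (show |sgn j * gam q x j| ≤ C by
      rw [abs_mul, abs_sgn, one_mul]; exact h.abs_gam_le hx hj)).trans ?_
    rw [Finset.sum_const, nsmul_eq_mul]
    have : ((head n k).card : ℝ) ≤ n + 1 := by
      exact_mod_cast (Finset.card_le_univ _).trans (by simp)
    gcongr
  have h2 : |(kap q x (Complex.I • tgrad q k x)).im| ≤ C * ((n + 1) * (2 * C)) := by
    refine (Complex.abs_im_le_norm _).trans (((kap q x).le_opNorm _).trans ?_)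
    rw [norm_smul, Complex.norm_I, one_mul]
    exact mul_le_mul (h.kap_le x hx.1) (h.norm_tgrad_le hx) (norm_nonneg _) (by linarith)
  refine (abs_add_le _ _).trans ((add_le_add h1 h2).trans ?_)
  have hn : (0 : ℝ) ≤ n + 1 := by positivity
  nlinarith [mul_le_mul_of_nonneg_left hC (mul_nonneg hn (by linarith : (0 : ℝ) ≤ C))]

theorem two_mul_le_headSum (h : IsControlled q k ρ C) (hx : x ∈ regular n k ρ) :
    2 * (3 * (n + 1) * C ^ 2) ≤ headSum k x := by
  have hC := h.one_le
  have h0 := coord_pos hx h.zero_mem_head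
  refine le_trans ?_ (inv_sq_le h.zero_mem_head)
  rw [le_inv_comm₀ (by positivity) (by positivity)]
  have h2 : ‖x 0‖ ^ 2 ≤ ρ ^ 2 := by
    gcongr; exact (norm_coord_le x 0).trans (norm_lt hx).le
  refine h2.trans ?_
  rw [← one_div, le_div_iff₀ (by positivity), mul_comm]
  exact h.small

theorem half_headSum_le_denom (h : IsControlled q k ρ C) (hx : x ∈ regular n k ρ) :
    headSum k x / 2 ≤ denom q k x := by
  have := (abs_le.1 (h.abs_corr_le hx)).1
  have := h.two_mul_le_headSum hx
  rw [denom]; linarith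

theorem denom_pos (h : IsControlled q k ρ C) (hx : x ∈ regular n k ρ) : 0 < denom q k x :=
  (half_pos (h.headSum_pos hx)).trans_le (h.half_headSum_le_denom hx)

theorem norm_field_tail_le (h : IsControlled q k ρ C) (hx : x ∈ regular n k ρ) {j : Fin (n + 1)}
    (hj : ¬ (j : ℕ) < k) : ‖field q k x j‖ ≤ 4 * C * ‖x 0‖ ^ 2 := by
  have hC := h.one_le
  have h0 := coord_pos hx h.zero_mem_head
  have hS := h.headSum_pos hx
  rw [field_tail hj, norm_neg, norm_div, norm_mul, Complex.norm_I, one_mul, Complex.norm_real,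
    Real.norm_eq_abs, abs_of_pos (h.denom_pos hx)]
  have h1 : (headSum k x)⁻¹ ≤ ‖x 0‖ ^ 2 := by
    rw [inv_le_comm₀ hS (by positivity)]; exact inv_sq_le h.zero_mem_head
  calc _ ≤ 2 * C / (headSum k x / 2) :=
        div_le_div₀ (by linarith) (h.norm_tgrad_coord_le hx j) (half_pos hS)
          (h.half_headSum_le_denom hx)
    _ = 4 * C * (headSum k x)⁻¹ := by field_simp; ring
    _ ≤ _ := by gcongr

theorem speed_contDiffOn (h : IsControlled q k ρ C) {j : Fin (n + 1)} (hj : j ∈ head n k) :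
    ContDiffOn ℝ ∞ (fun x => speed q k x j) (regular n k ρ) ∧
      ContDiffOn ℝ ∞ (fun x => denom q k x) (regular n k ρ) ∧
      ContDiffOn ℝ ∞ (fun x => tgrad q k x) (regular n k ρ) := by
  have hκ : ContDiffOn ℝ ∞ (kap q) (regular n k ρ) :=
    (kap_contDiffOn h.smooth h.ne_zero).mono fun x hx => hx.1
  have hcoord : ∀ i : Fin (n + 1), ContDiff ℝ ∞ fun x : E n => x i := fun i =>
    ((EuclideanSpace.proj i : E n →L[ℂ] ℂ).restrictScalars ℝ).contDiff
  have hsingle : ∀ i : Fin (n + 1), ContDiff ℝ ∞ fun x : E n =>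
      (EuclideanSpace.single i (x i) : E n) := fun i => by
    refine (contDiff_piLp 2).2 fun l => ?_
    by_cases hl : l = i
    · subst hl; simpa using hcoord l
    · simpa [hl] using contDiff_const
  have hre : ContDiff ℝ ∞ Complex.re := Complex.reCLM.contDiff
  have him : ContDiff ℝ ∞ Complex.im := Complex.imCLM.contDiff
  have hof : ContDiff ℝ ∞ Complex.ofReal := Complex.ofRealCLM.contDiff
  have hnsq : ∀ i : Fin (n + 1), ContDiffOn ℝ ∞ (fun x : E n => ‖x i‖ ^ 2) (regular n k ρ) :=
    fun i => ((hcoord i).norm_sq ℝ).contDiffOn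
  have hne : ∀ i ∈ head n k, ∀ x ∈ regular n k ρ, ‖x i‖ ^ 2 ≠ 0 := fun i hi x hx =>
    (pow_pos (coord_pos hx hi) 2).ne'
  have hgam : ∀ i ∈ head n k, ContDiffOn ℝ ∞ (fun x => gam q x i) (regular n k ρ) := fun i hi =>
    (hre.comp_contDiffOn (hκ.clm_apply (hsingle i).contDiffOn)).div (hnsq i) (hne i hi)
  have htg : ContDiffOn ℝ ∞ (fun x => tgrad q k x) (regular n k ρ) := by
    refine (contDiffOn_piLp 2).2 fun i => ?_
    by_cases hi : (i : ℕ) < k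
    · simpa [tgrad, hi] using contDiffOn_const
    · simp only [tgrad, hi, if_false]
      exact (hof.comp_contDiffOn (hre.comp_contDiffOn (hκ.clm_apply contDiffOn_const))).add
        ((hof.comp_contDiffOn (hre.comp_contDiffOn (hκ.clm_apply contDiffOn_const))).mul
          contDiffOn_const)
  have hden : ContDiffOn ℝ ∞ (fun x => denom q k x) (regular n k ρ) := by
    refine ContDiffOn.add (ContDiffOn.sum fun i hi => (hnsq i).inv (hne i hi)) (ContDiffOn.add
      (ContDiffOn.sum fun i hi => contDiffOn_const.mul (hgam i hi)) ?_)
    exact him.comp_contDiffOn (hκ.clm_apply (htg.const_smul Complex.I))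
  refine ⟨?_, hden, htg⟩
  exact ((contDiffOn_const.mul ((hnsq j).inv (hne j hj))).add (hgam j hj)).neg.div hden
    fun x hx => (h.denom_pos hx).ne'

theorem field_contDiffOn (h : IsControlled q k ρ C) :
    ContDiffOn ℝ ∞ (field q k) (regular n k ρ) := by
  have hof : ContDiff ℝ ∞ Complex.ofReal := Complex.ofRealCLM.contDiff
  have hcoord : ∀ i : Fin (n + 1), ContDiff ℝ ∞ fun x : E n => x i := fun i =>
    ((EuclideanSpace.proj i : E n →L[ℂ] ℂ).restrictScalars ℝ).contDiff
  refine (contDiffOn_piLp 2).2 fun i => ?_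
  by_cases hi : (i : ℕ) < k
  · simp only [field, hi, if_true]
    exact (contDiffOn_const.mul (hof.comp_contDiffOn
      (h.speed_contDiffOn (mem_head.2 hi)).1)).mul (hcoord i).contDiffOn
  · simp only [field, hi, if_false, div_eq_mul_inv]
    obtain ⟨-, hd, ht⟩ := h.speed_contDiffOn h.zero_mem_head
    have hd' : ContDiffOn ℝ ∞ (fun x => (denom q k x : ℂ)) (regular n k ρ) := hof.comp_contDiffOn hd
    exact ((contDiffOn_const.mul ((hcoord i).comp_contDiffOn ht)).mul (hd'.inv
      fun x hx => by exact_mod_cast (h.denom_pos hx).ne')).neg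

end IsControlled

/-! ### The linearization of the horizontal field -/

/-- The elementary estimate behind `IsControlled.norm_fderiv_field_sub_le` for coordinates in the
head: `r` stands for `|x_j|`, `σ²` for `headSum`, `a + γ` and `σ² + B` for the numerator and the
denominator of the speed, and primes for derivatives in a direction of length `ν`. -/
theorem speed_deriv_error {σ r sg a' γ γ' B B' S' b ν : ℝ} (hσ : 1 ≤ σ) (hr : 0 < r) (hr1 : r ≤ 1)
    (hrσ : r⁻¹ ≤ σ) (hsg : |sg| = 1) (hb : 1 ≤ b) (hν : 0 ≤ ν) (ha' : |a'| ≤ 2 * r⁻¹ ^ 3 * ν)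
    (hγ : |γ| ≤ b) (hγ' : |γ'| ≤ b * r⁻¹ * ν) (hB : |B| ≤ b) (hB' : |B'| ≤ b * σ * ν)
    (hS' : |S'| ≤ b * σ ^ 3 * ν) (hBS : |B| ≤ σ ^ 2 / 2) :
    r * |((a' + γ') * (σ ^ 2 + B) - (sg * (r ^ 2)⁻¹ + γ) * (S' + B')) / (σ ^ 2 + B) ^ 2
      - (a' * σ ^ 2 - sg * (r ^ 2)⁻¹ * S') / (σ ^ 2) ^ 2| ≤ 28 * b ^ 2 * σ⁻¹ * ν := by
  have hσ0 : 0 < σ := by linarith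
  have hD : σ ^ 2 / 2 ≤ σ ^ 2 + B := by linarith [(abs_le.1 hBS).1]
  have hD0 : 0 < σ ^ 2 + B := (by positivity : 0 < σ ^ 2 / 2).trans_le hD
  obtain ⟨p, hp⟩ : ∃ p, p = (σ ^ 2 + B)⁻¹ := ⟨_, rfl⟩
  obtain ⟨i, hi⟩ : ∃ i, i = σ⁻¹ := ⟨_, rfl⟩
  have hi0 : 0 < i := hi ▸ inv_pos.2 hσ0
  have hi1 : i ≤ 1 := hi ▸ inv_le_one_of_one_le₀ hσ
  have hσi : σ * i = 1 := by rw [hi]; field_simp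
  have hp0 : 0 < p := hp ▸ inv_pos.2 hD0
  have hp2 : p ≤ 2 * i ^ 2 := by
    rw [hp, hi, inv_le_comm₀ hD0 (by positivity)]
    refine le_trans (le_of_eq ?_) hD
    field_simp
  have hrr : r * r⁻¹ = 1 := mul_inv_cancel₀ hr.ne'
  have hri : 0 < r⁻¹ := inv_pos.2 hr
  have e : ((a' + γ') * (σ ^ 2 + B) - (sg * (r ^ 2)⁻¹ + γ) * (S' + B')) / (σ ^ 2 + B) ^ 2
      - (a' * σ ^ 2 - sg * (r ^ 2)⁻¹ * S') / (σ ^ 2) ^ 2 =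
      γ' * p - a' * B * p * i ^ 2 - γ * (S' + B') * p ^ 2 - sg * (r⁻¹ ^ 2) * B' * p ^ 2
        + sg * (r⁻¹ ^ 2) * S' * B * (2 * σ ^ 2 + B) * p ^ 2 * i ^ 4 := by
    rw [hp, hi]
    field_simp
    ring
  have t1 : r * |γ' * p| ≤ 2 * b ^ 2 * i * ν := by
    rw [abs_mul, abs_of_pos hp0]
    calc r * (|γ'| * p) ≤ r * ((b * r⁻¹ * ν) * (2 * i ^ 2)) := by gcongr
      _ = 2 * (b * 1) * (i * i) * ν * (r * r⁻¹) := by ring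
      _ ≤ 2 * (b * b) * (i * 1) * ν * (r * r⁻¹) := by gcongr
      _ = _ := by rw [hrr]; ring
  have t2 : r * |a' * B * p * i ^ 2| ≤ 4 * b ^ 2 * i * ν := by
    rw [abs_mul, abs_mul, abs_mul, abs_of_pos hp0, abs_of_pos (pow_pos hi0 2)]
    calc r * (|a'| * |B| * p * i ^ 2)
        ≤ r * ((2 * r⁻¹ ^ 3 * ν) * b * (2 * i ^ 2) * i ^ 2) := by gcongr
      _ = 4 * (r⁻¹ ^ 2) * (b * 1) * (i * i ^ 3) * ν * (r * r⁻¹) := by ring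
      _ ≤ 4 * σ ^ 2 * (b * b) * (i * i ^ 3) * ν * (r * r⁻¹) := by gcongr
      _ = 4 * b ^ 2 * (i * i) * ν * (σ * i) ^ 2 := by rw [hrr]; ring
      _ ≤ 4 * b ^ 2 * (i * 1) * ν * (σ * i) ^ 2 := by gcongr
      _ = _ := by rw [hσi]; ring
  have hSB : |S' + B'| ≤ 2 * b * σ ^ 3 * ν := by
    refine (abs_add_le _ _).trans ((add_le_add hS' hB').trans ?_)
    have h1 : σ ≤ σ ^ 3 := le_self_pow₀ hσ (by norm_num)
    calc b * σ ^ 3 * ν + b * σ * ν ≤ b * σ ^ 3 * ν + b * σ ^ 3 * ν := by gcongr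
      _ = _ := by ring
  have t3 : r * |γ * (S' + B') * p ^ 2| ≤ 8 * b ^ 2 * i * ν := by
    rw [abs_mul, abs_mul, abs_of_pos (pow_pos hp0 2)]
    calc r * (|γ| * |S' + B'| * p ^ 2)
        ≤ 1 * (b * (2 * b * σ ^ 3 * ν) * (2 * i ^ 2) ^ 2) := by gcongr
      _ = 8 * b ^ 2 * i * ν * (σ * i) ^ 3 := by ring
      _ = _ := by rw [hσi]; ring
  have t4 : r * |sg * (r⁻¹ ^ 2) * B' * p ^ 2| ≤ 4 * b ^ 2 * i * ν := by
    rw [abs_mul, abs_mul, abs_mul, abs_of_pos (pow_pos hp0 2), abs_of_pos (pow_pos hri 2), hsg]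
    calc r * (1 * r⁻¹ ^ 2 * |B'| * p ^ 2) ≤ r * (1 * r⁻¹ ^ 2 * (b * σ * ν) * (2 * i ^ 2) ^ 2) := by
          gcongr
      _ = 4 * r⁻¹ * (b * 1) * σ * i ^ 3 * i * ν * (r * r⁻¹) := by ring
      _ ≤ 4 * σ * (b * b) * σ * i ^ 3 * i * ν * (r * r⁻¹) := by gcongr
      _ = 4 * b ^ 2 * (i * i) * ν * (σ * i) ^ 2 := by rw [hrr]; ring
      _ ≤ 4 * b ^ 2 * (i * 1) * ν * (σ * i) ^ 2 := by gcongr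
      _ = _ := by rw [hσi]; ring
  have h2S : |2 * σ ^ 2 + B| ≤ 5 / 2 * σ ^ 2 := by
    have := sq_nonneg σ
    rw [abs_le] at hBS ⊢
    constructor <;> linarith [hBS.1, hBS.2]
  have t5 : r * |sg * (r⁻¹ ^ 2) * S' * B * (2 * σ ^ 2 + B) * p ^ 2 * i ^ 4| ≤
      10 * b ^ 2 * i * ν := by
    rw [abs_mul, abs_mul, abs_mul, abs_mul, abs_mul, abs_mul, abs_of_pos (pow_pos hp0 2),
      abs_of_pos (pow_pos hri 2), abs_of_pos (pow_pos hi0 4), hsg]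
    calc r * (1 * r⁻¹ ^ 2 * |S'| * |B| * |2 * σ ^ 2 + B| * p ^ 2 * i ^ 4)
        ≤ r * (1 * r⁻¹ ^ 2 * (b * σ ^ 3 * ν) * b * (5 / 2 * σ ^ 2) * (2 * i ^ 2) ^ 2 * i ^ 4) := by
          gcongr
      _ = 10 * b ^ 2 * σ ^ 5 * i ^ 7 * i * r⁻¹ * ν * (r * r⁻¹) := by ring
      _ ≤ 10 * b ^ 2 * σ ^ 5 * i ^ 7 * i * σ * ν * (r * r⁻¹) := by gcongr
      _ = 10 * b ^ 2 * (i * i) * ν * (σ * i) ^ 6 := by rw [hrr]; ring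
      _ ≤ 10 * b ^ 2 * (i * 1) * ν * (σ * i) ^ 6 := by gcongr
      _ = _ := by rw [hσi]; ring
  rw [e, ← hi]
  have habs : ∀ y₁ y₂ y₃ y₄ y₅ : ℝ,
      |y₁ - y₂ - y₃ - y₄ + y₅| ≤ |y₁| + |y₂| + |y₃| + |y₄| + |y₅| := by
    intro y₁ y₂ y₃ y₄ y₅
    refine (abs_add_le _ _).trans (add_le_add ?_ le_rfl)
    refine (abs_sub _ _).trans (add_le_add ?_ le_rfl)
    refine (abs_sub _ _).trans (add_le_add (abs_sub _ _) le_rfl)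
  refine (mul_le_mul_of_nonneg_left (habs _ _ _ _ _) hr.le).trans ?_
  calc _ = r * |γ' * p| + r * |a' * B * p * i ^ 2| + r * |γ * (S' + B') * p ^ 2|
        + r * |sg * (r⁻¹ ^ 2) * B' * p ^ 2|
        + r * |sg * (r⁻¹ ^ 2) * S' * B * (2 * σ ^ 2 + B) * p ^ 2 * i ^ 4| := by
        rw [mul_add, mul_add, mul_add, mul_add]
    _ ≤ _ := by linarith

/-- The analogue of `speed_deriv_error` for the remaining coordinates. -/
theorem tail_deriv_error {σ B B' S' b ν : ℝ} {g g' : ℂ} (hσ : 1 ≤ σ) (hb : 1 ≤ b) (hν : 0 ≤ ν)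
    (hg : ‖g‖ ≤ b) (hg' : ‖g'‖ ≤ b * ν) (hB' : |B'| ≤ b * σ * ν)
    (hS' : |S'| ≤ b * σ ^ 3 * ν) (hBS : |B| ≤ σ ^ 2 / 2) :
    ‖-((Complex.I * g' * ((σ ^ 2 + B : ℝ) : ℂ) - Complex.I * g * ((S' + B' : ℝ) : ℂ)) /
      ((σ ^ 2 + B : ℝ) : ℂ) ^ 2)‖ ≤ 28 * b ^ 2 * σ⁻¹ * ν := by
  have hσ0 : 0 < σ := by linarith
  have hD : σ ^ 2 / 2 ≤ σ ^ 2 + B := by linarith [(abs_le.1 hBS).1]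
  have hD0 : 0 < σ ^ 2 + B := (by positivity : 0 < σ ^ 2 / 2).trans_le hD
  obtain ⟨D, hDD⟩ : ∃ D, D = σ ^ 2 + B := ⟨_, rfl⟩
  obtain ⟨p, hp⟩ : ∃ p, p = D⁻¹ := ⟨_, rfl⟩
  obtain ⟨i, hi⟩ : ∃ i, i = σ⁻¹ := ⟨_, rfl⟩
  rw [← hDD] at hD hD0 ⊢
  have hi0 : 0 < i := hi ▸ inv_pos.2 hσ0
  have hi1 : i ≤ 1 := hi ▸ inv_le_one_of_one_le₀ hσ
  have hσi : σ * i = 1 := by rw [hi]; field_simp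
  have hp0 : 0 < p := hp ▸ inv_pos.2 hD0
  have hp2 : p ≤ 2 * i ^ 2 := by
    rw [hp, hi, inv_le_comm₀ hD0 (by positivity)]
    refine le_trans (le_of_eq ?_) hD
    field_simp
  have hSB : |S' + B'| ≤ 2 * b * σ ^ 3 * ν := by
    refine (abs_add_le _ _).trans ((add_le_add hS' hB').trans ?_)
    have h1 : σ ≤ σ ^ 3 := le_self_pow₀ hσ (by norm_num)
    calc b * σ ^ 3 * ν + b * σ * ν ≤ b * σ ^ 3 * ν + b * σ ^ 3 * ν := by gcongr
      _ = _ := by ring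
  have hDc : (D : ℂ) ≠ 0 := by exact_mod_cast hD0.ne'
  have e : -((Complex.I * g' * (D : ℂ) - Complex.I * g * ((S' + B' : ℝ) : ℂ)) / (D : ℂ) ^ 2) =
      Complex.I * (g * ((S' + B' : ℝ) : ℂ) * (p : ℂ) ^ 2 - g' * (p : ℂ)) := by
    rw [hp, Complex.ofReal_inv]
    field_simp
    ring
  rw [e, norm_mul, Complex.norm_I, one_mul, ← hi]
  refine (norm_sub_le _ _).trans ?_
  rw [norm_mul, norm_mul, norm_mul, norm_pow, Complex.norm_real, Complex.norm_real,
    Real.norm_eq_abs, Real.norm_eq_abs, abs_of_pos hp0]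
  have t1 : ‖g‖ * |S' + B'| * p ^ 2 ≤ 8 * b ^ 2 * i * ν := by
    calc ‖g‖ * |S' + B'| * p ^ 2 ≤ b * (2 * b * σ ^ 3 * ν) * (2 * i ^ 2) ^ 2 := by gcongr
      _ = 8 * b ^ 2 * i * ν * (σ * i) ^ 3 := by ring
      _ = _ := by rw [hσi]; ring
  have t2 : ‖g'‖ * p ≤ 2 * b ^ 2 * i * ν := by
    calc ‖g'‖ * p ≤ (b * ν) * (2 * i ^ 2) := by gcongr
      _ = 2 * (b * 1) * (i * i) * ν := by ring
      _ ≤ 2 * (b * b) * (i * 1) * ν := by gcongr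
      _ = _ := by ring
  have : 0 ≤ b ^ 2 * i * ν := by positivity
  linarith

/-- The unit complex numbers in the directions of the coordinates. If `x j = 0`, the value is `0`;
this can happen for coordinates outside of the head only, which do not enter in the shears below. -/
noncomputable def unitCoord (x : E n) (j : Fin (n + 1)) : ℂ := x j / (‖x j‖ : ℂ)

/-- The coefficients of the dominant part of the linearization of the horizontal field, which is the
same as for `q = 1`. -/
noncomputable def mainCoeff (k : ℕ) (x : E n) (j l : Fin (n + 1)) : ℝ :=
  if (j : ℕ) < k ∧ (l : ℕ) < k then
    (if j = l then 2 * sgn j * ((‖x j‖ ^ 2)⁻¹ * (headSum k x)⁻¹) else 0)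
      - 2 * sgn j * (‖x j‖⁻¹ * ‖x l‖⁻¹ ^ 3 * (headSum k x)⁻¹ ^ 2)
  else 0

/-- A symmetric matrix which acts in the same way as `mainCoeff` on the kernel of
`d log |y_2 ⋯ y_k / y_1|`. -/
noncomputable def symCoeff (k : ℕ) (x : E n) (j l : Fin (n + 1)) : ℝ :=
  mainCoeff k x j l - if (j : ℕ) < k ∧ (l : ℕ) < k then
    2 * sgn l * (‖x l‖⁻¹ * ‖x j‖⁻¹ ^ 3 * (headSum k x)⁻¹ ^ 2) else 0

theorem symCoeff_comm (k : ℕ) (x : E n) (j l : Fin (n + 1)) :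
    symCoeff k x j l = symCoeff k x l j := by
  unfold symCoeff mainCoeff
  by_cases hjl : j = l
  · subst hjl; rfl
  · have hlj : ¬ l = j := fun h => hjl h.symm
    by_cases hj : (j : ℕ) < k <;> by_cases hl : (l : ℕ) < k <;> simp [hj, hl, hjl, hlj]
    ring

/-- The infinitesimal rotation of the head coordinates along the horizontal field. -/
noncomputable def rotation (q : E n → ℂ) (k : ℕ) (x v : E n) : E n :=
  WithLp.toLp 2 fun j => if (j : ℕ) < k then Complex.I * (speed q k x j : ℂ) * v j else 0

section Line

variable (x v : E n)

theorem hasDerivAt_line : HasDerivAt (fun τ : ℝ => x + τ • v) v 0 := by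
  simpa using ((hasDerivAt_id (0 : ℝ)).smul_const v).const_add x

theorem hasDerivAt_line_coord (j : Fin (n + 1)) :
    HasDerivAt (fun τ : ℝ => (x + τ • v) j) (v j) 0 := by
  simpa using ((hasDerivAt_id (0 : ℝ)).smul_const (v j)).const_add (x j)

theorem hasDerivAt_line_normSq (j : Fin (n + 1)) :
    HasDerivAt (fun τ : ℝ => ‖(x + τ • v) j‖ ^ 2) (2 * ((starRingEnd ℂ) (x j) * v j).re) 0 := by
  have := (hasDerivAt_line_coord x v j).norm_sq
  simpa [Complex.inner, mul_comm] using this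

theorem hasDerivAt_line_inv_normSq {j : Fin (n + 1)} (hj : 0 < ‖x j‖) :
    HasDerivAt (fun τ : ℝ => (‖(x + τ • v) j‖ ^ 2)⁻¹)
      (-(2 * ((starRingEnd ℂ) (x j) * v j).re) * (‖x j‖⁻¹ ^ 4)) 0 := by
  refine ((hasDerivAt_line_normSq x v j).inv (by simpa using (pow_pos hj 2).ne')).congr_deriv ?_
  rw [zero_smul, add_zero]
  field_simp

theorem hasDerivAt_line_comp {F : Type*} [NormedAddCommGroup F] [NormedSpace ℝ F] {f : E n → F}
    (hf : DifferentiableAt ℝ f x) : HasDerivAt (fun τ : ℝ => f (x + τ • v)) (fderiv ℝ f x v) 0 := by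
  have h1 : HasFDerivAt f (fderiv ℝ f x) (x + (0 : ℝ) • v) := by simpa using hf.hasFDerivAt
  exact h1.comp_hasDerivAt 0 (hasDerivAt_line x v)

theorem abs_re_conj_mul_le (j : Fin (n + 1)) :
    |((starRingEnd ℂ) (x j) * v j).re| ≤ ‖x j‖ * ‖v‖ := by
  refine (Complex.abs_re_le_norm _).trans ?_
  rw [norm_mul, RCLike.norm_conj]
  gcongr
  exact norm_coord_le v j

end Line

namespace IsControlled

variable {q : E n → ℂ} {k : ℕ} {ρ C : ℝ} {x : E n}

theorem differentiableAt_kap (h : IsControlled q k ρ C) (hx : x ∈ regular n k ρ) :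
    DifferentiableAt ℝ (kap q) x :=
  ((kap_contDiffOn h.smooth h.ne_zero).differentiableOn (by simp)).differentiableAt
    (Metric.isOpen_ball.mem_nhds hx.1)

theorem norm_coord_le_one (h : IsControlled q k ρ C) (hx : x ∈ regular n k ρ) (j : Fin (n + 1)) :
    ‖x j‖ ≤ 1 := (norm_coord_le x j).trans ((norm_lt hx).le.trans h.radius_le)

theorem card_head_le (k : ℕ) : ((head n k).card : ℝ) ≤ n + 1 := by
  exact_mod_cast (Finset.card_le_univ _).trans (by simp)

theorem norm_kap_le (h : IsControlled q k ρ C) (hx : x ∈ regular n k ρ) (v : E n) :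
    ‖kap q x v‖ ≤ C * ‖v‖ :=
  ((kap q x).le_opNorm v).trans (by gcongr; exact h.kap_le x hx.1)

theorem norm_fderiv_kap_le (h : IsControlled q k ρ C) (hx : x ∈ regular n k ρ) (v w : E n) :
    ‖fderiv ℝ (kap q) x v w‖ ≤ C * ‖v‖ * ‖w‖ :=
  ((fderiv ℝ (kap q) x v).le_opNorm w).trans (by
    gcongr
    exact ((fderiv ℝ (kap q) x).le_opNorm v).trans (by gcongr; exact h.fderiv_kap_le x hx.1))

theorem exists_deriv_gam (h : IsControlled q k ρ C) (hx : x ∈ regular n k ρ) {j : Fin (n + 1)}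
    (hj : j ∈ head n k) (v : E n) : ∃ g' : ℝ,
      HasDerivAt (fun τ : ℝ => gam q (x + τ • v) j) g' 0 ∧ |g'| ≤ 4 * C * ‖x j‖⁻¹ * ‖v‖ := by
  have hC := h.one_le
  have hr := coord_pos hx hj
  have hκ := hasDerivAt_line_comp x v (h.differentiableAt_kap hx)
  have hs : HasDerivAt (fun τ : ℝ => (EuclideanSpace.single j ((x + τ • v) j) : E n))
      (EuclideanSpace.single j (v j)) 0 := by
    have e : (fun τ : ℝ => (EuclideanSpace.single j ((x + τ • v) j) : E n)) =
        fun τ : ℝ => EuclideanSpace.single j (x j) + τ • (EuclideanSpace.single j (v j) : E n) := by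
      funext τ
      rw [PiLp.add_apply, single_add, PiLp.smul_apply, Complex.real_smul, single_real_mul]
    rw [e]
    exact hasDerivAt_line _ _
  have hnum := Complex.reCLM.hasFDerivAt.comp_hasDerivAt (0 : ℝ) (hκ.clm_apply hs)
  have hden := hasDerivAt_line_normSq x v j
  have hmain := hnum.div hden (by simpa using (pow_pos hr 2).ne')
  refine ⟨_, hmain, ?_⟩
  simp only [Function.comp_apply, zero_smul, add_zero, Complex.reCLM_apply]
  set m := ((starRingEnd ℂ) (x j) * v j).re with hm
  have hm_le : |m| ≤ ‖x j‖ * ‖v‖ := abs_re_conj_mul_le x v j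
  have h1 : |((fderiv ℝ (kap q) x v) (EuclideanSpace.single j (x j)) +
      (kap q x) (EuclideanSpace.single j (v j))).re| ≤ 2 * C * ‖x j‖ * ‖v‖ := by
    refine (Complex.abs_re_le_norm _).trans ((norm_add_le _ _).trans ?_)
    have h2 := h.norm_fderiv_kap_le hx v (EuclideanSpace.single j (x j))
    have h3 := h.kap_head x hx j hj (v j)
    have h4 : C * ‖x j‖ * ‖v j‖ ≤ C * ‖x j‖ * ‖v‖ := by gcongr; exact norm_coord_le v j
    rw [norm_single] at h2
    linarith
  have h2 : |((kap q x) (EuclideanSpace.single j (x j))).re| ≤ C * ‖x j‖ ^ 2 := by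
    refine (Complex.abs_re_le_norm _).trans ((h.kap_head x hx j hj _).trans (le_of_eq ?_))
    ring
  rw [abs_div, abs_of_pos (by positivity : 0 < (‖x j‖ ^ 2) ^ 2), div_le_iff₀ (by positivity)]
  refine (abs_sub _ _).trans ?_
  rw [abs_mul, abs_mul, abs_mul, abs_two, abs_of_pos (pow_pos hr 2)]
  calc _ ≤ 2 * C * ‖x j‖ * ‖v‖ * ‖x j‖ ^ 2 + C * ‖x j‖ ^ 2 * (2 * (‖x j‖ * ‖v‖)) := by gcongr
    _ = _ := by field_simp; ring

theorem hasDerivAt_headSum (hx : x ∈ regular n k ρ) (v : E n) :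
    HasDerivAt (fun τ : ℝ => headSum k (x + τ • v))
      (∑ j ∈ head n k, -(2 * ((starRingEnd ℂ) (x j) * v j).re) * (‖x j‖⁻¹ ^ 4)) 0 := by
  unfold headSum
  refine HasDerivAt.fun_sum fun j hj => ?_
  exact hasDerivAt_line_inv_normSq x v (coord_pos hx hj)

theorem abs_deriv_headSum_le (hx : x ∈ regular n k ρ) (v : E n) :
    |∑ j ∈ head n k, -(2 * ((starRingEnd ℂ) (x j) * v j).re) * (‖x j‖⁻¹ ^ 4)| ≤
      2 * (n + 1) * √(headSum k x) ^ 3 * ‖v‖ := by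
  refine (Finset.abs_sum_le_sum_abs _ _).trans ?_
  have hb : ∀ j ∈ head n k, |-(2 * ((starRingEnd ℂ) (x j) * v j).re) * (‖x j‖⁻¹ ^ 4)| ≤
      2 * √(headSum k x) ^ 3 * ‖v‖ := fun j hj => by
    have hr := coord_pos hx hj
    rw [abs_mul, abs_neg, abs_mul, abs_two, abs_of_pos (pow_pos (inv_pos.2 hr) 4)]
    calc _ ≤ 2 * (‖x j‖ * ‖v‖) * ‖x j‖⁻¹ ^ 4 := by gcongr; exact abs_re_conj_mul_le x v j
      _ = 2 * ‖x j‖⁻¹ ^ 3 * ‖v‖ := by field_simp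
      _ ≤ _ := by gcongr; exact inv_le_sqrt hj
  refine (Finset.sum_le_sum hb).trans ?_
  rw [Finset.sum_const, nsmul_eq_mul]
  calc _ ≤ ((n : ℝ) + 1) * (2 * √(headSum k x) ^ 3 * ‖v‖) := by gcongr; exact card_head_le k
    _ = _ := by ring

theorem exists_deriv_tgrad (h : IsControlled q k ρ C) (hx : x ∈ regular n k ρ) (v : E n) :
    ∃ G' : E n, HasDerivAt (fun τ : ℝ => tgrad q k (x + τ • v)) G' 0 ∧
      ∀ j, ‖G' j‖ ≤ 2 * C * ‖v‖ := by
  have hC := h.one_le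
  have hdiff : DifferentiableAt ℝ (fun x => tgrad q k x) x :=
    ((h.speed_contDiffOn h.zero_mem_head).2.2.differentiableOn (by simp)).differentiableAt
      ((isOpen_regular k ρ).mem_nhds hx)
  have hder := hasDerivAt_line_comp x v hdiff
  refine ⟨_, hder, fun j => ?_⟩
  have hproj : HasDerivAt (fun τ : ℝ => tgrad q k (x + τ • v) j)
      ((fderiv ℝ (fun x => tgrad q k x) x v) j) 0 :=
    (((EuclideanSpace.proj j : E n →L[ℂ] ℂ).restrictScalars ℝ).hasFDerivAt).comp_hasDerivAt
      (0 : ℝ) hder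
  by_cases hj : (j : ℕ) < k
  · have e : (fun τ : ℝ => tgrad q k (x + τ • v) j) = fun _ => 0 := by
      funext τ; simp [tgrad, hj]
    rw [e] at hproj
    rw [hproj.unique (hasDerivAt_const _ _)]
    simp; positivity
  · have e : (fun τ : ℝ => tgrad q k (x + τ • v) j) = fun τ =>
        (((kap q (x + τ • v) (EuclideanSpace.single j 1)).re : ℂ) +
        ((kap q (x + τ • v) (EuclideanSpace.single j Complex.I)).re : ℂ) * Complex.I) := by
      funext τ; simp [tgrad, hj]
    have hκ := hasDerivAt_line_comp x v (h.differentiableAt_kap hx)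
    have hre : ∀ w : E n, HasDerivAt (fun τ : ℝ => (((kap q (x + τ • v) w).re : ℝ) : ℂ))
        (((fderiv ℝ (kap q) x v w).re : ℝ) : ℂ) 0 := fun w => by
      have h1 := hκ.clm_apply (hasDerivAt_const (0 : ℝ) w)
      simp only [zero_smul, map_zero, add_zero] at h1
      exact (Complex.reCLM.hasFDerivAt.comp_hasDerivAt (0 : ℝ) h1).ofReal_comp
    rw [e] at hproj
    rw [hproj.unique ((hre _).add ((hre _).mul_const Complex.I))]
    have hb : ∀ z : ℂ, ‖z‖ = 1 →
        ‖(((fderiv ℝ (kap q) x v (EuclideanSpace.single j z)).re : ℝ) : ℂ)‖ ≤ C * ‖v‖ :=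
      fun z hz => by
        rw [Complex.norm_real, Real.norm_eq_abs]
        refine (Complex.abs_re_le_norm _).trans ((h.norm_fderiv_kap_le hx v _).trans ?_)
        rw [norm_single, hz, mul_one]
    refine (norm_add_le _ _).trans ?_
    rw [norm_mul, Complex.norm_I, mul_one, two_mul, add_mul]
    exact add_le_add (hb 1 (by simp)) (hb _ (by simp))

theorem exists_deriv_corr (h : IsControlled q k ρ C) (hx : x ∈ regular n k ρ) (v : E n) :
    ∃ B' : ℝ, HasDerivAt (fun τ : ℝ => corr q k (x + τ • v)) B' 0 ∧
      |B'| ≤ 8 * (n + 1) * C ^ 2 * √(headSum k x) * ‖v‖ := by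
  have hC := h.one_le
  have hσ := h.one_le_sqrt hx
  have hg : ∀ j : Fin (n + 1), ∃ g' : ℝ, j ∈ head n k →
      HasDerivAt (fun τ : ℝ => gam q (x + τ • v) j) g' 0 ∧ |g'| ≤ 4 * C * ‖x j‖⁻¹ * ‖v‖ :=
    fun j => by
      by_cases hj : j ∈ head n k
      · obtain ⟨g', hg'⟩ := h.exists_deriv_gam hx hj v
        exact ⟨g', fun _ => hg'⟩
      · exact ⟨0, fun hj' => absurd hj' hj⟩
  choose g' hg' using hg
  obtain ⟨G', hG', hGb⟩ := h.exists_deriv_tgrad hx v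
  have hκ := hasDerivAt_line_comp x v (h.differentiableAt_kap hx)
  have h2 := Complex.imCLM.hasFDerivAt.comp_hasDerivAt (0 : ℝ)
    (hκ.clm_apply (hG'.fun_const_smul Complex.I))
  have h1 : HasDerivAt (fun τ : ℝ => ∑ j ∈ head n k, sgn j * gam q (x + τ • v) j)
      (∑ j ∈ head n k, sgn j * g' j) 0 :=
    HasDerivAt.fun_sum fun j hj => (hg' j hj).1.const_mul _
  refine ⟨_, h1.add h2, ?_⟩
  simp only [zero_smul, add_zero, Complex.imCLM_apply]
  have b1 : |∑ j ∈ head n k, sgn j * g' j| ≤ (n + 1) * (4 * C * √(headSum k x) * ‖v‖) := by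
    refine (Finset.abs_sum_le_sum_abs _ _).trans ((Finset.sum_le_sum fun j hj =>
      (show |sgn j * g' j| ≤ 4 * C * √(headSum k x) * ‖v‖ by
        rw [abs_mul, abs_sgn, one_mul]
        refine (hg' j hj).2.trans ?_
        gcongr
        exact inv_le_sqrt hj)).trans ?_)
    rw [Finset.sum_const, nsmul_eq_mul]
    gcongr
    exact card_head_le k
  have b2 : ‖(fderiv ℝ (kap q) x v) (Complex.I • tgrad q k x)‖ ≤
      C * ‖v‖ * ((n + 1) * (2 * C)) := by
    refine (h.norm_fderiv_kap_le hx v _).trans ?_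
    rw [norm_smul, Complex.norm_I, one_mul]
    gcongr
    exact h.norm_tgrad_le hx
  have b3 : ‖kap q x (Complex.I • G')‖ ≤ C * ((n + 1) * (2 * C * ‖v‖)) := by
    refine (h.norm_kap_le hx _).trans ?_
    rw [norm_smul, Complex.norm_I, one_mul]
    gcongr
    exact norm_le_of_coord hGb
  refine (abs_add_le _ _).trans ((add_le_add b1 ((Complex.abs_im_le_norm _).trans
    ((norm_add_le _ _).trans (add_le_add b2 b3)))).trans ?_)
  have h5 : (n + 1) * (4 * C * √(headSum k x) * ‖v‖) ≤
      4 * (n + 1) * (C * C) * √(headSum k x) * ‖v‖ := by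
    calc _ = 4 * (n + 1) * (C * 1) * √(headSum k x) * ‖v‖ := by ring
      _ ≤ _ := by gcongr
  have h6 : C * ‖v‖ * ((n + 1) * (2 * C)) + C * ((n + 1) * (2 * C * ‖v‖)) ≤
      4 * (n + 1) * (C * C) * √(headSum k x) * ‖v‖ := by
    calc _ = 4 * (n + 1) * (C * C) * 1 * ‖v‖ := by ring
      _ ≤ _ := by gcongr
  refine (add_le_add h5 h6).trans (le_of_eq (by ring))

/-- The linearization of the horizontal field is the sum of an infinitesimal rotation, a shear whose
coefficients only depend on the absolute values of the head coordinates, and an error which is small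
near the origin. -/
theorem norm_fderiv_field_sub_le (h : IsControlled q k ρ C) (hx : x ∈ regular n k ρ) (v : E n) :
    ‖fderiv ℝ (field q k) x v - rotation q k x v - shear (unitCoord x) (mainCoeff k x) v‖ ≤
      (n + 1) * (28 * (8 * (n + 1) * C ^ 2) ^ 2) * ‖x‖ * ‖v‖ := by
  have hC := h.one_le
  have hn : (1 : ℝ) ≤ n + 1 := by linarith [(Nat.cast_nonneg n : (0 : ℝ) ≤ n)]
  set σ := √(headSum k x) with hσdef
  have hσ1 : 1 ≤ σ := h.one_le_sqrt hx
  have hS : headSum k x = σ ^ 2 := (Real.sq_sqrt (h.headSum_pos hx).le).symm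
  set b : ℝ := 8 * (n + 1) * C ^ 2 with hbdef
  have hC2 : C ≤ C ^ 2 := le_self_pow₀ hC (by norm_num)
  have hb4 : 4 * C ≤ b := by
    rw [hbdef]
    calc 4 * C ≤ 8 * 1 * C ^ 2 := by linarith
      _ ≤ _ := by gcongr
  have hb1 : 1 ≤ b := by linarith
  have hcorr : |corr q k x| ≤ b := (h.abs_corr_le hx).trans (by rw [hbdef]; gcongr; norm_num)
  have hcorrS : |corr q k x| ≤ σ ^ 2 / 2 := by
    rw [← hS]
    have := h.abs_corr_le hx
    have := h.two_mul_le_headSum hx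
    linarith
  obtain ⟨B', hB', hB'b⟩ := h.exists_deriv_corr hx v
  obtain ⟨G', hG', hG'b⟩ := h.exists_deriv_tgrad hx v
  have hS' := hasDerivAt_headSum hx v
  have hS'b := abs_deriv_headSum_le hx v
  set S' : ℝ := ∑ j ∈ head n k, -(2 * ((starRingEnd ℂ) (x j) * v j).re) * (‖x j‖⁻¹ ^ 4) with hS'def
  have hS'b2 : |S'| ≤ b * σ ^ 3 * ‖v‖ := hS'b.trans (by
    gcongr
    rw [hbdef]
    have : (1 : ℝ) ≤ C ^ 2 := one_le_pow₀ hC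
    calc (2 : ℝ) * (n + 1) = 2 * (n + 1) * 1 := by ring
      _ ≤ 8 * (n + 1) * C ^ 2 := by gcongr; norm_num)
  have hden : HasDerivAt (fun τ : ℝ => denom q k (x + τ • v)) (S' + B') 0 := hS'.add hB'
  have hden0 : denom q k x ≠ 0 := (h.denom_pos hx).ne'
  have hdenS : denom q k x = σ ^ 2 + corr q k x := by rw [denom, hS]
  have hfdiff : DifferentiableAt ℝ (field q k) x :=
    (h.field_contDiffOn.differentiableOn (by simp)).differentiableAt
      ((isOpen_regular k ρ).mem_nhds hx)
  have hfder := hasDerivAt_line_comp x v hfdiff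
  have hproj : ∀ j, HasDerivAt (fun τ : ℝ => field q k (x + τ • v) j)
      ((fderiv ℝ (field q k) x v) j) 0 := fun j =>
    (((EuclideanSpace.proj j : E n →L[ℂ] ℂ).restrictScalars ℝ).hasFDerivAt).comp_hasDerivAt
      (0 : ℝ) hfder
  have hcoord : ∀ j, ‖(fderiv ℝ (field q k) x v - rotation q k x v
      - shear (unitCoord x) (mainCoeff k x) v) j‖ ≤ 28 * b ^ 2 * σ⁻¹ * ‖v‖ := by
    intro j
    rw [PiLp.sub_apply, PiLp.sub_apply, shear_apply]
    by_cases hj : (j : ℕ) < k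
    · have hjh : j ∈ head n k := mem_head.2 hj
      have hr := coord_pos hx hjh
      obtain ⟨g', hg', hg'b⟩ := h.exists_deriv_gam hx hjh v
      set m := ((starRingEnd ℂ) (x j) * v j).re with hm
      set a' : ℝ := sgn j * (-(2 * m) * ‖x j‖⁻¹ ^ 4) with ha'
      have hinv : HasDerivAt (fun τ : ℝ => sgn j * (‖(x + τ • v) j‖ ^ 2)⁻¹) a' 0 :=
        (hasDerivAt_line_inv_normSq x v hr).const_mul _
      have hspeed : HasDerivAt (fun τ : ℝ => speed q k (x + τ • v) j)
          (-(((a' + g') * (σ ^ 2 + corr q k x) -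
            (sgn j * (‖x j‖ ^ 2)⁻¹ + gam q x j) * (S' + B')) / (σ ^ 2 + corr q k x) ^ 2)) 0 := by
        refine (((hinv.add hg').neg).div hden (by simpa using hden0)).congr_deriv ?_
        simp only [Pi.neg_apply, Pi.add_apply, zero_smul, add_zero, hdenS]
        ring
      have hpj := hproj j
      have e : (fun τ : ℝ => field q k (x + τ • v) j) =
          fun τ : ℝ => Complex.I * ((speed q k (x + τ • v) j : ℝ) : ℂ) * (x + τ • v) j := by
        funext τ; exact field_head hj
      rw [e] at hpj
      rw [hpj.unique ((hspeed.ofReal_comp.const_mul Complex.I).mul (hasDerivAt_line_coord x v j))]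
      simp only [zero_smul, add_zero, rotation, hj, if_true]
      have hsum : ((∑ l, mainCoeff k x j l * ((starRingEnd ℂ) (unitCoord x l) * v l).re : ℝ)) =
          ‖x j‖ * -((a' * σ ^ 2 - sgn j * (‖x j‖ ^ 2)⁻¹ * S') / (σ ^ 2) ^ 2) := by
        have hu : ∀ l, ((starRingEnd ℂ) (unitCoord x l) * v l).re =
            ‖x l‖⁻¹ * ((starRingEnd ℂ) (x l) * v l).re := fun l => by
          rw [unitCoord, map_div₀, Complex.conj_ofReal, ← Complex.re_ofReal_mul]
          congr 1
          push_cast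
          ring
        have e1 : ∀ l, mainCoeff k x j l * ((starRingEnd ℂ) (unitCoord x l) * v l).re =
            (if j = l then 2 * sgn j * (‖x j‖⁻¹ ^ 3 * (σ ^ 2)⁻¹) * m else 0) +
            (if (l : ℕ) < k then sgn j * ‖x j‖⁻¹ * ((σ ^ 2)⁻¹ ^ 2) *
              (-(2 * ((starRingEnd ℂ) (x l) * v l).re) * (‖x l‖⁻¹ ^ 4)) else 0) := fun l => by
          rw [hu, mainCoeff, hS]
          by_cases hl : (l : ℕ) < k
          · rw [if_pos ⟨hj, hl⟩, if_pos hl]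
            split_ifs with hjl
            · subst hjl; rw [← hm]; field_simp; ring
            · ring
          · have hjl : j ≠ l := fun e => hl (e ▸ hj)
            simp [hl, hjl]
        rw [Finset.sum_congr rfl fun l _ => e1 l, Finset.sum_add_distrib, ← sum_head_eq,
          ← Finset.mul_sum, ← hS'def, Finset.sum_ite_eq]
        simp only [Finset.mem_univ, if_true]
        have hr' := hr.ne'
        have hσ0 : σ ≠ 0 := by positivity
        rw [ha']
        field_simp
        ring
      rw [hsum]
      have hun : unitCoord x j * (‖x j‖ : ℂ) = x j := by
        rw [unitCoord]
        exact div_mul_cancel₀ _ (by exact_mod_cast hr.ne')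
      have key := speed_deriv_error (σ := σ) (r := ‖x j‖) (sg := sgn j) (a' := a')
        (γ := gam q x j) (γ' := g') (B := corr q k x) (B' := B') (S' := S') (b := b) (ν := ‖v‖)
        hσ1 hr (h.norm_coord_le_one hx j) (inv_le_sqrt hjh) (abs_sgn j) hb1 (norm_nonneg v)
        (by
          rw [ha', abs_mul, abs_sgn, one_mul, abs_mul, abs_neg, abs_mul, abs_two,
            abs_of_pos (pow_pos (inv_pos.2 hr) 4)]
          calc _ ≤ 2 * (‖x j‖ * ‖v‖) * ‖x j‖⁻¹ ^ 4 := by gcongr; exact abs_re_conj_mul_le x v j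
            _ = _ := by field_simp)
        ((h.abs_gam_le hx hjh).trans (by linarith))
        (hg'b.trans (by gcongr)) hcorr hB'b hS'b2 hcorrS
      refine le_trans (le_of_eq ?_) key
      have hunorm : ‖unitCoord x j‖ = 1 := by
        rw [unitCoord, norm_div, Complex.norm_real, norm_norm, div_self hr.ne']
      have hcast : ∀ s a b : ℝ, ‖Complex.I * ((-a : ℝ) : ℂ) * x j + Complex.I * (s : ℂ) * v j
          - Complex.I * (s : ℂ) * v j - Complex.I * unitCoord x j * ((‖x j‖ * -b : ℝ) : ℂ)‖ =
          ‖x j‖ * |a - b| := fun s a b => by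
        have e2 : Complex.I * ((-a : ℝ) : ℂ) * x j + Complex.I * (s : ℂ) * v j
            - Complex.I * (s : ℂ) * v j - Complex.I * unitCoord x j * ((‖x j‖ * -b : ℝ) : ℂ) =
            Complex.I * unitCoord x j * ((‖x j‖ * -(a - b) : ℝ) : ℂ) := by
          push_cast
          linear_combination (Complex.I * a) * hun
        rw [e2, norm_mul, norm_mul, Complex.norm_I, hunorm, Complex.norm_real, Real.norm_eq_abs,
          abs_mul, abs_neg, abs_of_pos hr, one_mul, one_mul]
      exact hcast _ _ _
    · have hpj := hproj j
      have e : (fun τ : ℝ => field q k (x + τ • v) j) = fun τ : ℝ =>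
          -(Complex.I * tgrad q k (x + τ • v) j / ((denom q k (x + τ • v) : ℝ) : ℂ)) := by
        funext τ; exact field_tail hj
      have hGj : HasDerivAt (fun τ : ℝ => tgrad q k (x + τ • v) j) (G' j) 0 :=
        (((EuclideanSpace.proj j : E n →L[ℂ] ℂ).restrictScalars ℝ).hasFDerivAt).comp_hasDerivAt
          (0 : ℝ) hG'
      rw [e] at hpj
      rw [hpj.unique ((hGj.const_mul Complex.I).fun_div hden.ofReal_comp
        (by simpa using hden0)).fun_neg]
      have hsum : ((∑ l, mainCoeff k x j l * ((starRingEnd ℂ) (unitCoord x l) * v l).re : ℝ)) = 0 :=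
        Finset.sum_eq_zero fun l _ => by simp [mainCoeff, hj]
      rw [hsum]
      simp only [rotation, hj, if_false, Complex.ofReal_zero, mul_zero, sub_zero, zero_smul,
        add_zero]
      rw [hdenS]
      exact tail_deriv_error hσ1 hb1 (norm_nonneg v)
        ((h.norm_tgrad_coord_le hx j).trans (by linarith))
        ((hG'b j).trans (by gcongr; linarith)) hB'b hS'b2 hcorrS
  refine (norm_le_of_coord hcoord).trans ?_
  calc (n + 1) * (28 * b ^ 2 * σ⁻¹ * ‖v‖) = (n + 1) * (28 * b ^ 2) * σ⁻¹ * ‖v‖ := by ring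
    _ ≤ _ := by gcongr; exact h.inv_sqrt_le_norm hx

end IsControlled

/-! ### The linearized flow in the rotating frame -/

theorem norm_unitCoord_le (x : E n) (j : Fin (n + 1)) : ‖unitCoord x j‖ ≤ 1 := by
  rw [unitCoord, norm_div, Complex.norm_real, norm_norm]
  exact div_self_le_one _

/-- The diagonal unitary map with angles `s`. -/
noncomputable def rotate (s : Fin (n + 1) → ℝ) (v : E n) : E n :=
  WithLp.toLp 2 fun j => Complex.exp (s j * Complex.I) * v j

theorem rotate_apply (s : Fin (n + 1) → ℝ) (v : E n) (j : Fin (n + 1)) :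
    rotate s v j = Complex.exp (s j * Complex.I) * v j := rfl

theorem norm_rotate (s : Fin (n + 1) → ℝ) (v : E n) : ‖rotate s v‖ = ‖v‖ := by
  rw [EuclideanSpace.norm_eq, EuclideanSpace.norm_eq]
  simp [rotate_apply, Complex.norm_exp_ofReal_mul_I]

theorem rotate_sub (s : Fin (n + 1) → ℝ) (v w : E n) :
    rotate s (v - w) = rotate s v - rotate s w := by
  ext j; simp [rotate_apply, mul_sub]

theorem rotate_neg_rotate (s : Fin (n + 1) → ℝ) (v : E n) : rotate (-s) (rotate s v) = v := by
  ext j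
  rw [rotate_apply, rotate_apply, ← mul_assoc, ← Complex.exp_add]
  simp

theorem rotate_rotate_neg (s : Fin (n + 1) → ℝ) (v : E n) : rotate s (rotate (-s) v) = v := by
  simpa using rotate_neg_rotate (-s) v

theorem rotate_zero (v : E n) : rotate 0 v = v := by ext j; simp [rotate_apply]

theorem frameDet_rotate (s : Fin (n + 1) → ℝ) (v : Fin (n + 1) → E n) :
    frameDet (fun i => rotate s (v i)) =
      Complex.exp ((∑ j, s j : ℝ) * Complex.I) * frameDet v := by
  rw [Complex.ofReal_sum, Finset.sum_mul, Complex.exp_sum, frameDet, frameDet,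
    ← Matrix.det_mul_row]
  rfl

/-- Conjugation by a rotation takes a shear to the shear with rotated directions and the same
coefficients. -/
theorem shear_rotate {u u' : Fin (n + 1) → ℂ} {G : Fin (n + 1) → Fin (n + 1) → ℝ}
    {s : Fin (n + 1) → ℝ} {A : Finset (Fin (n + 1))}
    (hu : ∀ j ∈ A, u' j = Complex.exp (s j * Complex.I) * u j)
    (hG : ∀ j l, ¬ (j ∈ A ∧ l ∈ A) → G j l = 0) (v : E n) :
    shear u' G (rotate s v) = rotate s (shear u G v) := by
  ext j
  have h1 : ∀ l, G j l * ((starRingEnd ℂ) (u' l) * rotate s v l).re =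
      G j l * ((starRingEnd ℂ) (u l) * v l).re := fun l => by
    by_cases hl : j ∈ A ∧ l ∈ A
    · have h2 :
          (starRingEnd ℂ) (Complex.exp (s l * Complex.I)) * Complex.exp (s l * Complex.I) = 1 := by
        rw [← Complex.normSq_eq_conj_mul_self, Complex.normSq_eq_norm_sq,
          Complex.norm_exp_ofReal_mul_I]
        simp
      rw [hu l hl.2, rotate_apply, map_mul]
      congr 2
      linear_combination (starRingEnd ℂ) (u l) * v l * h2
    · rw [hG j l hl]; simp
  rw [rotate_apply, shear_apply, shear_apply, Finset.sum_congr rfl fun l _ => h1 l]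
  by_cases hj : j ∈ A
  · rw [hu j hj]; ring
  · rw [Finset.sum_eq_zero fun l _ => by rw [hG j l fun h => hj h.1, zero_mul]]
    simp

theorem symCoeff_eq_zero {k : ℕ} {x : E n} (j l : Fin (n + 1))
    (h : ¬ (j ∈ head n k ∧ l ∈ head n k)) : symCoeff k x j l = 0 := by
  rw [mem_head, mem_head] at h
  simp [symCoeff, mainCoeff, h]

theorem headSum_congr {k : ℕ} {x y : E n} (h : ∀ j ∈ head n k, ‖x j‖ = ‖y j‖) :
    headSum k x = headSum k y := Finset.sum_congr rfl fun j hj => by rw [h j hj]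

theorem symCoeff_congr {k : ℕ} {x y : E n} (h : ∀ j ∈ head n k, ‖x j‖ = ‖y j‖) :
    symCoeff k x = symCoeff k y := by
  funext j l
  by_cases hjl : (j : ℕ) < k ∧ (l : ℕ) < k
  · rw [symCoeff, symCoeff, mainCoeff, mainCoeff, headSum_congr h, h j (mem_head.2 hjl.1),
      h l (mem_head.2 hjl.2)]
  · simp [symCoeff, mainCoeff, hjl]

namespace IsControlled

variable {q : E n → ℂ} {k : ℕ} {ρ C : ℝ} {x : E n}

theorem abs_symCoeff_le (h : IsControlled q k ρ C) (hx : x ∈ regular n k ρ)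
    (j l : Fin (n + 1)) : |symCoeff k x j l| ≤ 6 := by
  by_cases hjl : (j : ℕ) < k ∧ (l : ℕ) < k
  swap
  · simp [symCoeff, mainCoeff, hjl]
  have hS : headSum k x = √(headSum k x) ^ 2 := (Real.sq_sqrt (h.headSum_pos hx).le).symm
  have hσ : 0 < √(headSum k x) := Real.sqrt_pos.2 (h.headSum_pos hx)
  have hj := inv_le_sqrt (x := x) (mem_head.2 hjl.1)
  have hl := inv_le_sqrt (x := x) (mem_head.2 hjl.2)
  have hj0 := coord_pos hx (mem_head.2 hjl.1)
  have hl0 := coord_pos hx (mem_head.2 hjl.2)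
  set σ := √(headSum k x) with hσdef
  have b1 : ∀ i m : Fin (n + 1), ‖x i‖⁻¹ ≤ σ → ‖x m‖⁻¹ ≤ σ →
      |‖x i‖⁻¹ * ‖x m‖⁻¹ ^ 3 * (headSum k x)⁻¹ ^ 2| ≤ 1 := fun i m hi hm => by
    rw [hS, abs_of_nonneg (by positivity)]
    calc ‖x i‖⁻¹ * ‖x m‖⁻¹ ^ 3 * (σ ^ 2)⁻¹ ^ 2 ≤ σ * σ ^ 3 * (σ ^ 2)⁻¹ ^ 2 := by gcongr
      _ = 1 := by field_simp
  have b2 : |(‖x j‖ ^ 2)⁻¹ * (headSum k x)⁻¹| ≤ 1 := by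
    rw [abs_of_nonneg (by have := h.headSum_pos hx; positivity)]
    rw [← div_eq_mul_inv, div_le_one (h.headSum_pos hx)]
    exact inv_sq_le (mem_head.2 hjl.1)
  have m2 : ∀ (i : Fin (n + 1)) (z : ℝ), |z| ≤ 1 → |2 * sgn i * z| ≤ 2 := fun i z hz => by
    rw [abs_mul, abs_mul, abs_sgn, abs_two]; linarith
  rw [symCoeff, mainCoeff, if_pos hjl, if_pos hjl]
  have t1 : |(if j = l then 2 * sgn j * ((‖x j‖ ^ 2)⁻¹ * (headSum k x)⁻¹) else 0)| ≤ 2 := by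
    split_ifs
    · exact m2 j _ b2
    · simp
  refine (abs_sub _ _).trans ?_
  have t2 := (abs_sub (if j = l then 2 * sgn j * ((‖x j‖ ^ 2)⁻¹ * (headSum k x)⁻¹) else 0)
    (2 * sgn j * (‖x j‖⁻¹ * ‖x l‖⁻¹ ^ 3 * (headSum k x)⁻¹ ^ 2)))
  linarith [m2 j _ (b1 j l hj hl), m2 l _ (b1 l j hl hj)]

theorem norm_shear_symCoeff_le (h : IsControlled q k ρ C) (hx : x ∈ regular n k ρ) (v : E n) :
    ‖shear (unitCoord x) (symCoeff k x) v‖ ≤ 6 * (n + 1) ^ 2 * ‖v‖ :=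
  (norm_shear_le (norm_unitCoord_le x) (h.abs_symCoeff_le hx) v).trans (le_of_eq (by ring))

/-- On the kernel of `d log |p|`, the shear in the linearization of the field can be replaced by one
with symmetric coefficients: the difference of the coefficients is the product of a function of `j`
and the coefficients of `d log |y_2 ⋯ y_k / y_1|`, which differs from `d log |p|` by the bounded
form `d log |q|`. -/
theorem norm_shear_mainCoeff_sub_le (h : IsControlled q k ρ C) (hx : x ∈ regular n k ρ) {v : E n}
    (hv : (dlog q k x v).re = 0) :
    ‖shear (unitCoord x) (mainCoeff k x) v - shear (unitCoord x) (symCoeff k x) v‖ ≤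
      (n + 1) * (2 * C) * ‖x‖ * ‖v‖ := by
  have hC := h.one_le
  have hS : headSum k x = √(headSum k x) ^ 2 := (Real.sq_sqrt (h.headSum_pos hx).le).symm
  have hσ : 1 ≤ √(headSum k x) := h.one_le_sqrt hx
  have hσi := h.inv_sqrt_le_norm hx
  rw [show (n + 1) * (2 * C) * ‖x‖ * ‖v‖ = (n + 1) * ((2 * C) * ‖x‖ * ‖v‖) by ring]
  refine norm_le_of_coord fun j => ?_
  rw [PiLp.sub_apply, shear_apply, shear_apply, ← mul_sub, ← Complex.ofReal_sub,
    ← Finset.sum_sub_distrib]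
  by_cases hj : (j : ℕ) < k
  swap
  · rw [Finset.sum_eq_zero fun l _ => by simp [mainCoeff, symCoeff, hj]]
    simp only [Complex.ofReal_zero, mul_zero, norm_zero]
    positivity
  have hk : ∑ l, (mainCoeff k x j l * ((starRingEnd ℂ) (unitCoord x l) * v l).re -
      symCoeff k x j l * ((starRingEnd ℂ) (unitCoord x l) * v l).re) =
      2 * ‖x j‖⁻¹ ^ 3 * (headSum k x)⁻¹ ^ 2 * -(kap q x v).re := by
    have h1 : -(kap q x v).re = ∑ l ∈ head n k, sgn l * (v l / x l).re := by
      rw [dlog, Complex.add_re, Complex.re_sum] at hv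
      rw [Finset.sum_congr rfl fun l _ => (Complex.re_ofReal_mul (sgn l) (v l / x l)).symm]
      linarith
    rw [h1, Finset.mul_sum, sum_head_eq]
    refine Finset.sum_congr rfl fun l _ => ?_
    rw [symCoeff, sub_mul, sub_sub_cancel]
    split_ifs with h2 h3 h3
    · have hx0 := hx.2 l (mem_head.2 h3)
      have hr := (coord_pos hx (mem_head.2 h3)).ne'
      have e : v l / x l = ((‖x l‖⁻¹ : ℝ) : ℂ) * ((starRingEnd ℂ) (unitCoord x l) * v l) := by
        rw [unitCoord, map_div₀, Complex.conj_ofReal]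
        have h4 : (starRingEnd ℂ) (x l) * x l = (‖x l‖ : ℂ) ^ 2 := by
          rw [← Complex.normSq_eq_conj_mul_self, Complex.normSq_eq_norm_sq]; push_cast; ring
        have h5 : (‖x l‖ : ℂ) ≠ 0 := by exact_mod_cast hr
        push_cast
        field_simp
        linear_combination (-v l) * h4
      rw [e, Complex.re_ofReal_mul]
      ring
    · exact absurd h2.2 h3
    · exact absurd ⟨hj, h3⟩ h2
    · simp
  rw [hk, norm_mul, norm_mul, Complex.norm_I, one_mul, Complex.norm_real, Real.norm_eq_abs, abs_mul,
    abs_neg]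
  have hj' := inv_le_sqrt (x := x) (mem_head.2 hj)
  set σ := √(headSum k x) with hσdef
  have hσ0 : 0 < σ := by linarith
  have b1 : |2 * ‖x j‖⁻¹ ^ 3 * (headSum k x)⁻¹ ^ 2| ≤ 2 * ‖x‖ := by
    rw [hS, abs_of_nonneg (by positivity)]
    calc 2 * ‖x j‖⁻¹ ^ 3 * (σ ^ 2)⁻¹ ^ 2 ≤ 2 * σ ^ 3 * (σ ^ 2)⁻¹ ^ 2 := by gcongr
      _ = 2 * σ⁻¹ := by field_simp
      _ ≤ _ := by gcongr
  calc _ ≤ 1 * (2 * ‖x‖ * (C * ‖v‖)) := by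
        gcongr
        · exact norm_unitCoord_le x j
        · exact (Complex.abs_re_le_norm _).trans (h.norm_kap_le hx v)
    _ = _ := by ring

end IsControlled

/-! ### Orbits of the horizontal field -/

open Set in
theorem eq_of_hasDerivWithinAt_zero {F : Type*} [NormedAddCommGroup F] [NormedSpace ℝ F]
    {f : ℝ → F} {T : ℝ} (hf : ∀ t ∈ Icc 0 T, HasDerivWithinAt f 0 (Icc 0 T) t) :
    ∀ t ∈ Icc 0 T, f t = f 0 :=
  constant_of_has_deriv_right_zero (fun t ht => (hf t ht).continuousWithinAt)
    fun t ht => (hf t ⟨ht.1, ht.2.le⟩).mono_of_mem_nhdsWithin (Icc_mem_nhdsGE_of_mem ht)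

open Set in
theorem exists_primitive {f : ℝ → ℝ} {T : ℝ} (hT : 0 ≤ T) (hf : ContinuousOn f (Icc 0 T)) :
    ∃ F : ℝ → ℝ, F 0 = 0 ∧ ∀ t ∈ Icc 0 T, HasDerivWithinAt F (f t) (Icc 0 T) t := by
  have hc : Continuous (IccExtend hT ((Icc 0 T).domRestrict f)) :=
    (continuousOn_iff_continuous_domRestrict.1 hf).Icc_extend'
  refine ⟨fun t => ∫ τ in (0 : ℝ)..t, IccExtend hT ((Icc 0 T).domRestrict f) τ, by simp,
    fun t ht => ?_⟩
  have h := (intervalIntegral.integral_hasDerivAt_right (hc.intervalIntegrable 0 t)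
    (hc.stronglyMeasurableAtFilter _ _) hc.continuousAt).hasDerivWithinAt (s := Icc 0 T)
  rwa [IccExtend_of_mem _ _ ht] at h

theorem hasDerivWithinAt_coord {x : ℝ → E n} {v : E n} {s : Set ℝ} {t : ℝ}
    (h : HasDerivWithinAt x v s t) (j : Fin (n + 1)) :
    HasDerivWithinAt (fun τ => x τ j) (v j) s t :=
  (((EuclideanSpace.proj j : E n →L[ℂ] ℂ).restrictScalars ℝ).hasFDerivAt).comp_hasDerivWithinAt
    t h

theorem hasDerivWithinAt_of_coord {x : ℝ → E n} {v : E n} {s : Set ℝ} {t : ℝ}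
    (h : ∀ j, HasDerivWithinAt (fun τ => x τ j) (v j) s t) : HasDerivWithinAt x v s t := by
  refine (hasFDerivWithinAt_piLp 2).2 ?_
  intro j
  have := (h j).hasFDerivWithinAt
  refine this.congr_fderiv ?_
  ext
  simp

/-- `x` is an integral curve of the horizontal field for times in `[0, T]`, in the part of the ball
of radius `ρ` where the head coordinates do not vanish. -/
structure IsOrbit (q : E n → ℂ) (k : ℕ) (ρ T : ℝ) (x : ℝ → E n) : Prop where
  mem : ∀ t ∈ Set.Icc 0 T, x t ∈ regular n k ρ
  deriv : ∀ t ∈ Set.Icc 0 T, HasDerivWithinAt x (field q k (x t)) (Set.Icc 0 T) t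

variable {q : E n → ℂ} {k : ℕ} {ρ C T : ℝ} {x : ℝ → E n}

theorem IsOrbit.continuousOn (hx : IsOrbit q k ρ T x) : ContinuousOn x (Set.Icc 0 T) :=
  fun t ht => (hx.deriv t ht).continuousWithinAt

/-- The head coordinates are rotated along an orbit. -/
theorem IsOrbit.exists_angle (hx : IsOrbit q k ρ T x) (h : IsControlled q k ρ C) (hT : 0 ≤ T) :
    ∃ s : ℝ → Fin (n + 1) → ℝ, s 0 = 0 ∧ (∀ t, ∀ j ∉ head n k, s t j = 0) ∧
      (∀ j ∈ head n k, ∀ t ∈ Set.Icc 0 T,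
        HasDerivWithinAt (fun τ => s τ j) (speed q k (x t) j) (Set.Icc 0 T) t) ∧
      ∀ j ∈ head n k, ∀ t ∈ Set.Icc 0 T, x t j = Complex.exp (s t j * Complex.I) * x 0 j := by
  have hex : ∀ j : Fin (n + 1), ∃ F : ℝ → ℝ, F 0 = 0 ∧ (j ∉ head n k → ∀ t, F t = 0) ∧
      (j ∈ head n k → ∀ t ∈ Set.Icc 0 T,
        HasDerivWithinAt F (speed q k (x t) j) (Set.Icc 0 T) t) := fun j => by
    by_cases hj : j ∈ head n k
    · obtain ⟨F, h0, hF⟩ := exists_primitive (f := fun t => speed q k (x t) j) hT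
        ((h.speed_contDiffOn hj).1.continuousOn.comp hx.continuousOn hx.mem)
      exact ⟨F, h0, fun h => absurd hj h, fun _ => hF⟩
    · exact ⟨fun _ => 0, rfl, fun _ _ => rfl, fun h => absurd h hj⟩
  choose F h0 hz hF using hex
  refine ⟨fun t j => F j t, funext h0, fun t j hj => hz j hj t, fun j hj => hF j hj, ?_⟩
  intro j hj t ht
  have hder : ∀ t ∈ Set.Icc 0 T, HasDerivWithinAt
      (fun τ => Complex.exp (-(F j τ : ℂ) * Complex.I) * x τ j) 0 (Set.Icc 0 T) t := by
    intro t ht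
    have h1 := (((hF j hj t ht).ofReal_comp.fun_neg.mul_const Complex.I).cexp).mul
      (hasDerivWithinAt_coord (hx.deriv t ht) j)
    refine h1.congr_deriv ?_
    rw [field_head (mem_head.1 hj)]
    ring
  have h2 := eq_of_hasDerivWithinAt_zero hder t ht
  simp only [h0, Complex.ofReal_zero, neg_zero, zero_mul, Complex.exp_zero, one_mul] at h2
  rw [← h2, ← mul_assoc, ← Complex.exp_add]
  simp

theorem IsOrbit.norm_coord_eq (hx : IsOrbit q k ρ T x) (h : IsControlled q k ρ C) {t : ℝ}
    (ht : t ∈ Set.Icc 0 T) {j : Fin (n + 1)} (hj : j ∈ head n k) : ‖x t j‖ = ‖x 0 j‖ := by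
  obtain ⟨s, -, -, -, hs⟩ := hx.exists_angle h (ht.1.trans ht.2)
  rw [hs j hj t ht, norm_mul, Complex.norm_exp_ofReal_mul_I, one_mul]

/-- In the frame which rotates with the head coordinates, solutions `w` of the linearized equation
which are tangent to the level sets of `|p|` stay close to those of a shear. -/
theorem exists_linearization_bound (n : ℕ) {C T : ℝ} (hC : 1 ≤ C) (hT : 0 ≤ T) : ∃ K, 0 ≤ K ∧
    ∀ {q : E n → ℂ} {k : ℕ} {ρ : ℝ} {x w : ℝ → E n} {δ : ℝ} {s : ℝ → Fin (n + 1) → ℝ},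
      IsControlled q k ρ C → IsOrbit q k ρ T x → δ ≤ 1 → (∀ t ∈ Set.Icc 0 T, ‖x t‖ ≤ δ) →
      (∀ t ∈ Set.Icc 0 T,
        HasDerivWithinAt w (fderiv ℝ (field q k) (x t) (w t)) (Set.Icc 0 T) t) →
      (∀ t ∈ Set.Icc 0 T, (dlog q k (x t) (w t)).re = 0) →
      s 0 = 0 → (∀ t, ∀ j ∉ head n k, s t j = 0) →
      (∀ j ∈ head n k, ∀ t ∈ Set.Icc 0 T,
        HasDerivWithinAt (fun τ => s τ j) (speed q k (x t) j) (Set.Icc 0 T) t) →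
      (∀ j ∈ head n k, ∀ t ∈ Set.Icc 0 T, x t j = Complex.exp (s t j * Complex.I) * x 0 j) →
      ∀ t ∈ Set.Icc 0 T, ‖rotate (-s t) (w t) -
        (w 0 + t • shear (unitCoord (x 0)) (symCoeff k (x 0)) (w 0))‖ ≤ K * δ * ‖w 0‖ := by
  set K₀ : ℝ := (n + 1) * (28 * (8 * (n + 1) * C ^ 2) ^ 2) + (n + 1) * (2 * C) with hK₀
  set g : ℝ := 6 * (n + 1) ^ 2 with hg
  have hK₀0 : 0 ≤ K₀ := by positivity
  have hg0 : 0 ≤ g := by positivity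
  refine ⟨K₀ * (1 + T * g) * T * Real.exp ((g + K₀) * T), by positivity, ?_⟩
  intro q k ρ x w δ s h hx hδ1 hδ hw hdlog hs0 hsz hs hsx
  have h0T : (0 : ℝ) ∈ Set.Icc 0 T := ⟨le_rfl, hT⟩
  have hδ0 : 0 ≤ δ := (norm_nonneg _).trans (hδ 0 h0T)
  set N := shear (unitCoord (x 0)) (symCoeff k (x 0)) with hN
  have hNle : ∀ v, ‖N v‖ ≤ g * ‖v‖ := h.norm_shear_symCoeff_le (hx.mem 0 h0T)
  -- In the rotating frame the rotational part of the linearization disappears, and the shear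
  -- becomes the constant `N`.
  set b : ℝ → E n := fun t => rotate (-s t) (w t) with hb
  have hbd : ∀ t ∈ Set.Icc 0 T, HasDerivWithinAt b
      (rotate (-s t) (fderiv ℝ (field q k) (x t) (w t) - rotation q k (x t) (w t)))
      (Set.Icc 0 T) t := by
    intro t ht
    refine hasDerivWithinAt_of_coord fun j => ?_
    have hwj := hasDerivWithinAt_coord (hw t ht) j
    simp only [hb, rotate_apply, PiLp.sub_apply, Pi.neg_apply]
    by_cases hj : j ∈ head n k
    · have h1 := (((hs j hj t ht).fun_neg.ofReal_comp.mul_const Complex.I).cexp).mul hwj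
      refine h1.congr_deriv ?_
      simp only [rotation, mem_head.1 hj, if_true]
      push_cast
      ring
    · simp only [hsz _ j hj, rotation, mt mem_head.2 hj, if_false]
      simpa using hwj
  have herr : ∀ t ∈ Set.Icc 0 T,
      ‖rotate (-s t) (fderiv ℝ (field q k) (x t) (w t) - rotation q k (x t) (w t)) - N (b t)‖ ≤
        K₀ * δ * ‖b t‖ := by
    intro t ht
    have hG : symCoeff k (x t) = symCoeff k (x 0) :=
      symCoeff_congr fun j hj => hx.norm_coord_eq h ht hj
    have hu : ∀ j ∈ head n k,
        unitCoord (x 0) j = Complex.exp ((-s t) j * Complex.I) * unitCoord (x t) j := by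
      intro j hj
      rw [unitCoord, unitCoord, hx.norm_coord_eq h ht hj, hsx j hj t ht, mul_div_assoc',
        ← mul_assoc, ← Complex.exp_add]
      simp
    have h1 : N (b t) = rotate (-s t) (shear (unitCoord (x t)) (symCoeff k (x t)) (w t)) := by
      rw [hN, hb, ← hG]
      exact shear_rotate hu (fun j l hjl => symCoeff_eq_zero j l hjl) _
    rw [h1, ← rotate_sub, norm_rotate, hb, norm_rotate]
    have h2 := h.norm_fderiv_field_sub_le (hx.mem t ht) (w t)
    have h3 := h.norm_shear_mainCoeff_sub_le (hx.mem t ht) (hdlog t ht)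
    calc _ ≤ (n + 1) * (28 * (8 * (n + 1) * C ^ 2) ^ 2) * ‖x t‖ * ‖w t‖ +
          (n + 1) * (2 * C) * ‖x t‖ * ‖w t‖ := by
          refine le_trans (le_of_eq ?_) ((norm_add_le _ _).trans (add_le_add h2 h3))
          congr 1
          abel
      _ = K₀ * ‖x t‖ * ‖w t‖ := by rw [hK₀]; ring
      _ ≤ _ := by gcongr; exact hδ t ht
  have hb0 : b 0 = w 0 := by simp only [hb, hs0, neg_zero, rotate_zero]
  set v := w 0 with hv
  have hNN : N (N v) = 0 := shear_shear _ _ _ _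
  -- As `N² = 0`, the curve `v + t N v` solves the equation `v' = N v`.
  have hcd : ∀ t ∈ Set.Icc 0 T, HasDerivWithinAt (fun t => b t - (v + t • N v))
      (rotate (-s t) (fderiv ℝ (field q k) (x t) (w t) - rotation q k (x t) (w t)) - N v)
      (Set.Icc 0 T) t := fun t ht => by
    have h1 : HasDerivWithinAt (fun t : ℝ => v + t • N v) (N v) (Set.Icc 0 T) t := by
      simpa using ((hasDerivWithinAt_id t (Set.Icc 0 T)).smul_const (N v)).const_add v
    exact (hbd t ht).sub h1
  have hgron := norm_le_of_deriv_bound (K := g + K₀) (ε := K₀ * δ * ((1 + T * g) * ‖v‖)) (δ := 0)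
    (by positivity) (by positivity) hcd (by simp [hb0]) (fun t ht => by
      have e1 : rotate (-s t) (fderiv ℝ (field q k) (x t) (w t) - rotation q k (x t) (w t)) - N v =
          (rotate (-s t) (fderiv ℝ (field q k) (x t) (w t) - rotation q k (x t) (w t)) - N (b t)) +
            N (b t - (v + t • N v)) := by
        rw [map_sub, map_add, map_smul, hNN, smul_zero, add_zero]
        abel
      rw [e1]
      have e2 : ‖b t‖ ≤ ‖b t - (v + t • N v)‖ + (1 + T * g) * ‖v‖ := by
        calc ‖b t‖ = ‖(b t - (v + t • N v)) + (v + t • N v)‖ := by rw [sub_add_cancel]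
          _ ≤ ‖b t - (v + t • N v)‖ + (‖v‖ + ‖t • N v‖) :=
            (norm_add_le _ _).trans (add_le_add le_rfl (norm_add_le _ _))
          _ ≤ ‖b t - (v + t • N v)‖ + (‖v‖ + T * (g * ‖v‖)) := by
            rw [norm_smul, Real.norm_eq_abs, abs_of_nonneg ht.1]
            gcongr
            · exact ht.2
            · exact hNle v
          _ = _ := by ring
      calc _ ≤ K₀ * δ * ‖b t‖ + g * ‖b t - (v + t • N v)‖ :=
            (norm_add_le _ _).trans (add_le_add (herr t ht) (hNle _))
        _ ≤ K₀ * δ * (‖b t - (v + t • N v)‖ + (1 + T * g) * ‖v‖) + g * ‖b t - (v + t • N v)‖ := by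
            gcongr
        _ = K₀ * δ * ‖b t - (v + t • N v)‖ + K₀ * δ * ((1 + T * g) * ‖v‖) +
            g * ‖b t - (v + t • N v)‖ := by ring
        _ ≤ K₀ * 1 * ‖b t - (v + t • N v)‖ + K₀ * δ * ((1 + T * g) * ‖v‖) +
            g * ‖b t - (v + t • N v)‖ := by gcongr
        _ = _ := by ring)
  intro t ht
  refine (hgron t ht).trans (le_of_eq ?_)
  ring

/-! ### The horizontal flow near a point -/

open scoped Manifold in
/-- A smooth function `f` on an open set `O` agrees on a compact subset with a compactly supported
smooth function on the whole space. -/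
theorem exists_cutoff {F G : Type*} [NormedAddCommGroup F] [NormedSpace ℝ F]
    [FiniteDimensional ℝ F] [NormedAddCommGroup G] [NormedSpace ℝ G] {K O : Set F} {f : F → G}
    (hK : IsCompact K) (hO : IsOpen O) (hKO : K ⊆ O) (hf : ContDiffOn ℝ ∞ f O) :
    ∃ χ : F → ℝ, (∀ x ∈ K, χ x = 1) ∧ (∀ x ∉ O, χ x = 0) ∧ (∀ x, 0 ≤ χ x ∧ χ x ≤ 1) ∧
      ContDiff ℝ ∞ (fun x => χ x • f x) ∧ HasCompactSupport (fun x => χ x • f x) := by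
  have : ProperSpace F := FiniteDimensional.proper ℝ F
  obtain ⟨L, hL, hKL, hLO⟩ := exists_compact_between hK hO hKO
  obtain ⟨χ, h0, h1, hχ⟩ := exists_contMDiffMap_zero_one_of_isClosed 𝓘(ℝ, F) (n := (⊤ : ℕ∞))
    isOpen_interior.isClosed_compl hK.isClosed
    (Set.disjoint_compl_left_iff_subset.2 hKL)
  have hL0 : ∀ x ∉ L, χ x = 0 := fun x hx => h0 fun h => hx (interior_subset h)
  refine ⟨χ, fun x hx => h1 hx, fun x hx => hL0 x fun h => hx (hLO h), fun x => hχ x, ?_, ?_⟩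
  · have hχs : ContDiff ℝ ∞ χ := χ.contMDiff.contDiff
    refine contDiff_iff_contDiffAt.2 fun x => ?_
    by_cases hx : x ∈ L
    · exact hχs.contDiffAt.smul (hf.contDiffAt (hO.mem_nhds (hLO hx)))
    · refine (contDiffAt_const (c := (0 : G))).congr_of_eventuallyEq ?_
      filter_upwards [hL.isClosed.isOpen_compl.mem_nhds hx] with z hz
      rw [hL0 z hz, zero_smul]
  · exact HasCompactSupport.intro hL fun x hx => by rw [hL0 x hx, zero_smul]

/-- `ψ` is a smooth flow of the horizontal field for times in `[0, T]` and initial points in the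
open set `U`; `variation` is the linearized equation for its derivative. -/
structure IsLocalFlow (q : E n → ℂ) (k : ℕ) (ρ T : ℝ) (U : Set (E n)) (ψ : ℝ → E n → E n) :
    Prop where
  isOpen : IsOpen U
  zero : ∀ x ∈ U, ψ 0 x = x
  orbit : ∀ x ∈ U, IsOrbit q k ρ T (ψ · x)
  smooth : ∀ t ∈ Set.Icc 0 T, ContDiffOn ℝ ∞ (ψ t) U
  variation : ∀ x ∈ U, ∀ v, ∀ t ∈ Set.Icc 0 T,
    HasDerivWithinAt (fun s => fderiv ℝ (ψ s) x v)
      (fderiv ℝ (field q k) (ψ t x) (fderiv ℝ (ψ t) x v)) (Set.Icc 0 T) t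

open Set in
/-- Along the flow of the horizontal field the head coordinates keep their absolute values and the
others move little, so that it exists for times in `[0, T]` near the origin. -/
theorem IsControlled.exists_flow {q : E n → ℂ} {k : ℕ} {ρ C T δ : ℝ} (h : IsControlled q k ρ C)
    (hT : 0 ≤ T) (hδ : (n + 1) * (1 + 4 * C * T) * δ < ρ / 2) {y : E n} (hy : ‖y‖ < δ)
    (hy0 : ∀ j ∈ head n k, y j ≠ 0) :
    ∃ (U : Set (E n)) (ψ : ℝ → E n → E n), y ∈ U ∧ IsLocalFlow q k ρ T U ψ ∧
      ∀ x ∈ U, ∀ t ∈ Icc 0 T, ‖ψ t x‖ ≤ (n + 1) * (1 + 4 * C * T) * δ := by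
  have hC := h.one_le
  have hδ0 : 0 < δ := (norm_nonneg _).trans_lt hy
  have hn : (0 : ℝ) ≤ n := Nat.cast_nonneg n
  have hCT : 0 ≤ 4 * C * T := by positivity
  have hδρ : δ < ρ / 2 := by
    refine lt_of_le_of_lt ?_ hδ
    calc δ = (0 + 1) * (1 + 0) * δ := by ring
      _ ≤ _ := by gcongr
  have hδ1 : δ ≤ 1 := by linarith [h.radius_le]
  -- On `K` the field is cut off to a compactly supported one; trajectories of the latter starting
  -- in `U` stay in `W ⊆ K`, so that they are trajectories of the original field.
  set K : Set (E n) := Metric.closedBall 0 (ρ / 2) ∩ ⋂ j ∈ head n k, {x | ‖y j‖ / 2 ≤ ‖x j‖} with hK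
  have hKc : IsCompact K := (isCompact_closedBall _ _).inter_right
    (isClosed_biInter fun j _ => isClosed_le continuous_const (by fun_prop))
  have hKreg : K ⊆ regular n k ρ := by
    rintro x ⟨hx1, hx2⟩
    simp only [mem_iInter, mem_ofPred_eq] at hx2
    refine ⟨?_, fun j hj => norm_pos_iff.1 ?_⟩
    · rw [mem_closedBall_zero_iff] at hx1
      rw [mem_ball_zero_iff]
      linarith
    · exact (half_pos (norm_pos_iff.2 (hy0 j hj))).trans_le (hx2 j hj)
  obtain ⟨χ, hχ1, hχ0, hχ, hZ, hZc⟩ := exists_cutoff hKc (isOpen_regular k ρ) hKreg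
    h.field_contDiffOn
  obtain ⟨ψ, hψ0, hψ, hψs, hψv⟩ := exists_smooth_flow hZ hZc hT
  set U : Set (E n) := Metric.ball 0 δ ∩ ⋂ j ∈ head n k, {x | ‖y j‖ / 2 < ‖x j‖} with hU
  set W : Set (E n) := Metric.ball 0 (ρ / 2) ∩ ⋂ j ∈ head n k, {x | ‖y j‖ / 2 < ‖x j‖} with hW
  have hopen : ∀ r : ℝ,
      IsOpen (Metric.ball 0 r ∩ ⋂ j ∈ head n k, {x : E n | ‖y j‖ / 2 < ‖x j‖}) := fun r =>
    Metric.isOpen_ball.inter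
      (isOpen_biInter_finset fun j _ => isOpen_lt continuous_const (by fun_prop))
  have hWK : W ⊆ K := by
    refine inter_subset_inter Metric.ball_subset_closedBall ?_
    exact iInter₂_mono fun j _ => Set.ofPred_subset_ofPred.2 fun x hx => le_of_lt hx
  -- The cutoff only rescales the field, which therefore still rotates the head coordinates.
  have hhead : ∀ x, ∀ t ∈ Icc 0 T, ∀ j ∈ head n k, ‖ψ t x j‖ = ‖x j‖ := by
    intro x t ht j hj
    have hd : ∀ t ∈ Icc 0 T, HasDerivWithinAt (fun τ => ‖ψ τ x j‖ ^ 2) 0 (Icc 0 T) t := by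
      intro t ht
      refine (hasDerivWithinAt_coord (hψ x t ht) j).norm_sq.congr_deriv ?_
      rw [PiLp.smul_apply, field_head (mem_head.1 hj), Complex.real_smul,
        show (χ (ψ t x) : ℂ) * (Complex.I * (speed q k (ψ t x) j : ℂ) * ψ t x j) =
          ((χ (ψ t x) * speed q k (ψ t x) j : ℝ) : ℂ) * (Complex.I * ψ t x j) by push_cast; ring,
        ← Complex.real_smul, inner_smul_right]
      simp [Complex.inner]
      ring_nf
      simp
    have h1 := eq_of_hasDerivWithinAt_zero hd t ht
    rw [hψ0] at h1
    exact (pow_left_inj₀ (norm_nonneg _) (norm_nonneg _) two_ne_zero).1 h1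
  have hbound : ∀ x ∈ U, ∀ t ∈ Icc 0 T, ‖ψ t x‖ ≤ (n + 1) * (1 + 4 * C * T) * δ := by
    intro x hx t ht
    have hxδ : ‖x‖ < δ := by simpa using hx.1
    rw [mul_assoc]
    refine norm_le_of_coord fun j => ?_
    by_cases hj : j ∈ head n k
    · rw [hhead x t ht j hj]
      calc ‖x j‖ ≤ (1 + 0) * δ := by linarith [norm_coord_le x j]
        _ ≤ _ := by gcongr
    · have hd := norm_le_of_deriv_bound (f := fun τ => ψ τ x j) (K := 0) (ε := 4 * C * δ) (δ := δ)
        le_rfl (by positivity) (fun t ht => hasDerivWithinAt_coord (hψ x t ht) j)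
        (by rw [hψ0]; exact (norm_coord_le x j).trans hxδ.le) (fun t ht => by
          rw [zero_mul, zero_add, PiLp.smul_apply, norm_smul, Real.norm_eq_abs,
            abs_of_nonneg (hχ _).1]
          by_cases hz : ψ t x ∈ regular n k ρ
          · have h1 := h.norm_field_tail_le hz (mt mem_head.2 hj)
            rw [hhead x t ht 0 h.zero_mem_head] at h1
            have h2 : ‖x 0‖ ≤ δ := (norm_coord_le x 0).trans hxδ.le
            calc _ ≤ 1 * (4 * C * ‖x 0‖ ^ 2) := by gcongr; exact (hχ _).2
              _ ≤ 1 * (4 * C * (δ * 1)) := by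
                  rw [sq]
                  gcongr
                  exact h2.trans hδ1
              _ = _ := by ring
          · rw [hχ0 _ hz]; simp; positivity) t ht
      refine hd.trans (le_of_eq ?_)
      rw [zero_mul, Real.exp_zero]
      ring
  have hmemW : ∀ x ∈ U, ∀ t ∈ Icc 0 T, ψ t x ∈ W := by
    intro x hx t ht
    refine ⟨by rw [mem_ball_zero_iff]; exact (hbound x hx t ht).trans_lt hδ, ?_⟩
    have hx2 := hx.2
    simp only [mem_iInter, mem_ofPred_eq] at hx2 ⊢
    intro j hj
    rw [hhead x t ht j hj]
    exact hx2 j hj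
  have hZW : ∀ z ∈ W, χ z • field q k z = field q k z := fun z hz => by
    rw [hχ1 z (hWK hz), one_smul]
  refine ⟨U, ψ, ⟨by simpa using hy, ?_⟩, ⟨hopen δ, fun x _ => hψ0 x, fun x hx =>
    ⟨fun t ht => hKreg (hWK (hmemW x hx t ht)), fun t ht => ?_⟩,
    fun t ht => (hψs t ht).contDiffOn, fun x hx v t ht => ?_⟩, hbound⟩
  · simp only [mem_iInter, mem_ofPred_eq]
    intro j hj
    linarith [norm_pos_iff.2 (hy0 j hj)]
  · have h1 := hψ x t ht
    rwa [hZW _ (hmemW x hx t ht)] at h1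
  · have h1 := hψv x v t ht
    have h2 : (fun z => χ z • field q k z) =ᶠ[nhds (ψ t x)] field q k :=
      Filter.eventually_of_mem ((hopen (ρ / 2)).mem_nhds (hmemW x hx t ht)) hZW
    rwa [h2.fderiv_eq] at h1

/-! ### The local model near the origin -/

/-- Multiplication of the `j`-th coordinate by `c`. -/
noncomputable def scaleCoord (j : Fin (n + 1)) (c : ℂ) : E n →L[ℝ] E n :=
  LinearMap.toContinuousLinearMap
    { toFun := fun x => x + EuclideanSpace.single j ((c - 1) * x j)
      map_add' := fun x y => by
        rw [PiLp.add_apply, mul_add, single_add]; abel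
      map_smul' := fun a x => by
        rw [PiLp.smul_apply, Complex.real_smul, mul_left_comm, single_real_mul, RingHom.id_apply,
          smul_add] }

theorem scaleCoord_def (j : Fin (n + 1)) (c : ℂ) (x : E n) :
    scaleCoord j c x = x + EuclideanSpace.single j ((c - 1) * x j) := rfl

theorem scaleCoord_apply (j : Fin (n + 1)) (c : ℂ) (x : E n) (i : Fin (n + 1)) :
    scaleCoord j c x i = if i = j then c * x i else x i := by
  rw [scaleCoord_def, PiLp.add_apply, PiLp.single_apply]
  split_ifs with h
  · subst h; ring
  · ring

theorem norm_scaleCoord (j : Fin (n + 1)) {c : ℂ} (hc : ‖c‖ = 1) (x : E n) :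
    ‖scaleCoord j c x‖ = ‖x‖ := by
  rw [EuclideanSpace.norm_eq, EuclideanSpace.norm_eq]
  congr 1
  refine Finset.sum_congr rfl fun i _ => ?_
  rw [scaleCoord_apply]
  split_ifs <;> simp [hc]

theorem rho_single {k : ℕ} (j : Fin (n + 1)) (hj : (j : ℕ) < k) (θ : ℝ) (x : E n) :
    rho (Pi.single (⟨j, hj⟩ : Fin k) θ) x = scaleCoord j (Complex.exp (θ * Complex.I)) x := by
  ext i
  rw [scaleCoord_apply]
  simp only [rho]
  by_cases hi : i = j
  · subst hi; simp [hj, mul_comm]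
  · by_cases hik : (i : ℕ) < k
    · have : (⟨i, hik⟩ : Fin k) ≠ ⟨j, hj⟩ := fun h => hi (Fin.ext (Fin.mk.inj_iff.1 h))
      simp [hik, hi, this]
    · simp [hik, hi]

theorem weight_single {k : ℕ} (j : Fin k) (θ : ℝ) :
    weight (Pi.single j θ) = if (j : ℕ) = 0 then -θ else θ := by
  rw [weight, Finset.sum_eq_single j]
  · simp
  · intro i _ hi; simp [Pi.single_eq_of_ne hi]
  · simp

theorem tailProd_scaleCoord {k : ℕ} (j : Fin (n + 1)) (hj : (j : ℕ) < k) (c : ℂ) (x : E n) :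
    tailProd k (scaleCoord j c x) = (if (j : ℕ) = 0 then 1 else c) * tailProd k x := by
  have h1 : ∀ i, scaleCoord j c x i = (if i = j then c else 1) * x i := fun i => by
    rw [scaleCoord_apply]; split_ifs <;> simp
  rw [tailProd, tailProd, Finset.prod_congr rfl fun i _ => h1 i, Finset.prod_mul_distrib,
    Finset.prod_ite_eq']
  congr 1
  by_cases h0 : (j : ℕ) = 0
  · rw [if_pos h0, if_neg (by simp only [Finset.mem_filter_univ]; omega)]
  · rw [if_neg h0, if_pos (by simp only [Finset.mem_filter_univ]; omega)]

theorem tailProd_ne_zero {k : ℕ} {x : E n} (hx : ∀ j ∈ head n k, x j ≠ 0) : tailProd k x ≠ 0 :=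
  Finset.prod_ne_zero_iff.2 fun j hj => hx j (mem_head.2 (Finset.mem_filter.1 hj).2.2)

namespace LocalModel

variable {k : ℕ} (M : LocalModel n k)

/-- The function `q` is torus invariant. -/
theorem q_scaleCoord {x : E n} (hx : x ∈ regular n k M.R) {j : Fin (n + 1)} (hj : j ∈ head n k)
    (h0 : (0 : Fin (n + 1)) ∈ head n k) (θ : ℝ) :
    M.q (scaleCoord j (Complex.exp (θ * Complex.I)) x) = M.q x := by
  have hj' := mem_head.1 hj
  have hc : ‖Complex.exp (θ * Complex.I)‖ = 1 := Complex.norm_exp_ofReal_mul_I θ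
  have hxR : scaleCoord j (Complex.exp (θ * Complex.I)) x ∈ Metric.ball (0 : E n) M.R := by
    rw [mem_ball_zero_iff, norm_scaleCoord j hc]
    simpa using hx.1
  have hx0 : x 0 ≠ 0 := hx.2 0 h0
  have ht := tailProd_ne_zero hx.2
  have he := Complex.exp_ne_zero (θ * Complex.I)
  have h1 := M.equivariant (Pi.single ⟨j, hj'⟩ θ) x hx.1 hx0
  rw [rho_single, weight_single, M.factor x hx.1 hx0, M.factor _ hxR
    (by rw [scaleCoord_apply]; split_ifs <;> simp [hx0, he]), tailProd_scaleCoord j hj',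
    scaleCoord_apply] at h1
  by_cases hj0 : j = 0
  · subst hj0
    simp only [Fin.val_zero, if_true, Complex.ofReal_neg, mul_comm Complex.I, neg_mul,
      Complex.exp_neg] at h1
    generalize Complex.exp (θ * Complex.I) = e at *
    field_simp at h1
    exact h1
  · have hj0' : ¬ (j : ℕ) = 0 := fun h => hj0 (Fin.ext h)
    have hj0'' : ¬ 0 = j := fun h => hj0 h.symm
    simp only [hj0', hj0'', if_false, mul_comm Complex.I] at h1
    field_simp at h1
    exact h1

/-- The function `dlog` is the logarithmic derivative of `p`. -/
theorem fderiv_p {x : E n} (hx : x ∈ regular n k M.R) (h0 : (0 : Fin (n + 1)) ∈ head n k)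
    (v : E n) : fderiv ℝ M.p x v = M.p x * dlog M.q k x v := by
  have hx0 : x 0 ≠ 0 := hx.2 0 h0
  have hxd : x ∈ M.dom := ⟨hx.1, hx0⟩
  have hpd : DifferentiableAt ℝ M.p x :=
    (M.p_smooth.differentiableOn (by simp)).differentiableAt (M.isOpen_dom.mem_nhds hxd)
  have hqd : DifferentiableAt ℝ M.q x :=
    (M.q_smooth.differentiableOn (by simp)).differentiableAt (Metric.isOpen_ball.mem_nhds hx.1)
  have hq0 := M.q_ne_zero x hx.1
  have hp := hasDerivAt_line_comp x v hpd
  have hq := hasDerivAt_line_comp x v hqd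
  have hx0' : x + (0 : ℝ) • v = x := by simp
  have hev : (fun τ : ℝ => M.p (x + τ • v)) =ᶠ[nhds 0] fun τ =>
      (∏ j ∈ Finset.univ.filter (fun j : Fin (n + 1) => 0 < (j : ℕ) ∧ (j : ℕ) < k), (x + τ • v) j) /
        (x + τ • v) 0 * M.q (x + τ • v) := by
    have h1 : ∀ᶠ τ : ℝ in nhds 0, x + τ • v ∈ M.dom := by
      have : ContinuousAt (fun τ : ℝ => x + τ • v) 0 := (hasDerivAt_line x v).continuousAt
      exact this.eventually_mem (by rw [hx0']; exact M.isOpen_dom.mem_nhds hxd)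
    filter_upwards [h1] with τ hτ
    rw [M.factor _ hτ.1 hτ.2, tailProd]
  have hpx : M.p x ≠ 0 := by
    rw [M.factor x hx.1 hx0]
    exact mul_ne_zero (div_ne_zero (tailProd_ne_zero hx.2) hx0) hq0
  have hcd : ∀ j, DifferentiableAt ℝ (fun τ : ℝ => (x + τ • v) j) 0 := fun j =>
    (hasDerivAt_line_coord x v j).differentiableAt
  have hcl : ∀ j, logDeriv (fun τ : ℝ => (x + τ • v) j) 0 = v j / x j := fun j => by
    rw [logDeriv_apply, (hasDerivAt_line_coord x v j).deriv, hx0']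
  have hL : logDeriv (fun τ : ℝ => M.p (x + τ • v)) 0 = dlog M.q k x v := by
    have hhead : head n k = insert 0 (Finset.univ.filter
        fun j : Fin (n + 1) => 0 < (j : ℕ) ∧ (j : ℕ) < k) := by
      have hk := mem_head.1 h0
      ext j
      rw [Finset.mem_insert, mem_head, Finset.mem_filter_univ, Fin.ext_iff]
      simp only [Fin.val_zero] at hk ⊢
      omega
    have hin : ∀ j ∈ Finset.univ.filter (fun j : Fin (n + 1) => 0 < (j : ℕ) ∧ (j : ℕ) < k),
        (x + (0 : ℝ) • v) j ≠ 0 := fun j hj => by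
      rw [hx0']
      exact hx.2 j (mem_head.2 (Finset.mem_filter.1 hj).2.2)
    have hprod : DifferentiableAt ℝ (fun τ : ℝ => ∏ j ∈ Finset.univ.filter
        (fun j : Fin (n + 1) => 0 < (j : ℕ) ∧ (j : ℕ) < k), (x + τ • v) j) 0 :=
      DifferentiableAt.fun_finsetProd fun j _ => hcd j
    rw [(logDeriv_congr_nhds hev).self_of_nhds,
      logDeriv_mul (f := fun τ : ℝ => (∏ j ∈ Finset.univ.filter
        (fun j : Fin (n + 1) => 0 < (j : ℕ) ∧ (j : ℕ) < k), (x + τ • v) j) / (x + τ • v) 0)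
        (g := fun τ : ℝ => M.q (x + τ • v)) 0
        (div_ne_zero (Finset.prod_ne_zero_iff.2 hin) (by rwa [hx0'])) (by rwa [hx0'])
        (hprod.fun_div (hcd 0) (by rwa [hx0'])) hq.differentiableAt,
      logDeriv_div 0 (Finset.prod_ne_zero_iff.2 hin) (by rwa [hx0']) hprod (hcd 0),
      logDeriv_prod hin fun j _ => hcd j, hcl, dlog, hhead, Finset.sum_insert (by simp),
      logDeriv_apply, hq.deriv, hx0', kap, Finset.sum_congr rfl fun j _ => hcl j]
    have hs : ∑ j ∈ Finset.univ.filter (fun j : Fin (n + 1) => 0 < (j : ℕ) ∧ (j : ℕ) < k),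
        (sgn j : ℂ) * (v j / x j) = ∑ j ∈ Finset.univ.filter
          (fun j : Fin (n + 1) => 0 < (j : ℕ) ∧ (j : ℕ) < k), v j / x j := by
      refine Finset.sum_congr rfl fun j hj => ?_
      have := (Finset.mem_filter.1 hj).2.1.ne'
      simp [sgn, this]
    rw [hs, smul_apply, smul_eq_mul]
    simp only [sgn, Fin.val_zero, if_true]
    push_cast
    ring
  rw [logDeriv_apply, hp.deriv, hx0'] at hL
  rw [← hL]
  field_simp

end LocalModel

namespace LocalModel

variable {k : ℕ} (M : LocalModel n k)

theorem scaleCoord_mem_regular {ρ : ℝ} {x : E n} (hx : x ∈ regular n k ρ) (j : Fin (n + 1))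
    {c : ℂ} (hc : ‖c‖ = 1) : scaleCoord j c x ∈ regular n k ρ := by
  refine ⟨?_, fun i hi => ?_⟩
  · rw [mem_ball_zero_iff, norm_scaleCoord j hc]
    simpa using hx.1
  · have hc0 : c ≠ 0 := norm_pos_iff.1 (by rw [hc]; exact one_pos)
    rw [scaleCoord_apply]
    split_ifs
    · exact mul_ne_zero hc0 (hx.2 i hi)
    · exact hx.2 i hi

theorem differentiableAt_q {x : E n} (hx : x ∈ Metric.ball (0 : E n) M.R) :
    DifferentiableAt ℝ M.q x :=
  (M.q_smooth.differentiableOn (by simp)).differentiableAt (Metric.isOpen_ball.mem_nhds hx)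

/-- The logarithmic derivative of `q` vanishes in the directions of the torus action. -/
theorem kap_rotation {x : E n} (hx : x ∈ regular n k M.R) {j : Fin (n + 1)} (hj : j ∈ head n k)
    (h0 : (0 : Fin (n + 1)) ∈ head n k) :
    kap M.q x (EuclideanSpace.single j (Complex.I * x j)) = 0 := by
  have hexp : HasDerivAt (fun θ : ℝ => Complex.exp (θ * Complex.I)) Complex.I 0 := by
    have := ((Complex.ofRealCLM.hasDerivAt (x := (0 : ℝ))).mul_const Complex.I).cexp
    simpa using this
  have hcurve : HasDerivAt (fun θ : ℝ => scaleCoord j (Complex.exp (θ * Complex.I)) x)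
      (EuclideanSpace.single j (Complex.I * x j)) 0 := by
    rw [← hasDerivWithinAt_univ]
    refine hasDerivWithinAt_of_coord fun i => ?_
    simp only [scaleCoord_apply, PiLp.single_apply]
    split_ifs with hi
    · subst hi
      exact (hexp.mul_const (x i)).hasDerivWithinAt
    · exact hasDerivWithinAt_const _ _ _
  have hx' : scaleCoord j (Complex.exp (((0 : ℝ) : ℂ) * Complex.I)) x = x := by
    rw [scaleCoord_def]; simp
  have hq : HasFDerivAt M.q (fderiv ℝ M.q x)
      (scaleCoord j (Complex.exp (((0 : ℝ) : ℂ) * Complex.I)) x) := by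
    rw [hx']; exact (M.differentiableAt_q hx.1).hasFDerivAt
  have h1 := hq.comp_hasDerivAt (0 : ℝ) hcurve
  have h2 : (M.q ∘ fun θ : ℝ => scaleCoord j (Complex.exp (θ * Complex.I)) x) =
      fun _ => M.q x := funext fun θ => M.q_scaleCoord hx hj h0 θ
  rw [h2] at h1
  rw [kap, smul_apply, h1.unique (hasDerivAt_const _ _), smul_zero]

/-- The logarithmic derivative of `q` is odd under the reflection of a head coordinate. -/
theorem kap_reflection {x : E n} (hx : x ∈ regular n k M.R) {j : Fin (n + 1)} (hj : j ∈ head n k)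
    (h0 : (0 : Fin (n + 1)) ∈ head n k) (w : ℂ) :
    kap M.q (scaleCoord j (-1) x) (EuclideanSpace.single j w) =
      -kap M.q x (EuclideanSpace.single j w) := by
  have hc : ‖(-1 : ℂ)‖ = 1 := by simp
  have hq : ∀ z ∈ regular n k M.R, M.q (scaleCoord j (-1) z) = M.q z := fun z hz => by
    have := M.q_scaleCoord hz hj h0 Real.pi
    rwa [Complex.exp_pi_mul_I] at this
  have hx' := scaleCoord_mem_regular hx j hc
  have h1 : HasFDerivAt (fun z => M.q (scaleCoord j (-1) z))
      ((fderiv ℝ M.q (scaleCoord j (-1) x)).comp (scaleCoord j (-1))) x :=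
    ((M.differentiableAt_q hx'.1).hasFDerivAt).comp x (scaleCoord j (-1)).hasFDerivAt
  have h2 := h1.congr_of_eventuallyEq (f₁ := M.q) (Filter.eventually_of_mem
    ((isOpen_regular k M.R).mem_nhds hx) fun z hz => (hq z hz).symm)
  have h3 := h2.fderiv
  have h4 : scaleCoord j (-1) (EuclideanSpace.single j w : E n) = -EuclideanSpace.single j w := by
    ext i
    rw [scaleCoord_apply]
    by_cases h : i = j <;> simp [h]
  rw [kap, kap, hq x hx, h3, smul_apply, smul_apply, ContinuousLinearMap.comp_apply, h4, map_neg,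
    smul_neg, neg_neg]

/-- By compactness, `q` is controlled on a small ball. The estimate `kap_head` follows from the mean
value inequality on the segment from `x` to its reflection in the `j`-th coordinate, as the
component of `kap q` in this coordinate is odd. -/
theorem exists_isControlled (hk : 0 < k) :
    ∃ ρ C : ℝ, 0 < ρ ∧ ρ < M.R ∧ IsControlled M.q k ρ C := by
  have h0 : (0 : Fin (n + 1)) ∈ head n k := mem_head.2 hk
  have hR := M.R_pos
  set r := min (M.R / 2) 1 with hr
  have hr0 : 0 < r := by positivity
  have hrR : r < M.R := (min_le_left _ _).trans_lt (by linarith)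
  have hsub : Metric.closedBall (0 : E n) r ⊆ Metric.ball 0 M.R := Metric.closedBall_subset_ball hrR
  have hκ : ContDiffOn ℝ ∞ (kap M.q) (Metric.ball 0 M.R) := kap_contDiffOn M.q_smooth M.q_ne_zero
  have hκ' : ContDiffOn ℝ ∞ (fderiv ℝ (kap M.q)) (Metric.ball 0 M.R) :=
    hκ.fderiv_of_isOpen Metric.isOpen_ball (by simp)
  obtain ⟨C₁, hC₁⟩ := (isCompact_closedBall (0 : E n) r).exists_bound_of_continuousOn
    (hκ.continuousOn.mono hsub)
  obtain ⟨C₂, hC₂⟩ := (isCompact_closedBall (0 : E n) r).exists_bound_of_continuousOn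
    (f := fderiv ℝ (kap M.q)) (hκ'.continuousOn.mono hsub)
  set C := max 1 (max C₁ C₂) with hC
  have hC1 : 1 ≤ C := le_max_left _ _
  set a : ℝ := 2 * (3 * (n + 1) * C ^ 2) with ha
  have ha0 : 0 < a := by positivity
  set ρ := min r a⁻¹ with hρ
  have hρ0 : 0 < ρ := by positivity
  have hρr : ρ ≤ r := min_le_left _ _
  have hball : Metric.ball (0 : E n) ρ ⊆ Metric.closedBall 0 r :=
    (Metric.ball_subset_ball hρr).trans Metric.ball_subset_closedBall
  have hreg : regular n k ρ ⊆ regular n k M.R := fun x hx => ⟨hsub (hball hx.1), hx.2⟩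
  have hκC : ∀ x ∈ Metric.ball (0 : E n) ρ, ‖fderiv ℝ (kap M.q) x‖ ≤ C := fun x hx =>
    (hC₂ x (hball hx)).trans ((le_max_right _ _).trans (le_max_right _ _))
  refine ⟨ρ, C, hρ0, hρr.trans_lt hrR, hk, hC1, M.q_smooth.mono (hball.trans hsub),
    fun x hx => M.q_ne_zero x (hsub (hball hx)), fun x hx j hj => M.kap_rotation (hreg hx) hj h0,
    fun x hx => (hC₁ x (hball hx)).trans ((le_max_left _ _).trans (le_max_right _ _)), hκC, ?_,
    hρr.trans (min_le_right _ _), ?_⟩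
  · intro x hx j hj w
    have hx' := scaleCoord_mem_regular hx j (c := -1) (by simp)
    have h1 := M.kap_reflection (hreg hx) hj h0 w
    have h2 : ‖kap M.q x - kap M.q (scaleCoord j (-1) x)‖ ≤ C * ‖x - scaleCoord j (-1) x‖ :=
      (convex_ball (0 : E n) ρ).norm_image_sub_le_of_norm_fderiv_le (fun z hz =>
        (hκ.differentiableOn (by simp)).differentiableAt
          (Metric.isOpen_ball.mem_nhds (hsub (hball hz)))) hκC hx'.1 hx.1
    have h3 : ‖x - scaleCoord j (-1) x‖ = 2 * ‖x j‖ := by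
      rw [scaleCoord_def, sub_add_cancel_left, norm_neg, norm_single, norm_mul]
      norm_num
    have h4 := (kap M.q x - kap M.q (scaleCoord j (-1) x)).le_of_opNorm_le h2
      (EuclideanSpace.single j w)
    rw [sub_apply, h1, sub_neg_eq_add, ← two_mul, norm_mul, h3, norm_single,
      Complex.norm_ofNat] at h4
    linarith
  · have h1 : ρ ≤ 1 := hρr.trans (min_le_right _ _)
    have h2 : ρ ≤ a⁻¹ := min_le_right _ _
    calc a * ρ ^ 2 = a * (ρ * ρ) := by ring
      _ ≤ a * (a⁻¹ * 1) := by gcongr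
      _ = 1 := by field_simp

end LocalModel

/-! ### Parallel transport -/

namespace LocalModel

variable {k : ℕ} (M : LocalModel n k) {ρ C T : ℝ} {x : E n}

theorem regular_subset {ρ ρ' : ℝ} (h : ρ ≤ ρ') : regular n k ρ ⊆ regular n k ρ' :=
  fun _ hx => ⟨Metric.ball_subset_ball h hx.1, hx.2⟩

theorem p_ne_zero (hx : x ∈ regular n k M.R) (h0 : (0 : Fin (n + 1)) ∈ head n k) : M.p x ≠ 0 := by
  rw [M.factor x hx.1 (hx.2 0 h0)]
  exact mul_ne_zero (div_ne_zero (tailProd_ne_zero hx.2) (hx.2 0 h0)) (M.q_ne_zero x hx.1)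

theorem mem_dom (hx : x ∈ regular n k M.R) (h0 : (0 : Fin (n + 1)) ∈ head n k) : x ∈ M.dom :=
  ⟨hx.1, hx.2 0 h0⟩

theorem differentiableAt_p (hx : x ∈ M.dom) : DifferentiableAt ℝ M.p x :=
  (M.p_smooth.differentiableOn (by simp)).differentiableAt (M.isOpen_dom.mem_nhds hx)

theorem fderiv_p_field (hρ : ρ ≤ M.R) (h : IsControlled M.q k ρ C) (hx : x ∈ regular n k ρ) :
    fderiv ℝ M.p x (field M.q k x) = -Complex.I * M.p x := by
  rw [M.fderiv_p (regular_subset hρ hx) h.zero_mem_head,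
    dlog_field hx.2 (h.rot x hx) (h.denom_pos hx).ne', mul_comm]

theorem omega_field_eq_zero (hρ : ρ ≤ M.R) (h : IsControlled M.q k ρ C) (hx : x ∈ regular n k ρ)
    {v : E n} (hv : fderiv ℝ M.p x v = 0) : omega (field M.q k x) v = 0 := by
  have hxR := regular_subset hρ hx
  rw [M.fderiv_p hxR h.zero_mem_head] at hv
  rw [omega_field hx.2 (h.rot x hx),
    (mul_eq_zero.1 hv).resolve_left (M.p_ne_zero hxR h.zero_mem_head)]
  simp

/-- Horizontal curves lie over circles `|ζ| = const`. -/
theorem p_orbit (hρ : ρ ≤ M.R) (h : IsControlled M.q k ρ C) {x : ℝ → E n}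
    (hx : IsOrbit M.q k ρ T x) {t : ℝ} (ht : t ∈ Set.Icc 0 T) :
    M.p (x t) = Complex.exp (-(t * Complex.I)) * M.p (x 0) := by
  have hd : ∀ t ∈ Set.Icc 0 T, HasDerivWithinAt
      (fun τ : ℝ => Complex.exp (τ * Complex.I) * M.p (x τ)) 0 (Set.Icc 0 T) t := by
    intro t ht
    have hdom := M.mem_dom (regular_subset hρ (hx.mem t ht)) h.zero_mem_head
    have h1 := (M.differentiableAt_p hdom).hasFDerivAt.comp_hasDerivWithinAt t (hx.deriv t ht)
    rw [M.fderiv_p_field hρ h (hx.mem t ht)] at h1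
    have h2 := (((Complex.ofRealCLM.hasDerivWithinAt (x := t) (s := Set.Icc 0 T)).mul_const
      Complex.I).cexp).mul h1
    refine h2.congr_deriv ?_
    simp
    ring
  have h1 := eq_of_hasDerivWithinAt_zero hd t ht
  simp only [Complex.ofReal_zero, zero_mul, Complex.exp_zero, one_mul] at h1
  rw [← h1, ← mul_assoc, ← Complex.exp_add]
  simp

variable {U : Set (E n)} {ψ : ℝ → E n → E n}

theorem isParallelTransport (hρ : ρ ≤ M.R) (h : IsControlled M.q k ρ C)
    (hψ : IsLocalFlow M.q k ρ T U ψ) : M.IsParallelTransport T U ψ where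
  zero := hψ.zero
  mem t ht x hx := M.mem_dom (regular_subset hρ ((hψ.orbit x hx).mem t ht)) h.zero_mem_head
  smooth := hψ.smooth
  flow t ht x hx := by
    have hm := (hψ.orbit x hx).mem t ht
    exact ⟨_, ⟨M.fderiv_p_field hρ h hm, fun v hv => M.omega_field_eq_zero hρ h hm hv⟩,
      (hψ.orbit x hx).deriv t ht⟩

/-- As `p ∘ ψ t = exp (-i t) p`, the linearized flow preserves the tangent spaces of the fibres, and
it preserves `d log p`; see `dlog_flow`. -/
theorem fderiv_p_flow (hρ : ρ ≤ M.R) (h : IsControlled M.q k ρ C)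
    (hψ : IsLocalFlow M.q k ρ T U ψ) (hx : x ∈ U) {t : ℝ} (ht : t ∈ Set.Icc 0 T) (v : E n) :
    fderiv ℝ M.p (ψ t x) (fderiv ℝ (ψ t) x v) =
      Complex.exp (-(t * Complex.I)) * fderiv ℝ M.p x v := by
  have h0 := h.zero_mem_head
  have hnhds := hψ.isOpen.mem_nhds hx
  have hm : ∀ z ∈ U, ∀ t ∈ Set.Icc 0 T, ψ t z ∈ M.dom := fun z hz t ht =>
    M.mem_dom (regular_subset hρ ((hψ.orbit z hz).mem t ht)) h0
  have hxd : x ∈ M.dom := by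
    have := hm x hx 0 ⟨le_rfl, ht.1.trans ht.2⟩
    rwa [hψ.zero x hx] at this
  have h1 := (M.differentiableAt_p (hm x hx t ht)).hasFDerivAt.comp x
    (((hψ.smooth t ht).differentiableOn (by simp)).differentiableAt hnhds).hasFDerivAt
  have h2 : (fun z => Complex.exp (-(t * Complex.I)) * M.p z) =ᶠ[nhds x] M.p ∘ ψ t :=
    Filter.eventually_of_mem hnhds fun z hz => by
      have := M.p_orbit hρ h (hψ.orbit z hz) ht
      rw [hψ.zero z hz] at this
      exact this.symm
  have h3 := ((M.differentiableAt_p hxd).hasFDerivAt.const_mul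
    (Complex.exp (-(t * Complex.I)))).unique (h1.congr_of_eventuallyEq h2)
  have h4 := congrArg (fun l : E n →L[ℝ] ℂ => l v) h3
  simpa using h4.symm

theorem dlog_flow (hρ : ρ ≤ M.R) (h : IsControlled M.q k ρ C)
    (hψ : IsLocalFlow M.q k ρ T U ψ) (hx : x ∈ U) {t : ℝ} (ht : t ∈ Set.Icc 0 T) (v : E n) :
    dlog M.q k (ψ t x) (fderiv ℝ (ψ t) x v) = dlog M.q k x v := by
  have h0 := h.zero_mem_head
  have h0T : (0 : ℝ) ∈ Set.Icc 0 T := ⟨le_rfl, ht.1.trans ht.2⟩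
  have hxr : x ∈ regular n k M.R := by
    have := regular_subset hρ ((hψ.orbit x hx).mem 0 h0T)
    rwa [hψ.zero x hx] at this
  have h1 := M.fderiv_p_flow hρ h hψ hx ht v
  have h2 := M.p_orbit hρ h (hψ.orbit x hx) ht
  rw [hψ.zero x hx] at h2
  rw [M.fderiv_p (regular_subset hρ ((hψ.orbit x hx).mem t ht)) h0, M.fderiv_p hxr h0, h2,
    mul_assoc] at h1
  exact mul_left_cancel₀ (M.p_ne_zero hxr h0) (mul_left_cancel₀ (Complex.exp_ne_zero _) h1)

end LocalModel

/-! ### The graded phase along the flow -/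

namespace LocalModel

variable {k : ℕ} (M : LocalModel n k) {ρ C T : ℝ}

/-- The form on the fibres in terms of the extension `Θ` of `y_2 ⋯ y_k η_Y`. -/
theorem fiberForm_eq_extension {Θ : E n → Form n} {x : E n} (hx : x ∈ regular n k M.R)
    (h0 : (0 : Fin (n + 1)) ∈ head n k) (hΘ : Θ x = tailProd k x • M.η x)
    {w : Fin (n + 1) → E n} {c : ℝ} (hc : c ≠ 0)
    (hw0 : fderiv ℝ M.p x (w 0) = c * (-Complex.I * M.p x))
    (hw : ∀ i : Fin n, fderiv ℝ M.p x (w i.succ) = 0) :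
    M.fiberForm x (fun i => w i.succ) = Complex.I / c * (M.q x * Θ x w / x 0) := by
  have hp := M.p_ne_zero hx h0
  have hx0 := hx.2 0 h0
  have hc' : (c : ℂ) ≠ 0 := by exact_mod_cast hc
  have hw0' : fderiv ℝ M.p x (w 0) ≠ 0 := by
    rw [hw0]
    exact mul_ne_zero hc' (mul_ne_zero (neg_ne_zero.2 Complex.I_ne_zero) hp)
  have hcons : Matrix.vecCons (w 0) (fun i => w i.succ) = w := Fin.cons_self_tail w
  rw [M.fiberForm_eq (M.mem_dom hx h0) hp hw0' hw, hcons, hw0, hΘ,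
    ContinuousAlternatingMap.smul_apply, smul_eq_mul]
  have h1 : M.p x ^ 2 * M.η x w / (c * (-Complex.I * M.p x)) =
      Complex.I / c * (M.p x * M.η x w) := by
    field_simp
    rw [Complex.I_sq]
    ring
  rw [h1, M.factor x hx.1 hx0]
  ring

theorem linearIndependent_of_fiberForm_ne_zero {x : E n} {v : Fin n → E n}
    (h : M.fiberForm x v ≠ 0) : LinearIndependent ℝ v := by
  by_contra hli
  apply h
  rw [fiberForm]
  have h1 : ¬ LinearIndependent ℝ (Matrix.vecCons
      (Classical.epsilon fun w => fderiv ℝ M.p x w ≠ 0) v) := fun h2 =>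
    hli (h2.comp Fin.succ (Fin.succ_injective n))
  have h2 := (M.η x).toAlternatingMap.map_linearDependent _ h1
  rw [ContinuousAlternatingMap.coe_toAlternatingMap] at h2
  rw [h2]
  simp

/-- The phase of the image of `Λ` can be computed from the image of a basis. That this image is
again a basis is implied by the value of the form on it being nonzero. -/
theorem phase_map {x : E n} {Λ : Submodule ℝ (E n)} (e : Module.Basis (Fin n) ℝ Λ)
    (f : E n →ₗ[ℝ] E n) (h : M.fiberForm x (fun i => f (e i)) ≠ 0) :
    M.phase x (Λ.map f) = M.fiberForm x (fun i => f (e i)) ^ 2 /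
      (‖M.fiberForm x (fun i => f (e i))‖ : ℂ) ^ 2 := by
  have hli := M.linearIndependent_of_fiberForm_ne_zero h
  let v : Fin n → Λ.map f := fun i => ⟨f (e i), Submodule.mem_map_of_mem (e i).2⟩
  have hv : LinearIndependent ℝ v := LinearIndependent.of_comp (Λ.map f).subtype hli
  have hspan : ⊤ ≤ Submodule.span ℝ (Set.range v) := by
    rintro ⟨_, u, hu, rfl⟩ -
    have h1 := e.sum_repr ⟨u, hu⟩
    have h2 : (⟨f u, Submodule.mem_map_of_mem hu⟩ : Λ.map f) = ∑ i, e.repr ⟨u, hu⟩ i • v i := by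
      apply Subtype.ext
      have h3 := congrArg (fun z : Λ => f z) h1
      simp only [Submodule.coe_sum, Submodule.coe_smul, map_sum, map_smul] at h3
      simp only [Submodule.coe_sum, Submodule.coe_smul, v]
      exact h3.symm
    exact h2 ▸ Submodule.sum_mem _ fun i _ =>
      Submodule.smul_mem _ _ (Submodule.subset_span ⟨i, rfl⟩)
  have h1 := M.phase_eq x (Λ.map f) (Module.Basis.mk hv hspan)
  simpa only [Module.Basis.mk_apply] using h1

/-- If the argument of the form changes by `π θ`, the graded phase changes by `θ`, because the phase
is the square of the unit complex number in the direction of the form. -/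
theorem phase_quotient_eq {F G : ℂ} {r θ : ℝ} (hr : 0 < r) (hG : G ≠ 0)
    (h : F = r * Complex.exp (Real.pi * θ * Complex.I) * G) :
    Complex.exp (2 * Real.pi * Complex.I * θ) =
      F ^ 2 / (‖F‖ : ℂ) ^ 2 / (G ^ 2 / (‖G‖ : ℂ) ^ 2) := by
  have h1 : ‖Complex.exp (Real.pi * θ * Complex.I)‖ = 1 := by
    rw [← Complex.ofReal_mul, Complex.norm_exp_ofReal_mul_I]
  have hr' : (r : ℂ) ≠ 0 := by exact_mod_cast hr.ne'
  have hG' : (‖G‖ : ℂ) ≠ 0 := by exact_mod_cast (norm_ne_zero_iff.2 hG)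
  rw [h, norm_mul, norm_mul, h1, Complex.norm_real, Real.norm_eq_abs, abs_of_pos hr,
    show 2 * Real.pi * Complex.I * (θ : ℂ) =
      Real.pi * θ * Complex.I + Real.pi * θ * Complex.I by ring, Complex.exp_add]
  push_cast
  field_simp

variable {U : Set (E n)} {ψ : ℝ → E n → E n} {y : E n}

theorem fderiv_flow_zero {q : E n → ℂ} (hψ : IsLocalFlow q k ρ T U ψ) (hy : y ∈ U)
    (v : E n) : fderiv ℝ (ψ 0) y v = v := by
  have h1 : ψ 0 =ᶠ[nhds y] id :=
    Filter.eventually_of_mem (hψ.isOpen.mem_nhds hy) fun x hx => hψ.zero x hx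
  rw [h1.fderiv_eq, fderiv_id]
  rfl

/-- The graded phase is computed from a unitary frame of the Lagrangian subspace spanned by `Λ` and
the horizontal field. The determinant of the frame transported by the flow is the product of three
factors: the contribution of the rotations of the coordinates, the determinant of the frame
transported by a shear, whose argument changes by at most `(n + 1) π`, and a factor close to
one. -/
theorem exists_isGradedPhase {Θ : E n → Form n} (hT : 0 ≤ T) (hρ : ρ ≤ M.R)
    (h : IsControlled M.q k ρ C) (hψ : IsLocalFlow M.q k ρ T U ψ) (hy : y ∈ U)
    (hΘc : ContinuousOn Θ (Metric.ball 0 M.R))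
    (hΘ : ∀ x ∈ Metric.ball (0 : E n) M.R, tailProd k x ≠ 0 → Θ x = tailProd k x • M.η x)
    {s : ℝ → Fin (n + 1) → ℝ} (hs0 : s 0 = 0)
    (hsc : ∀ j, ContinuousOn (fun t => s t j) (Set.Icc 0 T))
    (hsx : ∀ t ∈ Set.Icc 0 T, ψ t y 0 = Complex.exp (s t 0 * Complex.I) * y 0)
    {ε₁ ε₂ δ c₀ : ℝ} (hδ : ∀ t ∈ Set.Icc 0 T, ‖ψ t y‖ < δ)
    (hlin : ∀ v, (dlog M.q k y v).re = 0 → ‖v‖ = 1 → ∀ t ∈ Set.Icc 0 T,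
      ‖rotate (-s t) (fderiv ℝ (ψ t) y v) -
        (v + t • shear (unitCoord y) (symCoeff k y) v)‖ ≤ δ)
    (hform : ∀ x : E n, ‖x‖ < δ → ∀ w w' : Fin (n + 1) → E n,
      (∀ i, ‖w i‖ ≤ 1 + T * (6 * (n + 1) ^ 2)) → (∀ i, ‖w' i - w i‖ ≤ δ) →
      c₀ ≤ ‖frameDet w‖ → ‖M.q x * Θ x w' / frameDet w - 1‖ < ε₁)
    (harg : ∀ z : ℂ, ‖z - 1‖ < ε₁ → z ∈ Complex.slitPlane ∧ |Complex.arg z| < ε₂)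
    (hc₀ : 0 < c₀) (hdet : ∀ (V : Fin (n + 1) → E n) (t : ℝ), IsUnitaryFrame V → t ∈ Set.Icc 0 T →
      c₀ ≤ ‖frameDet (fun i => V i + t • shear (unitCoord y) (symCoeff k y) (V i))‖)
    {Λ : Submodule ℝ (E n)} (hΛ : M.IsLagrangian y Λ) :
    ∃ a, M.IsGradedPhase T ψ y Λ a ∧
      Real.pi * a ≤ ∑ j ∈ Finset.univ.erase 0, s T j + (n + 1) * Real.pi + 2 * ε₂ := by
  have h0T : (0 : ℝ) ∈ Set.Icc 0 T := ⟨le_rfl, hT⟩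
  have hTT : T ∈ Set.Icc 0 T := ⟨hT, le_rfl⟩
  have h0 := h.zero_mem_head
  have horb := hψ.orbit y hy
  have hyρ : y ∈ regular n k ρ := by
    have := horb.mem 0 h0T
    rwa [hψ.zero y hy] at this
  have hyR := regular_subset hρ hyρ
  have hxR : ∀ t ∈ Set.Icc 0 T, ψ t y ∈ regular n k M.R := fun t ht =>
    regular_subset hρ (horb.mem t ht)
  have hpy := M.p_ne_zero hyR h0
  -- A unitary frame adapted to `Λ` and the horizontal field.
  set z := field M.q k y with hz
  have hDz : fderiv ℝ M.p y z = -Complex.I * M.p y := M.fderiv_p_field hρ h hyρ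
  obtain ⟨V, c, e, hc, hV, ⟨l, hl, hV0⟩, hVs⟩ := exists_unitaryFrame hΛ.finrank_eq hΛ.isotropic
    (z := z) (fun v hv => M.omega_field_eq_zero hρ h hyρ (hΛ.tangent v hv)) (fun hzΛ => by
      have h1 := hΛ.tangent z hzΛ
      rw [hDz] at h1
      exact mul_ne_zero (neg_ne_zero.2 Complex.I_ne_zero) hpy h1)
  have hDV0 : fderiv ℝ M.p y (V 0) = c * (-Complex.I * M.p y) := by
    rw [hV0, map_smul, map_add, hDz, hΛ.tangent l hl, add_zero, Complex.real_smul]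
  have hDVs : ∀ i : Fin n, fderiv ℝ M.p y (V i.succ) = 0 := fun i => by
    rw [hVs]; exact hΛ.tangent _ (e i).2
  have hdlog : ∀ i, (dlog M.q k y (V i)).re = 0 := fun i => by
    have h1 : dlog M.q k y (V i) = fderiv ℝ M.p y (V i) / M.p y := by
      rw [M.fderiv_p hyR h0, mul_div_cancel_left₀ _ hpy]
    rw [h1]
    refine Fin.cases ?_ (fun i => ?_) i
    · rw [hDV0, ← mul_assoc, mul_div_cancel_right₀ _ hpy]; simp
    · rw [hDVs]; simp
  set N := shear (unitCoord y) (symCoeff k y) with hN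
  set w : ℝ → Fin (n + 1) → E n := fun t i => fderiv ℝ (ψ t) y (V i) with hw
  set W : ℝ → Fin (n + 1) → E n := fun t i => V i + t • N (V i) with hW
  have hw0 : w 0 = V := funext fun i => fderiv_flow_zero hψ hy _
  have hW0 : W 0 = V := funext fun i => by simp [hW]
  -- The factor of the determinant of the transported frame which is close to one.
  set Ef : ℝ → ℂ := fun t => M.q (ψ t y) * Θ (ψ t y) (w t) /
    frameDet (fun i => rotate (s t) (W t i)) with hEf
  have hdetW : ∀ t ∈ Set.Icc 0 T, c₀ ≤ ‖frameDet (fun i => rotate (s t) (W t i))‖ := fun t ht => by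
    rw [frameDet_rotate, norm_mul, Complex.norm_exp_ofReal_mul_I, one_mul]
    exact hdet V t hV ht
  have hdetW0 : ∀ t ∈ Set.Icc 0 T, frameDet (fun i => rotate (s t) (W t i)) ≠ 0 := fun t ht =>
    norm_pos_iff.1 (hc₀.trans_le (hdetW t ht))
  have hEclose : ∀ t ∈ Set.Icc 0 T, Ef t ∈ Complex.slitPlane ∧ |Complex.arg (Ef t)| < ε₂ := by
    intro t ht
    refine harg _ (hform _ (hδ t ht) _ _ (fun i => ?_) (fun i => ?_) (hdetW t ht))
    · rw [norm_rotate]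
      refine (norm_add_le _ _).trans ?_
      rw [hV.norm_eq, norm_smul, Real.norm_eq_abs, abs_of_nonneg ht.1]
      have h1 := h.norm_shear_symCoeff_le hyρ (V i)
      rw [hV.norm_eq, mul_one] at h1
      gcongr
      exact ht.2
    · have h1 := hlin (V i) (hdlog i) (hV.norm_eq i) t ht
      have h2 : w t i - rotate (s t) (W t i) = rotate (s t) (rotate (-s t) (w t i) - W t i) := by
        rw [rotate_sub, rotate_rotate_neg]
      rw [h2, norm_rotate]
      exact h1
  have hEc : ContinuousOn Ef (Set.Icc 0 T) := by
    have hmaps : Set.MapsTo (fun t => ψ t y) (Set.Icc 0 T) (Metric.ball 0 M.R) :=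
      fun t ht => (hxR t ht).1
    have hwc : ContinuousOn w (Set.Icc 0 T) := continuousOn_pi.2 fun i t ht =>
      (hψ.variation y hy (V i) t ht).continuousWithinAt
    have h1 : ContinuousOn (fun t => M.q (ψ t y)) (Set.Icc 0 T) :=
      M.q_smooth.continuousOn.comp horb.continuousOn hmaps
    have h2 : ContinuousOn (fun t => Θ (ψ t y) (w t)) (Set.Icc 0 T) :=
      (hΘc.comp horb.continuousOn hmaps).eval hwc
    refine (h1.mul h2).div ?_ hdetW0
    refine continuous_frameDet.comp_continuousOn (continuousOn_pi.2 fun i => ?_)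
    refine (PiLp.continuous_toLp 2 _).comp_continuousOn (continuousOn_pi.2 fun j => ?_)
    refine ContinuousOn.mul ?_ ?_
    · exact Complex.continuous_exp.comp_continuousOn
        ((Complex.continuous_ofReal.comp_continuousOn (hsc j)).mul continuousOn_const)
    · have h3 : Continuous fun t : ℝ => (V i + t • N (V i)) j := by fun_prop
      exact h3.continuousOn
  obtain ⟨φ, hφc, hφ0, hφb, hφ⟩ := exists_arg_frameDet_shear hV (unitCoord y)
    (symCoeff_comm k y) T
  -- The forms on the fibres.
  have hF : ∀ t ∈ Set.Icc 0 T, M.fiberForm (ψ t y) (fun i => w t i.succ) =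
      Complex.I / c * (M.q (ψ t y) * Θ (ψ t y) (w t) / ψ t y 0) := by
    intro t ht
    have hpt := M.p_orbit hρ h horb ht
    rw [hψ.zero y hy] at hpt
    refine M.fiberForm_eq_extension (hxR t ht) h0
      (hΘ _ (hxR t ht).1 (tailProd_ne_zero (hxR t ht).2)) hc.ne' ?_ fun i => ?_
    · rw [hw, M.fderiv_p_flow hρ h hψ hy ht, hDV0, hpt]
      ring
    · rw [hw, M.fderiv_p_flow hρ h hψ hy ht, hDVs, mul_zero]
  have hqΘ : ∀ t ∈ Set.Icc 0 T, M.q (ψ t y) * Θ (ψ t y) (w t) =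
      Ef t * frameDet (fun i => rotate (s t) (W t i)) := fun t ht =>
    (div_mul_cancel₀ _ (hdetW0 t ht)).symm
  have hE0 : ∀ t ∈ Set.Icc 0 T, Ef t ≠ 0 := fun t ht =>
    Complex.slitPlane_ne_zero (hEclose t ht).1
  have hFne : ∀ t ∈ Set.Icc 0 T, M.fiberForm (ψ t y) (fun i => w t i.succ) ≠ 0 := by
    intro t ht
    rw [hF t ht, hqΘ t ht]
    have hc' : (c : ℂ) ≠ 0 := by exact_mod_cast hc.ne'
    exact mul_ne_zero (div_ne_zero Complex.I_ne_zero hc')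
      (div_ne_zero (mul_ne_zero (hE0 t ht) (hdetW0 t ht)) ((hxR t ht).2 0 h0))
  set G := M.fiberForm y (fun i => (e i : E n)) with hG
  have hG0 : M.fiberForm (ψ 0 y) (fun i => w 0 i.succ) = G := by
    rw [hw0, hψ.zero y hy, hG]
    simp only [hVs]
  have hGne : G ≠ 0 := hG0 ▸ hFne 0 h0T
  have hphase0 : M.phase y Λ = G ^ 2 / (‖G‖ : ℂ) ^ 2 := M.phase_eq y Λ e
  have hphase : ∀ t ∈ Set.Icc 0 T, M.phase (ψ t y) (Λ.map (fderiv ℝ (ψ t) y).toLinearMap) =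
      M.fiberForm (ψ t y) (fun i => w t i.succ) ^ 2 /
        (‖M.fiberForm (ψ t y) (fun i => w t i.succ)‖ : ℂ) ^ 2 := by
    intro t ht
    have e1 : (fun i => w t i.succ) = fun i => (fderiv ℝ (ψ t) y).toLinearMap (e i) :=
      funext fun i => by rw [hw, ← hVs]; rfl
    have h1 := hFne t ht
    rw [e1] at h1 ⊢
    exact M.phase_map e _ h1
  -- The form on the fibre contains the factor `1 / y_1`, which cancels the rotation of `y_1`.
  set θ : ℝ → ℝ := fun t => Real.pi⁻¹ * (∑ j ∈ Finset.univ.erase 0, s t j + φ t +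
    (Complex.arg (Ef t) - Complex.arg (Ef 0))) with hθ
  refine ⟨θ T, ⟨θ, ?_, ?_, rfl, fun t ht => ⟨?_, ?_⟩⟩, ?_⟩
  · have h1 : ContinuousOn (fun t => Complex.arg (Ef t)) (Set.Icc 0 T) := fun t ht =>
      (Complex.continuousAt_arg (hEclose t ht).1).comp_continuousWithinAt (hEc t ht)
    exact continuousOn_const.mul (((continuousOn_finsetSum _ fun j _ => hsc j).add hφc).add
      (h1.sub continuousOn_const))
  · simp [hθ, hs0, hφ0]
  · rw [hphase0]
    have : (‖G‖ : ℂ) ≠ 0 := by exact_mod_cast (norm_ne_zero_iff.2 hGne)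
    exact div_ne_zero (pow_ne_zero 2 hGne) (pow_ne_zero 2 this)
  · rw [hphase t ht, hphase0]
    obtain ⟨r, hr, hrφ⟩ := hφ t ht
    have hn0 : 0 < ‖Ef 0‖ := norm_pos_iff.2 (hE0 0 h0T)
    have hnt : 0 < ‖Ef t‖ := norm_pos_iff.2 (hE0 t ht)
    refine phase_quotient_eq (r := r * ‖Ef t‖ / ‖Ef 0‖) (by positivity) hGne ?_
    rw [← hG0, hF t ht, hF 0 h0T, hqΘ t ht, hqΘ 0 h0T, frameDet_rotate, frameDet_rotate, hW0,
      hsx t ht, hψ.zero y hy, hs0]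
    have hWt : frameDet (W t) = r * Complex.exp (φ t * Complex.I) * frameDet V := hrφ
    rw [hWt]
    have hsum : (∑ j, s t j) = s t 0 + ∑ j ∈ Finset.univ.erase 0, s t j :=
      (Finset.add_sum_erase _ _ (Finset.mem_univ _)).symm
    have hπθ : (Real.pi : ℂ) * (θ t : ℂ) * Complex.I =
        ((∑ j ∈ Finset.univ.erase 0, s t j : ℝ) : ℂ) * Complex.I + φ t * Complex.I +
          (Complex.arg (Ef t) * Complex.I - Complex.arg (Ef 0) * Complex.I) := by
      have hπ : (Real.pi : ℂ) ≠ 0 := by exact_mod_cast Real.pi_ne_zero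
      simp only [hθ]
      push_cast
      field_simp
    rw [hπθ, hsum, Complex.exp_add, Complex.exp_add, Complex.exp_sub, Complex.ofReal_add, add_mul,
      Complex.exp_add]
    conv_lhs => rw [← Complex.norm_mul_exp_arg_mul_I (Ef t)]
    have hE0' := Complex.norm_mul_exp_arg_mul_I (Ef 0)
    have hy0 : y 0 ≠ 0 := hyR.2 0 h0
    have hn0' : (‖Ef 0‖ : ℂ) ≠ 0 := by exact_mod_cast hn0.ne'
    have hc' : (c : ℂ) ≠ 0 := by exact_mod_cast hc.ne'
    simp only [Pi.zero_apply, Finset.sum_const_zero, Complex.ofReal_zero, zero_mul,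
      Complex.exp_zero, one_mul]
    have he1 := Complex.exp_ne_zero (s t 0 * Complex.I)
    have he2 := Complex.exp_ne_zero (Complex.arg (Ef 0) * Complex.I)
    generalize Complex.arg (Ef 0) = a₀ at *
    generalize ‖Ef 0‖ = m₀ at *
    rw [← hE0']
    push_cast
    field_simp
  · have h1 := (abs_lt.1 (hEclose T hTT).2).2
    have h2 := (abs_lt.1 (hEclose 0 h0T).2).1
    have h3 := (abs_le.1 (hφb T)).2
    have hπ := Real.pi_pos
    simp only [hθ]
    rw [← mul_assoc, mul_inv_cancel₀ hπ.ne', one_mul]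
    linarith

end LocalModel

/-! ### The total rotation of the coordinates -/

/-- The sum of the `|x_j|⁻²` over the head without `j = 0`. -/
noncomputable def innerSum (k : ℕ) (x : E n) : ℝ := ∑ j ∈ (head n k).erase 0, (‖x j‖ ^ 2)⁻¹

variable {q : E n → ℂ} {k : ℕ} {ρ C T : ℝ}

theorem innerSum_add (h0 : (0 : Fin (n + 1)) ∈ head n k) (x : E n) :
    (‖x 0‖ ^ 2)⁻¹ + innerSum k x = headSum k x := Finset.add_sum_erase _ (fun j => (‖x j‖ ^ 2)⁻¹) h0

theorem innerSum_nonneg (x : E n) : 0 ≤ innerSum k x :=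
  Finset.sum_nonneg fun _ _ => by positivity

/-- Up to an error which is small near the origin, the angular velocities of `x_2, …, x_k` are
`-|x_j|⁻² / headSum`. -/
theorem IsControlled.sum_speed_le (h : IsControlled q k ρ C) {x : E n} (hx : x ∈ regular n k ρ) :
    ∑ j ∈ (head n k).erase 0, speed q k x j ≤
      -(innerSum k x / headSum k x) + 8 * (n + 1) * C ^ 2 * ‖x 0‖ ^ 2 := by
  have hC := h.one_le
  have hS := h.headSum_pos hx
  have hD := h.denom_pos hx
  have hB := h.abs_corr_le hx
  have hhalf := h.half_headSum_le_denom hx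
  set Γ := ∑ j ∈ (head n k).erase 0, gam q x j with hΓ
  have hΓb : |Γ| ≤ (n + 1) * C ^ 2 := by
    refine (Finset.abs_sum_le_sum_abs _ _).trans ?_
    refine (Finset.sum_le_sum fun j hj => h.abs_gam_le hx (Finset.mem_of_mem_erase hj)).trans ?_
    rw [Finset.sum_const, nsmul_eq_mul]
    have h1 : (((head n k).erase 0).card : ℝ) ≤ n + 1 := by
      exact_mod_cast (Finset.card_le_univ _).trans (by simp)
    have h2 : C ≤ C ^ 2 := le_self_pow₀ hC (by norm_num)
    gcongr
  have hsum : ∑ j ∈ (head n k).erase 0, speed q k x j = -(innerSum k x + Γ) / denom q k x := by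
    rw [innerSum, hΓ, ← Finset.sum_add_distrib, ← Finset.sum_neg_distrib, Finset.sum_div]
    refine Finset.sum_congr rfl fun j hj => ?_
    have hj0 : ¬ (j : ℕ) = 0 := fun e => (Finset.mem_erase.1 hj).1 (Fin.ext e)
    rw [speed, sgn, if_neg hj0, one_mul]
  have hI : innerSum k x ≤ headSum k x := by
    rw [← innerSum_add h.zero_mem_head]
    have : 0 ≤ (‖x 0‖ ^ 2)⁻¹ := by positivity
    linarith
  have hI0 := innerSum_nonneg (k := k) x
  have hinv : (headSum k x)⁻¹ ≤ ‖x 0‖ ^ 2 := by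
    rw [inv_le_comm₀ hS (pow_pos (coord_pos hx h.zero_mem_head) 2)]
    exact inv_sq_le h.zero_mem_head
  rw [hsum, ← sub_le_iff_le_add']
  have e1 : -(innerSum k x + Γ) / denom q k x - -(innerSum k x / headSum k x) =
      (innerSum k x * corr q k x - Γ * headSum k x) / (headSum k x * denom q k x) := by
    have hdc : denom q k x = headSum k x + corr q k x := rfl
    field_simp
    rw [hdc]
    ring
  have e2 : innerSum k x * corr q k x - Γ * headSum k x ≤
      headSum k x * (4 * (n + 1) * C ^ 2) := by
    have h1 : innerSum k x * corr q k x ≤ headSum k x * (3 * (n + 1) * C ^ 2) :=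
      (mul_le_mul_of_nonneg_left ((le_abs_self _).trans hB) hI0).trans
        (mul_le_mul_of_nonneg_right hI (by positivity))
    have h2 : -Γ * headSum k x ≤ ((n + 1) * C ^ 2) * headSum k x := by
      gcongr
      exact (neg_le_abs Γ).trans hΓb
    linarith
  rw [e1]
  calc _ ≤ headSum k x * (4 * (n + 1) * C ^ 2) / (headSum k x * denom q k x) := by gcongr
    _ = 4 * (n + 1) * C ^ 2 / denom q k x := by field_simp
    _ ≤ 4 * (n + 1) * C ^ 2 / (headSum k x / 2) := by gcongr
    _ = 8 * (n + 1) * C ^ 2 * (headSum k x)⁻¹ := by field_simp; ring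
    _ ≤ _ := by gcongr

/-- The angles by which `x_2, …, x_k` turn along an orbit; the bound for the angular velocities is
constant along the orbit. -/
theorem IsOrbit.sum_angle_le {x : ℝ → E n} (hx : IsOrbit q k ρ T x) (h : IsControlled q k ρ C)
    (hT : 0 ≤ T) {s : ℝ → Fin (n + 1) → ℝ} (hs0 : s 0 = 0) (hsz : ∀ t, ∀ j ∉ head n k, s t j = 0)
    (hs : ∀ j ∈ head n k, ∀ t ∈ Set.Icc 0 T,
      HasDerivWithinAt (fun τ => s τ j) (speed q k (x t) j) (Set.Icc 0 T) t) :
    ∑ j ∈ Finset.univ.erase 0, s T j ≤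
      T * (-(innerSum k (x 0) / headSum k (x 0)) + 8 * (n + 1) * C ^ 2 * ‖x 0 0‖ ^ 2) := by
  have h0 := h.zero_mem_head
  have e : ∑ j ∈ Finset.univ.erase 0, s T j = ∑ j ∈ (head n k).erase 0, s T j := by
    refine (Finset.sum_subset (Finset.erase_subset_erase _ (Finset.subset_univ _)) ?_).symm
    intro j hj hj'
    exact hsz _ j fun hjh => hj' (Finset.mem_erase.2 ⟨(Finset.mem_erase.1 hj).1, hjh⟩)
  rw [e]
  have hd : ∀ t ∈ Set.Icc 0 T, HasDerivWithinAt (fun τ => ∑ j ∈ (head n k).erase 0, s τ j)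
      (∑ j ∈ (head n k).erase 0, speed q k (x t) j) (Set.Icc 0 T) t := fun t ht =>
    HasDerivWithinAt.fun_sum fun j hj => hs j (Finset.mem_of_mem_erase hj) t ht
  set b := -(innerSum k (x 0) / headSum k (x 0)) + 8 * (n + 1) * C ^ 2 * ‖x 0 0‖ ^ 2 with hb
  refine image_le_of_deriv_right_le_deriv_boundary (B := fun t => t * b) (B' := fun _ => b)
    (fun t ht => (hd t ht).continuousWithinAt)
    (fun t ht => (hd t ⟨ht.1, ht.2.le⟩).mono_of_mem_nhdsWithin (Icc_mem_nhdsGE_of_mem ht))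
    (by simp [hs0]) (by fun_prop)
    (fun t _ => by simpa using ((hasDerivAt_id t).mul_const b).hasDerivWithinAt)
    (fun t ht => ?_) ⟨hT, le_rfl⟩
  have ht' : t ∈ Set.Icc 0 T := ⟨ht.1, ht.2.le⟩
  have hn : ∀ j ∈ head n k, ‖x t j‖ = ‖x 0 j‖ := fun j hj => hx.norm_coord_eq h ht' hj
  have h1 := h.sum_speed_le (hx.mem t ht')
  have h2 : innerSum k (x t) = innerSum k (x 0) :=
    Finset.sum_congr rfl fun j hj => by rw [hn j (Finset.mem_of_mem_erase hj)]
  rwa [h2, headSum_congr hn, hn 0 h0] at h1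

/-- The factors `|y_3|, …, |y_k|` of `|y_2 ⋯ y_k|` are bounded below by the
smallest one, `|y_3|`. -/
theorem norm_tailProd_ge (hk : 2 ≤ k) (hn : 2 ≤ n) (hkn : k ≤ n + 1) (y : E n)
    (hord : ∀ i j : Fin (n + 1), 1 ≤ (i : ℕ) → i ≤ j → (j : ℕ) < k → ‖y i‖ ≤ ‖y j‖) :
    ‖y ⟨1, by omega⟩‖ * ‖y ⟨2, by omega⟩‖ ^ (k - 2) ≤ ‖tailProd k y‖ := by
  set A := Finset.univ.filter fun j : Fin (n + 1) => 2 ≤ (j : ℕ) ∧ (j : ℕ) < k with hA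
  have hins : (Finset.univ.filter fun j : Fin (n + 1) => 0 < (j : ℕ) ∧ (j : ℕ) < k) =
      insert ⟨1, by omega⟩ A := by
    ext j
    simp only [hA, Finset.mem_insert, Finset.mem_filter_univ, Fin.ext_iff]
    omega
  have hcard : A.card = k - 2 := by
    have : A.map Fin.valEmbedding = Finset.Ico 2 k := by
      ext m
      simp only [hA, Finset.mem_map, Finset.mem_filter_univ, Fin.valEmbedding_apply,
        Finset.mem_Ico]
      exact ⟨fun ⟨j, hj, e⟩ => e ▸ hj, fun hm => ⟨⟨m, by omega⟩, hm, rfl⟩⟩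
    rw [← Finset.card_map Fin.valEmbedding, this, Nat.card_Ico]
  rw [tailProd, hins, Finset.prod_insert (by simp [hA]), norm_mul, norm_prod, ← hcard,
    ← Finset.prod_const]
  gcongr with j hj
  have hj' := (Finset.mem_filter.1 hj).2
  exact hord _ _ (by simp) (Fin.mk_le_of_le_val hj'.1) hj'.2

/-- In `S' / S = S' / (|y_1|⁻² + S')`, the sum `S'` is bounded below by `|y_2|⁻²`, and the ratio
`|y_2| / |y_1|` is bounded above in terms of `ζ` and `y_3`. The assumption `hζ` holds for points of
the fibre over `ζ` with `|y_3| ≤ |q(y)|`. For `k = 2` the coordinate `y_3` is not subject to the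
ordering. -/
theorem fraction_le_innerSum_div (hk : 2 ≤ k) (hn : 2 ≤ n) (hkn : k ≤ n + 1) {y : E n}
    (hy : ∀ j ∈ head n k, y j ≠ 0)
    (hord : ∀ i j : Fin (n + 1), 1 ≤ (i : ℕ) → i ≤ j → (j : ℕ) < k → ‖y i‖ ≤ ‖y j‖) {ζ : ℂ}
    (hζ : ‖y ⟨2, by omega⟩‖ * ‖tailProd k y‖ ≤ ‖ζ‖ * ‖y 0‖) (hζ0 : ζ ≠ 0) :
    ‖y ⟨2, by omega⟩‖ ^ (2 * (k - 1)) / (‖y ⟨2, by omega⟩‖ ^ (2 * (k - 1)) + ‖ζ‖ ^ 2) ≤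
      innerSum k y / headSum k y := by
  have h0 : (0 : Fin (n + 1)) ∈ head n k := mem_head.2 (by simp; omega)
  have h1 : (⟨1, by omega⟩ : Fin (n + 1)) ∈ (head n k).erase 0 :=
    Finset.mem_erase.2 ⟨by simp [Fin.ext_iff], mem_head.2 (by simp; omega)⟩
  have hr0 : 0 < ‖y 0‖ := norm_pos_iff.2 (hy 0 h0)
  have hr1 : 0 < ‖y ⟨1, by omega⟩‖ := norm_pos_iff.2 (hy _ (Finset.mem_of_mem_erase h1))
  have hI : (‖y ⟨1, by omega⟩‖ ^ 2)⁻¹ ≤ innerSum k y :=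
    Finset.single_le_sum (f := fun j => (‖y j‖ ^ 2)⁻¹) (fun _ _ => by positivity) h1
  have hz : 0 < ‖ζ‖ := norm_pos_iff.2 hζ0
  have hT := norm_tailProd_ge hk hn hkn y hord
  rw [← innerSum_add h0, mul_comm 2, pow_mul]
  set r₀ := ‖y 0‖ with hr₀
  set r₁ := ‖y ⟨1, by omega⟩‖ with hr₁
  set a := ‖y ⟨2, by omega⟩‖ with ha
  have ha0 : 0 ≤ a := norm_nonneg _
  have hkey : a ^ (k - 1) * r₁ ≤ ‖ζ‖ * r₀ := by
    refine le_trans (le_trans (le_of_eq ?_) (mul_le_mul_of_nonneg_left hT ha0)) hζ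
    rw [show k - 1 = k - 2 + 1 by omega, pow_succ]
    ring
  set A := a ^ (k - 1) with hA
  have hA0 : 0 ≤ A := by positivity
  have hI0 : 0 < innerSum k y := lt_of_lt_of_le (by positivity) hI
  have hinv0 : 0 < (r₀ ^ 2)⁻¹ := by positivity
  have hsq : (A * r₁) ^ 2 ≤ (‖ζ‖ * r₀) ^ 2 := by gcongr
  rw [div_le_div_iff₀ (by positivity) (by positivity)]
  have h2 : A ^ 2 * (r₀ ^ 2)⁻¹ ≤ innerSum k y * ‖ζ‖ ^ 2 := by
    calc A ^ 2 * (r₀ ^ 2)⁻¹ = (A * r₁) ^ 2 * ((r₁ ^ 2)⁻¹ * (r₀ ^ 2)⁻¹) := by field_simp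
      _ ≤ (‖ζ‖ * r₀) ^ 2 * ((r₁ ^ 2)⁻¹ * (r₀ ^ 2)⁻¹) := by gcongr
      _ = (r₁ ^ 2)⁻¹ * ‖ζ‖ ^ 2 := by field_simp
      _ ≤ _ := by gcongr
  linarith

theorem eventually_mul_lt (a : ℝ) {b : ℝ} (hb : 0 < b) :
    ∀ᶠ δ : ℝ in nhdsWithin 0 (Set.Ioi 0), a * δ < b := by
  have h : Filter.Tendsto (fun δ : ℝ => a * δ) (nhdsWithin 0 (Set.Ioi 0)) (nhds (a * 0)) :=
    (Continuous.tendsto (by fun_prop) 0).mono_left nhdsWithin_le_nhds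
  rw [mul_zero] at h
  exact h.eventually_lt_const hb

namespace LocalModel

variable {k : ℕ} (M : LocalModel n k)

/-- On the fibres over `ζ ≠ 0` the coordinates `y_1, …, y_k` do not vanish, as `y_2 ⋯ y_k` divides
`p`. -/
theorem mem_regular_of_mem_fiber {ρ : ℝ} {ζ : ℂ} (hζ : ζ ≠ 0) {y : E n} (hy : y ∈ M.fiber ζ)
    (hyρ : ‖y‖ < ρ) : y ∈ regular n k ρ := by
  obtain ⟨⟨hyR, hy0⟩, hp⟩ := hy
  refine ⟨by simpa using hyρ, fun j hj => ?_⟩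
  by_cases hj0 : (j : ℕ) = 0
  · have : j = 0 := Fin.ext hj0
    rwa [this]
  · have ht : tailProd k y ≠ 0 := by
      intro ht
      apply hζ
      rw [← hp, M.factor y hyR hy0, ht]
      simp
    exact Finset.prod_ne_zero_iff.1 ht j
      ((Finset.mem_filter_univ _).2 ⟨Nat.pos_of_ne_zero hj0, mem_head.1 hj⟩)

end LocalModel

end SeidelLocal

open SeidelLocal

theorem mainTheorem6 (n k : ℕ) (hn : 2 ≤ n) (hk : 2 ≤ k) (hkn : k ≤ n + 1)
    (M : SeidelLocal.LocalModel n k) (d : ℕ) (hd : 0 < d) (ε : ℝ) (hε : 0 < ε) :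
    ∃ δ₁ δ₂ : ℝ, 0 < δ₂ ∧ δ₂ < δ₁ ∧ δ₁ ≤ M.R ∧
      ∀ ζ : ℂ, 0 < ‖ζ‖ → ‖ζ‖ < δ₁ →
      ∀ y ∈ M.fiber ζ, ‖y‖ < δ₁ → δ₂ < ‖y 0‖ →
        ∃ (U : Set (SeidelLocal.E n)) (ψ : ℝ → SeidelLocal.E n → SeidelLocal.E n),
          IsOpen U ∧ y ∈ U ∧ M.IsParallelTransport (2 * Real.pi * d) U ψ ∧
          ∀ Λ : Submodule ℝ (SeidelLocal.E n), M.IsLagrangian y Λ →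
            ∃ a : ℝ, M.IsGradedPhase (2 * Real.pi * d) ψ y Λ a ∧
              ((∀ i j : Fin (n + 1), 1 ≤ (i : ℕ) → i ≤ j → (j : ℕ) < k → ‖y i‖ ≤ ‖y j‖) →
                a ≤ -2 * d *
                    (‖y ⟨2, by omega⟩‖ ^ (2 * (k - 1)) /
                      (‖y ⟨2, by omega⟩‖ ^ (2 * (k - 1)) + ‖ζ‖ ^ 2))
                  + n + 1 + ε) := by
  obtain ⟨ρ, C, hρ0, hρR, h⟩ := M.exists_isControlled (by omega)
  have hC := h.one_le
  have hπ := Real.pi_pos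
  set T : ℝ := 2 * Real.pi * d with hT
  have hT0 : 0 ≤ T := by positivity
  obtain ⟨K, -, hK⟩ := exists_linearization_bound n hC hT0
  obtain ⟨c₀, hc₀, hdet⟩ := exists_frameDet_shear_lower_bound n 6 T
  obtain ⟨ε₁, hε₁, harg⟩ := exists_arg_close_one (half_pos hε)
  obtain ⟨Θ, hΘs, hΘ, hΘ0⟩ := M.extends_smoothly
  have hnhds : Metric.ball (0 : E n) M.R ∈ nhds 0 := Metric.ball_mem_nhds _ M.R_pos
  have hqc : ContinuousAt M.q 0 := M.q_smooth.continuousOn.continuousAt hnhds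
  obtain ⟨δf, hδf, hform⟩ := exists_form_close (hΘs.continuousOn.continuousAt hnhds) hΘ0 hqc
    M.q_zero (1 + T * (6 * (n + 1) ^ 2)) hc₀ hε₁
  obtain ⟨δq, hδq, hq⟩ : ∃ δq > 0, ∀ x : E n, ‖x‖ < δq → 1 / 2 < ‖M.q x‖ := by
    have h1 : ∀ᶠ x in nhds (0 : E n), 1 / 2 < ‖M.q x‖ :=
      hqc.norm.eventually_const_lt (by norm_num [M.q_zero])
    obtain ⟨δ, hδ, h2⟩ := Metric.eventually_nhds_iff.1 h1
    exact ⟨δ, hδ, fun x hx => h2 (by simpa using hx)⟩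
  -- The flow starting in the ball of radius `δ₁` stays in the ball of radius `A * δ₁`.
  set A : ℝ := (n + 1) * (1 + 4 * C * T) with hA
  obtain ⟨δ₁, ⟨⟨⟨⟨⟨⟨hd1, hd2⟩, hd3⟩, hd4⟩, hd5⟩, hd6⟩, hd7⟩, hδ₁⟩ :=
    (((((((eventually_mul_lt A (half_pos hρ0)).and (eventually_mul_lt A one_pos)).and
      (eventually_mul_lt A hδf)).and (eventually_mul_lt (K * A) hδf)).and
      (eventually_mul_lt 1 (lt_min hδq (half_pos one_pos)))).and
      (eventually_mul_lt (T * (8 * (n + 1) * C ^ 2)) hε)).and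
      (eventually_mul_lt 1 hρ0)).and self_mem_nhdsWithin |>.exists
  have hδ₁0 : 0 < δ₁ := hδ₁
  rw [one_mul] at hd5 hd7
  refine ⟨δ₁, δ₁ / 2, half_pos hδ₁0, half_lt_self hδ₁0, hd7.le.trans hρR.le, ?_⟩
  rintro ζ hζ - y hy hyδ -
  have hζ0 : ζ ≠ 0 := norm_pos_iff.1 hζ
  have hyρ : y ∈ regular n k ρ := M.mem_regular_of_mem_fiber hζ0 hy (hyδ.trans hd7)
  obtain ⟨U, ψ, hyU, hψ, hψb⟩ := h.exists_flow hT0 hd1 hyδ hyρ.2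
  refine ⟨U, ψ, hψ.isOpen, hyU, M.isParallelTransport hρR.le h hψ, fun Λ hΛ => ?_⟩
  have horb := hψ.orbit y hyU
  obtain ⟨s, hs0, hsz, hsd, hsx⟩ := horb.exists_angle h hT0
  have hsc : ∀ j, ContinuousOn (fun t => s t j) (Set.Icc 0 T) := fun j => by
    by_cases hj : j ∈ head n k
    · exact fun t ht => (hsd j hj t ht).continuousWithinAt
    · simp only [hsz _ j hj]
      exact continuousOn_const
  have hψ0 := hψ.zero y hyU
  have hlin : ∀ v, (dlog M.q k y v).re = 0 → ‖v‖ = 1 → ∀ t ∈ Set.Icc 0 T,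
      ‖rotate (-s t) (fderiv ℝ (ψ t) y v) -
        (v + t • shear (unitCoord y) (symCoeff k y) v)‖ ≤ δf := by
    intro v hv hv1 t ht
    have h1 := hK (w := fun t => fderiv ℝ (ψ t) y v) h horb hd2.le (hψb y hyU)
      (hψ.variation y hyU v) (fun t ht => by rw [M.dlog_flow hρR.le h hψ hyU ht, hv])
      hs0 hsz hsd hsx t ht
    simp only [hψ0, LocalModel.fderiv_flow_zero hψ hyU, hv1, mul_one] at h1
    exact h1.trans (by rw [← mul_assoc]; exact hd4.le)
  obtain ⟨a, ha, hab⟩ := M.exists_isGradedPhase hT0 hρR.le h hψ hyU hΘs.continuousOn hΘ hs0 hsc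
    (fun t ht => by rw [hsx 0 h.zero_mem_head t ht, hψ0])
    (fun t ht => (hψb y hyU t ht).trans_lt hd3) hlin hform harg hc₀
    (fun V t hV ht => hdet _ _ V t (norm_unitCoord_le y) (h.abs_symCoeff_le hyρ)
      (symCoeff_comm k y) hV ht) hΛ
  refine ⟨a, ha, fun hord => ?_⟩
  have hδhalf : δ₁ ≤ 1 / 2 := hd5.le.trans (min_le_right _ _)
  -- This follows from `ζ y_1 = y_2 ⋯ y_k q(y)` and `|y_3| ≤ 1 / 2 ≤ |q(y)|`.
  have hζy : ‖y ⟨2, by omega⟩‖ * ‖tailProd k y‖ ≤ ‖ζ‖ * ‖y 0‖ := by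
    have h1 : ζ * y 0 = tailProd k y * M.q y := by
      have hy0 : y 0 ≠ 0 := hy.1.2
      rw [← hy.2, M.factor y hy.1.1 hy0]
      field_simp
    rw [← norm_mul ζ, h1, norm_mul, mul_comm]
    have h2 := hq y (hyδ.trans (hd5.trans_le (min_le_left _ _)))
    have h3 := norm_coord_le y ⟨2, by omega⟩
    gcongr
    linarith
  have hfrac := fraction_le_innerSum_div hk hn hkn hyρ.2 hord hζy hζ0
  have hang := horb.sum_angle_le h hT0 hs0 hsz hsd
  rw [hψ0] at hang
  set f := ‖y ⟨2, by omega⟩‖ ^ (2 * (k - 1)) /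
    (‖y ⟨2, by omega⟩‖ ^ (2 * (k - 1)) + ‖ζ‖ ^ 2) with hf
  have hsmall : T * (8 * (n + 1) * C ^ 2 * ‖y 0‖ ^ 2) ≤ ε := by
    have h1 : ‖y 0‖ ≤ δ₁ := (norm_coord_le y 0).trans hyδ.le
    have h2 : ‖y 0‖ ^ 2 ≤ δ₁ := by
      rw [sq, ← mul_one δ₁]
      exact mul_le_mul h1 (by linarith) (norm_nonneg _) hδ₁0.le
    calc T * (8 * (n + 1) * C ^ 2 * ‖y 0‖ ^ 2) ≤ T * (8 * (n + 1) * C ^ 2 * δ₁) := by gcongr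
      _ = T * (8 * (n + 1) * C ^ 2) * δ₁ := by ring
      _ ≤ ε := hd6.le
  have hTf : T * f ≤ T * (innerSum k y / headSum k y) := by gcongr
  -- The errors are `ε` from the total rotation and `2 * (ε / 2)` from the factor close to one;
  -- their sum is less than `π ε`.
  have hπ3 := Real.pi_gt_three
  have hfinal : Real.pi * a ≤ Real.pi * (-2 * d * f + n + 1 + ε) := by
    have e1 : Real.pi * (-2 * d * f + n + 1 + ε) = -(T * f) + (n + 1) * Real.pi + Real.pi * ε := by
      rw [hT]; ring
    have e2 : 3 * ε ≤ Real.pi * ε := by gcongr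
    rw [e1]
    linarith
  exact le_of_mul_le_mul_left hfinal hπ
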